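/- Conventions. Manifolds are smooth, connected, Hausdorff and second countable. For an $n$-dimensional manifold $M$, $L^r$ denotes the real line bundle associated to the frame bundle via $|\det|^{r/n}$, and $L=L^1$ is the weight bundle; $\Lambda^k_0M=\Lambda^kM\otimes L^k$ is the bundle of weightless $k$-forms. A conformal structure $c$ is a smooth symmetric positive definite bilinear form on $TM$ with values in $L^2$ (of determinant $1$ in the canonical sense, i.e. a reduction of the frame bundle to $\mathrm{CO}(n)$). A Weyl structure on $(M,c)$ is a torsion-free connection $D$ on $TM$ with $Dc=0$, where $D$ also denotes the induced connection on all weighted tensor bundles; $D$ is closed if $L$ has a nowhere vanishing $D$-parallel local section around every point. Let $(M_1,c_1)$ and $(M_2,c_2)$ be conformal manifolds of dimensions $n_1,n_2\ge 1$, and let $c$ be a conformal product structure on $M=M_1\times M_2$: the projections $p_i:(M,c)\to(M_i,c_i)$ are conformal submersions (i.e. $dp_i$ restricted to $(\ker dp_i)^\perp$ is a conformal isomorphism onto $TM_i$) and $H_1=\ker dp_2$ and $H_2=\ker dp_1$ are $c$-orthogonal. Let $D$ be the adapted Weyl structure, i.e. the unique Weyl structure on $(M,c)$ preserving the splitting $TM=H_1\oplus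 H_2$. The conformal product is called closed if $D$ is closed. The bundle $p_i^*(\Lambda^k_0M_i)$ is regarded as a subbundle of $\Lambda^k_0M$, using the identification of $L$ with the pull-back of the weight bundle of $M_i$ which matches $\sqrt{c(X,X)}$ with $\sqrt{c_i(dp_i X,dp_i X)}$ for $0\ne X\in(\ker dp_i)^\perp$. (1) If for some $1\le k\le n_1-1$ there is a smooth section $\omega$ of $p_1^*(\Lambda^k_0M_1)$, not identically zero, with $D\omega=0$, then the conformal product is closed. (2) In other words, if the conformal product is not closed, then the only parallel weightless forms of pure type are the volume forms of the factors: for $i\in\{1,2\}$, $k\ge 1$ and any smooth section $\omega$ of $p_i^*(\Lambda^k_0M_i)$ that is not identically zero, $D\omega=0$ if and only if $k=n_i$ and $\omega$ is a nonzero constant multiple of the pull-back of a weightless volume form of $M_i$, that is, of a section of $\Lambda^{n_i}_0M_i\cong\mathbb{R}$ (the isomorphism being canonical up to sign) equal to $\pm1$ at each point (in particular $M_i$ is orientable). -/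

import Mathlib

open Module
open scoped Manifold ContDiff Topology

noncomputable section

/-- The space `L^r(V)` of weights of degree `r` of an `n`-dimensional real vector space `V`: the fibre
of the line bundle associated to the frame bundle via the representation `|det| ^ (r / n)` of
`GL(n, ℝ)`, that is, the functions `l` on the frames of `V` such that
`l (b A) = |det A| ^ (- r / n) * l b`. -/
def Weight (n : ℕ) (V : Type*) [AddCommGroup V] [Module ℝ V] (r : ℝ) :
    Submodule ℝ (Basis (Fin n) ℝ V → ℝ) where
  carrier := {l | ∀ b b' : Basis (Fin n) ℝ V, l b' = |b.det b'| ^ (-(r / n)) * l b}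
  add_mem' := by
    intro l l' hl hl' b b'
    simp only [Pi.add_apply, hl b b', hl' b b', mul_add]
  zero_mem' := by
    intro b b'
    simp
  smul_mem' := by
    intro a l hl b b'
    simp only [Pi.smul_apply, smul_eq_mul, hl b b']
    ring

section Manifold

variable {E : Type*} [NormedAddCommGroup E] [NormedSpace ℝ E]
  {H : Type*} [TopologicalSpace H] (I : ModelWithCorners ℝ E H)
  (M : Type*) [TopologicalSpace M] [ChartedSpace H M]

/-- The fibre at `x` of the weight bundle `L^r` of the manifold `M`. -/
abbrev WeightAt {M : Type*} [TopologicalSpace M] [ChartedSpace H M] (r : ℝ) (x : M) : Type _ :=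
  Weight (finrank ℝ E) (TangentSpace I x) r

/-- A choice of a frame of the tangent space at each point (with no regularity). -/
abbrev FrameField : Type _ :=
  ∀ x : M, Basis (Fin (finrank ℝ E)) ℝ (TangentSpace I x)

/-- Exterior `k`-forms on `M` with values in `L^r` (with no regularity), that is, sections of
`Λ^k M ⊗ L^r`. -/
abbrev WeightedForm (k : ℕ) (r : ℝ) : Type _ :=
  ∀ x : M, TangentSpace I x [⋀^Fin k]→ₗ[ℝ] WeightAt I r x

/-- Weightless `k`-forms on `M` (with no regularity): sections of `Λ^k_0 M = Λ^k M ⊗ L^k`. -/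
abbrev WeightlessForm (k : ℕ) : Type _ := WeightedForm I M k (k : ℝ)

variable {M}

/-- The vector field `Y` is smooth on `U`. -/
def SmoothFieldOn [IsManifold I ∞ M] (Y : ∀ x : M, TangentSpace I x) (U : Set M) : Prop :=
  ContMDiffOn I I.tangent ∞ (fun x => (⟨x, Y x⟩ : TangentBundle I M)) U

variable {I}

/-- The frame field `e` is a smooth frame on `U`. -/
def FrameField.SmoothOn [IsManifold I ∞ M] (e : FrameField I M) (U : Set M) : Prop :=
  ∀ j : Fin (finrank ℝ E), SmoothFieldOn I (fun x => e x j) U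

/-- The section `l` of `L^r` is smooth on the open set `U`: its coefficient with respect to every
local smooth frame is smooth. -/
def WeightSmoothOn [IsManifold I ∞ M] {r : ℝ} (l : ∀ x : M, WeightAt I r x) (U : Set M) : Prop :=
  ∀ W : Set M, IsOpen W → W ⊆ U → ∀ e : FrameField I M, e.SmoothOn W →
    ContMDiffOn I 𝓘(ℝ, ℝ) ∞ (fun x => (l x).1 (e x)) W

/-- The weighted form `φ` is smooth: its coefficients with respect to every local smooth frame are
smooth. -/
def WeightedForm.Smooth [IsManifold I ∞ M] {k : ℕ} {r : ℝ} (φ : WeightedForm I M k r) : Prop :=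
  ∀ W : Set M, IsOpen W → ∀ e : FrameField I M, e.SmoothOn W →
    ∀ s : Fin k → Fin (finrank ℝ E),
      ContMDiffOn I 𝓘(ℝ, ℝ) ∞ (fun x => (φ x (fun i => e x (s i))).1 (e x)) W

variable (I M)

/-- A (smooth) conformal structure on `M`: a symmetric positive definite bilinear form `c` on `TM`
with values in `L²`. The determinant of such a form, `det (c (b i) (b j)) (b)`, is a positive number
that does not depend on the frame `b`; as usual it is normalized to be `1`, which makes conformal
structures the same thing as reductions of the frame bundle to `CO(n)`. -/
structure ConformalStructure [IsManifold I ∞ M] where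
  /-- the `L²`-valued scalar product -/
  inner : ∀ x : M, TangentSpace I x →ₗ[ℝ] TangentSpace I x →ₗ[ℝ] WeightAt I 2 x
  symm : ∀ (x : M) (X Y : TangentSpace I x), inner x X Y = inner x Y X
  pos : ∀ (x : M) (X : TangentSpace I x), X ≠ 0 →
    ∀ b : Basis (Fin (finrank ℝ E)) ℝ (TangentSpace I x), 0 < (inner x X X).1 b
  normalized : ∀ (x : M) (b : Basis (Fin (finrank ℝ E)) ℝ (TangentSpace I x)),
    (Matrix.of fun i j => (inner x (b i) (b j)).1 b).det = 1
  smooth : ∀ W : Set M, IsOpen W → ∀ e : FrameField I M, e.SmoothOn W →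
    ∀ i j : Fin (finrank ℝ E),
      ContMDiffOn I 𝓘(ℝ, ℝ) ∞ (fun x => (inner x (e x i) (e x j)).1 (e x)) W

variable {I M}

/-- The connection on `L^r` induced by a connection `cov` on `TM`: the value on the frame `e x` of
the covariant derivative at `x`, in the direction `v`, of a section `l` of `L^r`. Here `e` is a local
smooth frame around `x`; writing `D_v e_j = ∑ i, A i j • e_i`, this is `v (l (e)) + (r / n) tr(A) l (e)`. -/
def weightDeriv [IsManifold I ∞ M]
    (cov : CovariantDerivative I E (TangentSpace I : M → Type _)) {r : ℝ}
    (l : ∀ x : M, WeightAt I r x) (e : FrameField I M) (x : M) (v : TangentSpace I x) : ℝ :=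
  mvfderiv I (fun y => (l y).1 (e y)) x v
    + (r / (finrank ℝ E : ℝ)) * (∑ j, (e x).repr (cov (fun y => e y j) x v) j) * (l x).1 (e x)

/-- The section `l` of `L^r` is parallel on the open set `U` for the induced connection. -/
def WeightParallelOn [IsManifold I ∞ M]
    (cov : CovariantDerivative I E (TangentSpace I : M → Type _)) {r : ℝ}
    (l : ∀ x : M, WeightAt I r x) (U : Set M) : Prop :=
  ∀ W : Set M, IsOpen W → W ⊆ U → ∀ e : FrameField I M, e.SmoothOn W →
    ∀ x ∈ W, ∀ v : TangentSpace I x, weightDeriv cov l e x v = 0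

/-- The weighted form `φ` is parallel for the connection induced on `Λ^k M ⊗ L^r`:
`D_v (φ (Y_1, …, Y_k)) = ∑ i, φ (Y_1, …, D_v Y_i, …, Y_k)` for all local vector fields. -/
def WeightedForm.Parallel [IsManifold I ∞ M]
    (cov : CovariantDerivative I E (TangentSpace I : M → Type _)) {k : ℕ} {r : ℝ}
    (φ : WeightedForm I M k r) : Prop :=
  ∀ W : Set M, IsOpen W → ∀ e : FrameField I M, e.SmoothOn W →
    ∀ Y : Fin k → ∀ x : M, TangentSpace I x, (∀ i, SmoothFieldOn I (Y i) W) →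
    ∀ x ∈ W, ∀ v : TangentSpace I x,
      weightDeriv cov (fun y => φ y (fun i => Y i y)) e x v
        = ∑ i, (φ x (Function.update (fun j => Y j x) i (cov (Y i) x v))).1 (e x)

/-- A Weyl structure on the conformal manifold `(M, c)`: a smooth torsion-free connection `D` on `TM`
such that `D c = 0`, that is, `D_v (c (Y, Z)) = c (D_v Y, Z) + c (Y, D_v Z)` with the induced connection
on `L²` on the left-hand side. -/
structure WeylStructure [FiniteDimensional ℝ E] [IsManifold I ∞ M]
    (c : ConformalStructure I M) where
  /-- the covariant derivative on the tangent bundle -/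
  cov : CovariantDerivative I E (TangentSpace I : M → Type _)
  smooth : cov.ContMDiffCovariantDerivative ∞
  torsion_eq_zero :
    haveI : CompleteSpace E := FiniteDimensional.complete ℝ E
    cov.torsion = 0
  conformal : ∀ W : Set M, IsOpen W → ∀ e : FrameField I M, e.SmoothOn W →
    ∀ Y Z : ∀ x : M, TangentSpace I x, SmoothFieldOn I Y W → SmoothFieldOn I Z W →
    ∀ x ∈ W, ∀ v : TangentSpace I x,
      weightDeriv cov (fun y => c.inner y (Y y) (Z y)) e x v
        = (c.inner x (cov Y x v) (Z x)).1 (e x) + (c.inner x (Y x) (cov Z x v)).1 (e x)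

/-- The Weyl structure `D` is closed: around every point, the weight bundle `L` carries a nowhere
vanishing `D`-parallel smooth local section. -/
def WeylStructure.Closed [FiniteDimensional ℝ E] [IsManifold I ∞ M]
    {c : ConformalStructure I M} (D : WeylStructure c) : Prop :=
  ∀ x : M, ∃ U : Set M, IsOpen U ∧ x ∈ U ∧ ∃ l : ∀ y : M, WeightAt I 1 y,
    WeightSmoothOn l U ∧ (∀ y ∈ U, l y ≠ 0) ∧ WeightParallelOn D.cov l U

/-- A weightless volume form: a smooth section `η` of `Λ^n_0 M`, with `n = dim M`, which is `1` or `-1`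
at each point under the canonical isomorphism (up to sign) `Λ^n_0 M ≅ ℝ`; equivalently, it has norm
one for every conformal structure. It exists if and only if `M` is orientable. -/
def IsWeightlessVolumeForm [IsManifold I ∞ M] {k : ℕ} (η : WeightlessForm I M k) : Prop :=
  WeightedForm.Smooth η ∧ ∃ h : k = finrank ℝ E,
    ∀ (x : M) (b : Basis (Fin (finrank ℝ E)) ℝ (TangentSpace I x)),
      |(η x (fun i => b (Fin.cast h i))).1 b| = 1

/-! ### Conformal submersions and pull-back of weighted forms -/

variable {E' : Type*} [NormedAddCommGroup E'] [NormedSpace ℝ E']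
  {H' : Type*} [TopologicalSpace H'] {I' : ModelWithCorners ℝ E' H'}
  {N : Type*} [TopologicalSpace N] [ChartedSpace H' N]

/-- `X` is orthogonal to the kernel of the differential of `p` at `x`. -/
def IsHorizontal [IsManifold I ∞ M] (I' : ModelWithCorners ℝ E' H')
    (c : ConformalStructure I M) (p : M → N) (x : M) (X : TangentSpace I x) : Prop :=
  ∀ V : TangentSpace I x, mfderiv I I' p x V = 0 → c.inner x X V = 0

/-- `p : (M, c) → (N, c')` is a conformal submersion: a smooth submersion whose differential, restricted
to `(ker dp)^⊥`, is at each point a conformal isomorphism onto the tangent space of `N`. (As `c` and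
`c'` take values in the lines `L²` of `M` and `N`, conformal means that `c'(dp X, dp Y)` corresponds to
`c(X, Y)` through an isomorphism between these lines.) -/
structure IsConformalSubmersion [IsManifold I ∞ M] [IsManifold I' ∞ N]
    (c : ConformalStructure I M) (c' : ConformalStructure I' N) (p : M → N) : Prop where
  contMDiff : ContMDiff I I' ∞ p
  submersion : ∀ x : M, Function.Surjective (mfderiv I I' p x)
  conformal : ∀ x : M, ∃ P : WeightAt I 2 x ≃ₗ[ℝ] WeightAt I' 2 (p x),
    ∀ X Y : TangentSpace I x, IsHorizontal I' c p x X → IsHorizontal I' c p x Y →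
      c'.inner (p x) (mfderiv I I' p x X) (mfderiv I I' p x Y) = P (c.inner x X Y)

/-- For a conformal submersion `p`, the weight `l ∈ L^r` at `x` is the pull-back of the weight `l'` at
`p x` under the canonical identification of the weight bundle of `M` with the pull-back of that of
`N`, which matches `√c(X, X)` with `√c'(dp X, dp X)` for `X ∈ (ker dp)^⊥` nonzero. -/
def IsWeightPullbackAt [IsManifold I ∞ M] [IsManifold I' ∞ N]
    (c : ConformalStructure I M) (c' : ConformalStructure I' N) (p : M → N) {r : ℝ} (x : M)
    (l : WeightAt I r x) (l' : WeightAt I' r (p x)) : Prop :=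
  ∀ X : TangentSpace I x, X ≠ 0 → IsHorizontal I' c p x X →
    ∀ (b : Basis (Fin (finrank ℝ E)) ℝ (TangentSpace I x))
      (b' : Basis (Fin (finrank ℝ E')) ℝ (TangentSpace I' (p x))),
      l.1 b * ((c'.inner (p x) (mfderiv I I' p x X) (mfderiv I I' p x X)).1 b') ^ (r / 2)
        = l'.1 b' * ((c.inner x X X).1 b) ^ (r / 2)

/-- The weighted exterior form `α` on `T_x M` is the pull-back of the weighted exterior form `β` on
`T_{p x} N`. -/
def IsFormPullbackAt [IsManifold I ∞ M] [IsManifold I' ∞ N]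
    (c : ConformalStructure I M) (c' : ConformalStructure I' N) (p : M → N) {k : ℕ} {r : ℝ} (x : M)
    (α : TangentSpace I x [⋀^Fin k]→ₗ[ℝ] WeightAt I r x)
    (β : TangentSpace I' (p x) [⋀^Fin k]→ₗ[ℝ] WeightAt I' r (p x)) : Prop :=
  ∀ Y : Fin k → TangentSpace I x,
    IsWeightPullbackAt c c' p x (α Y) (β fun i => mfderiv I I' p x (Y i))

/-- `φ` is a smooth section over `M` of the pull-back bundle `p^*(Λ^k N ⊗ L^r)`, regarded as a
subbundle of `Λ^k M ⊗ L^r`. -/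
def IsSectionOfPullback [IsManifold I ∞ M] [IsManifold I' ∞ N]
    (c : ConformalStructure I M) (c' : ConformalStructure I' N) (p : M → N) {k : ℕ} {r : ℝ}
    (φ : WeightedForm I M k r) : Prop :=
  WeightedForm.Smooth φ ∧
    ∀ x : M, ∃ β : TangentSpace I' (p x) [⋀^Fin k]→ₗ[ℝ] WeightAt I' r (p x),
      IsFormPullbackAt c c' p x (φ x) β

/-- `φ` is a nonzero constant multiple of the pull-back to `M` of a weightless volume form of `N`
(in particular `k = dim N` and `N` is orientable). -/
def IsPullbackOfVolume [IsManifold I ∞ M] [IsManifold I' ∞ N]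
    (c : ConformalStructure I M) (c' : ConformalStructure I' N) (p : M → N) {k : ℕ}
    (φ : WeightlessForm I M k) : Prop :=
  ∃ η : WeightlessForm I' N k, IsWeightlessVolumeForm η ∧
    ∃ a : ℝ, a ≠ 0 ∧ ∀ x : M, IsFormPullbackAt c c' p x (φ x) (a • η (p x))

end Manifold

section Product

variable {E₁ : Type*} [NormedAddCommGroup E₁] [NormedSpace ℝ E₁]
  {M₁ : Type*} [TopologicalSpace M₁] [ChartedSpace E₁ M₁] [IsManifold 𝓘(ℝ, E₁) ∞ M₁]
  {E₂ : Type*} [NormedAddCommGroup E₂] [NormedSpace ℝ E₂]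
  {M₂ : Type*} [TopologicalSpace M₂] [ChartedSpace E₂ M₂] [IsManifold 𝓘(ℝ, E₂) ∞ M₂]

/-- The conformal structure `c` on `M₁ × M₂` is a conformal product of `(M₁, c₁)` and `(M₂, c₂)`: the
canonical projections are conformal submersions and they are orthogonal, that is, the kernels of
their differentials are orthogonal. -/
structure IsConformalProduct (c₁ : ConformalStructure 𝓘(ℝ, E₁) M₁)
    (c₂ : ConformalStructure 𝓘(ℝ, E₂) M₂)
    (c : ConformalStructure (𝓘(ℝ, E₁).prod 𝓘(ℝ, E₂)) (M₁ × M₂)) : Prop where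
  fst : IsConformalSubmersion c c₁ (Prod.fst : M₁ × M₂ → M₁)
  snd : IsConformalSubmersion c c₂ (Prod.snd : M₁ × M₂ → M₂)
  orthogonal : ∀ (z : M₁ × M₂) (X Y : TangentSpace (𝓘(ℝ, E₁).prod 𝓘(ℝ, E₂)) z),
    mfderiv (𝓘(ℝ, E₁).prod 𝓘(ℝ, E₂)) 𝓘(ℝ, E₁) (Prod.fst : M₁ × M₂ → M₁) z X = 0 →
    mfderiv (𝓘(ℝ, E₁).prod 𝓘(ℝ, E₂)) 𝓘(ℝ, E₂) (Prod.snd : M₁ × M₂ → M₂) z Y = 0 →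
    c.inner z X Y = 0

/-- The Weyl structure `D` is the adapted Weyl structure of the conformal product: the (unique) Weyl
structure that preserves the splitting of the tangent bundle of `M₁ × M₂` into `H₁ = ker dp₂` and
`H₂ = ker dp₁`. -/
def WeylStructure.IsAdapted [FiniteDimensional ℝ E₁] [FiniteDimensional ℝ E₂]
    {c : ConformalStructure (𝓘(ℝ, E₁).prod 𝓘(ℝ, E₂)) (M₁ × M₂)} (D : WeylStructure c) : Prop :=
  ∀ W : Set (M₁ × M₂), IsOpen W →
    ∀ Y : ∀ z : M₁ × M₂, TangentSpace (𝓘(ℝ, E₁).prod 𝓘(ℝ, E₂)) z, SmoothFieldOn _ Y W →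
    ((∀ z ∈ W, mfderiv (𝓘(ℝ, E₁).prod 𝓘(ℝ, E₂)) 𝓘(ℝ, E₂) (Prod.snd : M₁ × M₂ → M₂) z (Y z) = 0) →
      ∀ z ∈ W, ∀ v : TangentSpace (𝓘(ℝ, E₁).prod 𝓘(ℝ, E₂)) z,
        mfderiv (𝓘(ℝ, E₁).prod 𝓘(ℝ, E₂)) 𝓘(ℝ, E₂) (Prod.snd : M₁ × M₂ → M₂) z
          (D.cov Y z v) = 0) ∧
    ((∀ z ∈ W, mfderiv (𝓘(ℝ, E₁).prod 𝓘(ℝ, E₂)) 𝓘(ℝ, E₁) (Prod.fst : M₁ × M₂ → M₁) z (Y z) = 0) →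
      ∀ z ∈ W, ∀ v : TangentSpace (𝓘(ℝ, E₁).prod 𝓘(ℝ, E₂)) z,
        mfderiv (𝓘(ℝ, E₁).prod 𝓘(ℝ, E₂)) 𝓘(ℝ, E₁) (Prod.fst : M₁ × M₂ → M₁) z
          (D.cov Y z v) = 0)

end Product

end

/-!
The weight bundle is trivialized locally by the length of a coordinate vector field `Y₀` tangent to
the first factor (a gauge). Weights, the conformal structure and a weightless form become a
function, a metric `g` and an ordinary form `Φ`, and the Weyl structure acts on `L` through the
1-form `q v = g (D_v Y₀) Y₀` (`WeylStructure.leeForm`): `D c = 0` says that `D g = - 2 q g`, and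
`D φ = 0` that `D Φ = - k q Φ` (`mvfderiv_gaugeMetric`, `mvfderiv_gaugeForm`); no trace of the
connection appears. As `D` is torsion-free and preserves both factors, a coordinate field of one
factor is parallel in the directions of the other (`IsAdaptedPair.cov_inl_inr`). In particular `q`
vanishes on the second factor, and `g` and `Φ`, evaluated on coordinate fields of the first factor,
do not change in the directions of the second.

Suppose that `1 ≤ k < dim M₁`. At two points that differ only in the second factor, `g` and `Φ`
agree, together with their derivatives in the directions of the first factor. Hence the difference
`S` of the two connections and the difference `δ` of the two values of `q` satisfy
`2 δ(w) g = g (S_w ·, ·) + g (·, S_w ·)` with `S` symmetric and `k δ(w) Φ = Φ ∘ S_w` (as a derivation). The first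
equation determines `S` by `δ`, as in the conformal change of a Levi-Civita connection, and the
second one then forces `δ = 0` unless `Φ = 0` (`lee_eq_zero_of_form`); but `φ` has no zeros, being a
solution of a linear differential equation along curves (`parallel_ne_zero`). So `q` is pulled back
from a slice of the first factor, where it is exact: the coordinate fields of the second factor are
parallel along it, so the logarithm of their length is a potential of `-q` (`IsAdaptedPair.closed`).

If `k = dim M₁`, then `Φ(Y) Φ(b)` and the Gram determinant of `Y` and `b` are proportional, where
`b` is the coordinate frame of the first factor. Jacobi's formula for the derivative of a
determinant shows that `φ` is parallel if and only if the factor of proportionality, the squared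
length of `φ`, is locally constant (`IsAdaptedPair.eventually_sq_div_eq`,
`IsAdaptedPair.parallel_of_sq_eq`). Because the fibres are connected, such a form descends to a
multiple of a weightless volume form (`IsAdaptedPair.isPullbackOfVolume`). For `k > dim M₁` there
are no nonzero forms.
-/

noncomputable section

/-! ### Coordinate vector fields -/

section CoordinateFields

variable {E : Type*} [NormedAddCommGroup E] [NormedSpace ℝ E]
  {H : Type*} [TopologicalSpace H] {I : ModelWithCorners ℝ E H}
  {M : Type*} [TopologicalSpace M] [ChartedSpace H M]

variable (I) in
/-- The coordinate vector field of the chart at `z₀` with constant coordinates `u`. -/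
def coordField (z₀ : M) (u : E) : ∀ x : M, TangentSpace I x :=
  VectorField.mpullback I 𝓘(ℝ, E) (extChartAt I z₀) (fun _ => u)

variable (I) in
/-- The map that sends a tangent vector to its coordinates in the chart at `z₀`. -/
def coordVec (z₀ x : M) : TangentSpace I x →L[ℝ] E :=
  mfderiv I 𝓘(ℝ, E) (extChartAt I z₀) x

variable [IsManifold I ∞ M]

theorem coordVec_coordField {z₀ z : M} (hz : z ∈ (chartAt H z₀).source) (u : E) :
    coordVec I z₀ z (coordField I z₀ u z) = u := by
  have h := isInvertible_mfderiv_extChartAt (I := I) (x := z₀) (y := z) (by simpa using hz)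
  exact congrArg (fun L : E →L[ℝ] E => L u) h.self_comp_inverse

theorem coordField_coordVec {z₀ z : M} (hz : z ∈ (chartAt H z₀).source) (v : TangentSpace I z) :
    coordField I z₀ (coordVec I z₀ z v) z = v := by
  have h := isInvertible_mfderiv_extChartAt (I := I) (x := z₀) (y := z) (by simpa using hz)
  exact congrArg (fun L : E →L[ℝ] E => L v) h.inverse_comp_self

/-- The coordinates in the chart at `z₀` identify the tangent space at a point of the chart with the
model space. -/
def coordEquiv {z₀ z : M} (hz : z ∈ (chartAt H z₀).source) : TangentSpace I z ≃ₗ[ℝ] E where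
  __ := (coordVec I z₀ z).toLinearMap
  invFun u := coordField I z₀ u z
  left_inv := coordField_coordVec hz
  right_inv := coordVec_coordField hz

theorem coordField_smooth [CompleteSpace E] (z₀ : M) (u : E) :
    SmoothFieldOn I (coordField I z₀ u) (chartAt H z₀).source := by
  intro z hz
  have hz' : z ∈ (extChartAt I z₀).source := by simpa using hz
  have hs : ContMDiffAt 𝓘(ℝ, E) 𝓘(ℝ, E).tangent ∞
      (fun x : E => (⟨x, u⟩ : TangentBundle 𝓘(ℝ, E) E)) (extChartAt I z₀ z) :=
    contMDiffAt_vectorSpace_iff_contDiffAt.2 contDiffAt_const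
  exact (ContMDiffAt.mpullback_vectorField_preimage (n := ∞) (m := ∞) hs
    (contMDiffAt_extChartAt' hz) (isInvertible_mfderiv_extChartAt hz')
    le_rfl).contMDiffWithinAt

theorem mlieBracket_coordField [CompleteSpace E] {z₀ z : M} (hz : z ∈ (chartAt H z₀).source)
    (u v : E) : VectorField.mlieBracket I (coordField I z₀ u) (coordField I z₀ v) z = 0 := by
  have hc : ∀ w : E, MDifferentiableAt 𝓘(ℝ, E) 𝓘(ℝ, E).tangent
      (fun x : E => (⟨x, w⟩ : TangentBundle 𝓘(ℝ, E) E)) (extChartAt I z₀ z) := by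
    intro w
    have : ContMDiffAt 𝓘(ℝ, E) 𝓘(ℝ, E).tangent ∞
      (fun x : E => (⟨x, w⟩ : TangentBundle 𝓘(ℝ, E) E)) (extChartAt I z₀ z) :=
      contMDiffAt_vectorSpace_iff_contDiffAt.2 contDiffAt_const
    exact this.mdifferentiableAt (by simp)
  have hm : minSmoothness ℝ 2 ≤ 2 := by simp
  have : IsManifold I (minSmoothness ℝ 2) M := IsManifold.of_le (n := ∞) (by
    simpa using (show (2 : WithTop ℕ∞) ≤ ∞ from ENat.LEInfty.out))
  have h := VectorField.mpullback_mlieBracket (I := I) (I' := 𝓘(ℝ, E)) (n := 2)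
    (f := extChartAt I z₀) (x₀ := z) (hc u) (hc v) ((contMDiffAt_extChartAt' hz)) hm
  refine h.symm.trans ?_
  have h0 : VectorField.mlieBracket 𝓘(ℝ, E) (fun _ : E => u) (fun _ : E => v)
      (extChartAt I z₀ z) = (0 : E) := by
    have h1 := VectorField.mlieBracketWithin_eq_lieBracketWithin
      (V := fun _ : E => u) (W := fun _ : E => v) (𝕜 := ℝ) (s := Set.univ)
    have h2 := congrFun h1 (extChartAt I z₀ z)
    refine (congrFun VectorField.mlieBracketWithin_univ.symm _).trans (h2.trans ?_)
    simp only [VectorField.lieBracketWithin, fderivWithin_univ]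
    simp
    rfl
  exact (congrArg (mfderiv I 𝓘(ℝ, E) (extChartAt I z₀) z).inverse h0).trans (map_zero _)

theorem coordVec_smooth {z₀ : M} {X : ∀ x : M, TangentSpace I x} {W : Set M} (hW : IsOpen W)
    (hWs : W ⊆ (chartAt H z₀).source) (hX : SmoothFieldOn I X W) :
    ContMDiffOn I 𝓘(ℝ, E) ∞ (fun x => coordVec I z₀ x (X x)) W := by
  have h := ((trivializationAt E (TangentSpace I) z₀).contMDiffOn_section_iff (IB := I) (n := ∞)
    (s := X) hW (by simpa using hWs)).1 hX
  refine h.congr fun x hx => ?_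
  have hx' := hWs hx
  have h1 := congrArg (fun L : TangentSpace I x →L[ℝ] E => L (X x))
    (TangentBundle.continuousLinearMapAt_trivializationAt (𝕜 := ℝ) (I := I) hx')
  refine h1.symm.trans ?_
  exact congrFun ((trivializationAt E (TangentSpace I) z₀).coe_linearMapAt_of_mem (R := ℝ)
    (by simpa using hx')) (X x)

theorem differentiableAt_comp_extChartAt_symm [I.Boundaryless] {z₀ z : M} {F : M → ℝ}
    (hz : z ∈ (chartAt H z₀).source) (hF : MDifferentiableAt I 𝓘(ℝ, ℝ) F z) :
    DifferentiableAt ℝ (F ∘ (extChartAt I z₀).symm) (extChartAt I z₀ z) := by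
  have hz' : z ∈ (extChartAt I z₀).source := by simpa using hz
  have ht := (extChartAt I z₀).map_source hz'
  have hs : MDifferentiableAt 𝓘(ℝ, E) I (extChartAt I z₀).symm (extChartAt I z₀ z) :=
    ((contMDiffOn_extChartAt_symm (n := ∞) z₀).contMDiffAt
      ((isOpen_extChartAt_target z₀).mem_nhds ht)).mdifferentiableAt (by simp)
  rw [← mdifferentiableAt_iff_differentiableAt]
  refine MDifferentiableAt.comp _ ?_ hs
  rwa [(extChartAt I z₀).left_inv hz']

theorem mvfderiv_eq_fderiv [I.Boundaryless] {z₀ z : M} {F : M → ℝ}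
    (hz : z ∈ (chartAt H z₀).source) (hF : MDifferentiableAt I 𝓘(ℝ, ℝ) F z)
    (v : TangentSpace I z) :
    mvfderiv I F z v
      = fderiv ℝ (F ∘ (extChartAt I z₀).symm) (extChartAt I z₀ z) (coordVec I z₀ z v) := by
  have hz' : z ∈ (extChartAt I z₀).source := by simpa using hz
  have hd := differentiableAt_comp_extChartAt_symm hz hF
  have he : F =ᶠ[𝓝 z] (F ∘ (extChartAt I z₀).symm) ∘ extChartAt I z₀ := by
    filter_upwards [(isOpen_extChartAt_source (I := I) z₀).mem_nhds hz'] with y hy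
    simp only [Function.comp_apply, (extChartAt I z₀).left_inv hy]
  have h1 : mfderiv I 𝓘(ℝ, ℝ) F z = _ := he.mfderiv_eq
  have h2 := mfderiv_comp z (I := I) (I' := 𝓘(ℝ, E)) (I'' := 𝓘(ℝ, ℝ))
    hd.mdifferentiableAt (mdifferentiableAt_extChartAt hz)
  have h3 := h1.trans h2
  rw [mfderiv_eq_fderiv] at h3
  exact congrArg (fun L : TangentSpace I z →L[ℝ] ℝ => L v) h3

/-- A tangent vector is the velocity of a curve, along which derivatives can be computed. -/
theorem exists_curve [I.Boundaryless] (z : M) (v : TangentSpace I z) :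
    ∃ γ : ℝ → M, γ 0 = z ∧ ContinuousAt γ 0 ∧ ∀ F : M → ℝ, MDifferentiableAt I 𝓘(ℝ, ℝ) F z →
      HasDerivAt (fun t => F (γ t)) (mvfderiv I F z v) 0 := by
  have hz := mem_chart_source H z
  have hz' : z ∈ (extChartAt I z).source := by simp
  refine ⟨fun t => (extChartAt I z).symm (extChartAt I z z + t • coordVec I z z v), ?_, ?_, ?_⟩
  · simp
  · refine ContinuousAt.comp (g := (extChartAt I z).symm) ?_ (by fun_prop)
    simpa using continuousAt_extChartAt_symm (I := I) z
  · intro F hF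
    rw [mvfderiv_eq_fderiv hz hF]
    have hd := differentiableAt_comp_extChartAt_symm hz hF
    have hl : HasDerivAt (fun t : ℝ => extChartAt I z z + t • coordVec I z z v)
        (coordVec I z z v) 0 := by
      simpa using ((hasDerivAt_id (0 : ℝ)).smul_const (coordVec I z z v)).const_add (extChartAt I z z)
    exact HasFDerivAt.comp_hasDerivAt_of_eq 0 hd.hasFDerivAt hl (by simp)

end CoordinateFields

/-! ### Weights -/

section Weights

variable {n : ℕ} {V : Type*} [AddCommGroup V] [Module ℝ V] {r : ℝ}

theorem Weight.ext_of_apply {l l' : Weight n V r} (b : Basis (Fin n) ℝ V) (h : l.1 b = l'.1 b) :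
    l = l' := by
  ext b'
  rw [l.2 b b', l'.2 b b', h]

theorem Weight.pos_of_pos {l : Weight n V r} {b : Basis (Fin n) ℝ V} (h : 0 < l.1 b)
    (b' : Basis (Fin n) ℝ V) : 0 < l.1 b' := by
  rw [l.2 b b']
  exact mul_pos (Real.rpow_pos_of_pos (abs_pos.2 (b.isUnit_det b').ne_zero) _) h

/-- The quotient `l / κ ^ (r / 2)` of a weight `l` of degree `r` by a power of a positive weight `κ`
of degree `2`, computed in the frame `b`. -/
def Weight.quot (b : Basis (Fin n) ℝ V) (κ : Weight n V 2) : Weight n V r →ₗ[ℝ] ℝ where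
  toFun l := l.1 b / (κ.1 b) ^ (r / 2)
  map_add' := by intro l l'; simp [add_div]
  map_smul' := by intro a l; simp [mul_div_assoc]

theorem Weight.quot_eq {κ : Weight n V 2} {b : Basis (Fin n) ℝ V} (h : 0 < κ.1 b)
    (b' : Basis (Fin n) ℝ V) (l : Weight n V r) : Weight.quot b κ l = Weight.quot b' κ l := by
  have hd : 0 < |b.det b'| := abs_pos.2 (b.isUnit_det b').ne_zero
  have hp : 0 < |b.det b'| ^ (-(r / n)) := Real.rpow_pos_of_pos hd _
  simp only [Weight.quot, LinearMap.coe_mk, AddHom.coe_mk]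
  rw [l.2 b b', κ.2 b b', Real.mul_rpow (Real.rpow_nonneg hd.le _) h.le, ← Real.rpow_mul hd.le,
    show -(2 / (n : ℝ)) * (r / 2) = -(r / n) by ring, mul_div_mul_left _ _ hp.ne']

end Weights

section Manifold

variable {E : Type*} [NormedAddCommGroup E] [NormedSpace ℝ E]
  {H : Type*} [TopologicalSpace H] {I : ModelWithCorners ℝ E H}
  {M : Type*} [TopologicalSpace M] [ChartedSpace H M] [FiniteDimensional ℝ E]

/-- The quotient `l / κ ^ (r / 2)` of a weight `l` of degree `r` at a point of a manifold by a power
of a positive weight `κ` of degree `2`. -/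
def weightQuot {r : ℝ} {x : M} (κ : WeightAt I 2 x) : WeightAt I r x →ₗ[ℝ] ℝ :=
  Weight.quot (V := TangentSpace I x) (finBasis ℝ E) κ

theorem weightQuot_eq {r : ℝ} {x : M} {κ : WeightAt I 2 x}
    {b : Basis (Fin (finrank ℝ E)) ℝ (TangentSpace I x)} (hκ : 0 < κ.1 b) (l : WeightAt I r x) :
    weightQuot κ l = l.1 b / (κ.1 b) ^ (r / 2) :=
  Weight.quot_eq (Weight.pos_of_pos hκ _) b l

theorem apply_eq_weightQuot_mul {r : ℝ} {x : M} {κ : WeightAt I 2 x}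
    {b : Basis (Fin (finrank ℝ E)) ℝ (TangentSpace I x)} (hκ : 0 < κ.1 b) (l : WeightAt I r x) :
    l.1 b = weightQuot κ l * (κ.1 b) ^ (r / 2) := by
  rw [weightQuot_eq hκ, div_mul_cancel₀]
  exact (Real.rpow_pos_of_pos hκ _).ne'

variable [IsManifold I ∞ M]

variable (I) in
/-- The frame of coordinate vector fields of the chart at `z₀` (with junk values outside of the chart
domain). -/
def coordFrame (z₀ : M) : FrameField I M := fun x =>
  open scoped Classical in
  if hx : x ∈ (chartAt H z₀).source then (finBasis ℝ E).map (coordEquiv hx).symm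
  else (finBasis ℝ E : Basis (Fin (finrank ℝ E)) ℝ E)

theorem coordFrame_of_mem {z₀ x : M} (hx : x ∈ (chartAt H z₀).source) :
    coordFrame I z₀ x = (finBasis ℝ E).map (coordEquiv hx).symm := dif_pos hx

theorem coordFrame_apply {z₀ x : M} (hx : x ∈ (chartAt H z₀).source) (j : Fin (finrank ℝ E)) :
    coordFrame I z₀ x j = coordField I z₀ (finBasis ℝ E j) x := by
  rw [coordFrame_of_mem hx]
  rfl

theorem coordFrame_repr {z₀ x : M} (hx : x ∈ (chartAt H z₀).source) (v : TangentSpace I x)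
    (j : Fin (finrank ℝ E)) :
    (coordFrame I z₀ x).repr v j = (finBasis ℝ E).repr (coordVec I z₀ x v) j := by
  rw [coordFrame_of_mem hx]
  rfl

theorem coordFrame_smooth (z₀ : M) : (coordFrame I z₀).SmoothOn (chartAt H z₀).source := by
  have : CompleteSpace E := FiniteDimensional.complete ℝ E
  intro j
  exact (coordField_smooth z₀ (finBasis ℝ E j)).congr fun x hx =>
    congrArg (fun v => (⟨x, v⟩ : TangentBundle I M)) (coordFrame_apply hx j)

omit [FiniteDimensional ℝ E] in
theorem SmoothFieldOn.mono {Y : ∀ x : M, TangentSpace I x} {U W : Set M}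
    (h : SmoothFieldOn I Y U) (hW : W ⊆ U) : SmoothFieldOn I Y W :=
  ContMDiffOn.mono h hW

omit [FiniteDimensional ℝ E] in
theorem FrameField.SmoothOn.mono {e : FrameField I M} {U W : Set M} (h : e.SmoothOn U)
    (hW : W ⊆ U) : e.SmoothOn W := fun j => (h j).mono hW

theorem coordFrame_repr_smooth {z₀ : M} {X : ∀ x : M, TangentSpace I x} {W : Set M}
    (hW : IsOpen W) (hWs : W ⊆ (chartAt H z₀).source) (hX : SmoothFieldOn I X W)
    (j : Fin (finrank ℝ E)) :
    ContMDiffOn I 𝓘(ℝ, ℝ) ∞ (fun x => (coordFrame I z₀ x).repr (X x) j) W := by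
  have h := coordVec_smooth hW hWs hX
  have hL : ContDiff ℝ ∞ fun u : E => (finBasis ℝ E).repr u j :=
    (LinearMap.toContinuousLinearMap ((finBasis ℝ E).coord j)).contDiff
  refine (hL.contMDiff.comp_contMDiffOn h).congr fun x hx => ?_
  exact coordFrame_repr (hWs hx) _ _

/-- A weight that is smooth in the coordinate frame is smooth in any smooth frame. -/
theorem weight_smooth_of_coordFrame {r : ℝ} {z₀ : M} {l : ∀ x : M, WeightAt I r x} {W : Set M}
    (hW : IsOpen W) (hWs : W ⊆ (chartAt H z₀).source)
    (hl : ContMDiffOn I 𝓘(ℝ, ℝ) ∞ (fun x => (l x).1 (coordFrame I z₀ x)) W)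
    {e : FrameField I M} (he : e.SmoothOn W) :
    ContMDiffOn I 𝓘(ℝ, ℝ) ∞ (fun x => (l x).1 (e x)) W := by
  have hdet : ContMDiffOn I 𝓘(ℝ, ℝ) ∞ (fun x => (coordFrame I z₀ x).det (e x)) W := by
    simp only [Basis.det_apply, Matrix.det_apply', Basis.toMatrix_apply]
    refine contMDiffOn_finsetSum fun σ _ => ContMDiffOn.mul contMDiffOn_const ?_
    exact contMDiffOn_finsetProd fun i _ => coordFrame_repr_smooth hW hWs (he i) _
  intro x hx
  have hne : (coordFrame I z₀ x).det (e x) ≠ 0 := ((coordFrame I z₀ x).isUnit_det (e x)).ne_zero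
  have hf : ContDiffAt ℝ ∞ (fun t : ℝ => |t| ^ (-(r / (finrank ℝ E : ℝ))))
      ((coordFrame I z₀ x).det (e x)) :=
    (contDiffAt_abs hne).rpow_const_of_ne (abs_ne_zero.2 hne)
  refine ContMDiffWithinAt.congr (f := fun y => |(coordFrame I z₀ y).det (e y)|
      ^ (-(r / (finrank ℝ E : ℝ))) * (l y).1 (coordFrame I z₀ y)) ?_ (fun y _ => (l y).2 _ _)
      ((l x).2 _ _)
  exact (hf.contMDiffAt.comp_contMDiffWithinAt x (hdet x hx)).mul (hl x hx)

theorem ConformalStructure.inner_smooth (c : ConformalStructure I M)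
    {X Z : ∀ x : M, TangentSpace I x} {W : Set M} (hW : IsOpen W) (hX : SmoothFieldOn I X W)
    (hZ : SmoothFieldOn I Z W) {e : FrameField I M} (he : e.SmoothOn W) :
    ContMDiffOn I 𝓘(ℝ, ℝ) ∞ (fun x => (c.inner x (X x) (Z x)).1 (e x)) W := by
  intro z₀ hz₀
  set U := W ∩ (chartAt H z₀).source with hU
  have hUo : IsOpen U := hW.inter (chartAt H z₀).open_source
  have hUs : U ⊆ (chartAt H z₀).source := Set.inter_subset_right
  have hUW : U ⊆ W := Set.inter_subset_left
  have hz : U ∈ 𝓝 z₀ := hUo.mem_nhds ⟨hz₀, mem_chart_source H z₀⟩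
  refine ContMDiffAt.contMDiffWithinAt (ContMDiffOn.contMDiffAt (s := U) ?_ hz)
  refine weight_smooth_of_coordFrame hUo hUs ?_ (he.mono hUW)
  have hs : ∀ x, (c.inner x (X x) (Z x)).1 (coordFrame I z₀ x) =
      ∑ i, ∑ j, (coordFrame I z₀ x).repr (X x) i * ((coordFrame I z₀ x).repr (Z x) j *
        (c.inner x (coordFrame I z₀ x i) (coordFrame I z₀ x j)).1 (coordFrame I z₀ x)) := by
    intro x
    conv_lhs => rw [← (coordFrame I z₀ x).sum_repr (X x), ← (coordFrame I z₀ x).sum_repr (Z x)]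
    simp only [map_sum, map_smul, LinearMap.sum_apply, LinearMap.smul_apply, Finset.smul_sum,
      Submodule.coe_sum, Submodule.coe_smul, Finset.sum_apply, Pi.smul_apply, smul_eq_mul]
    rw [Finset.sum_comm]
    simp only [mul_left_comm]
  simp only [hs]
  refine contMDiffOn_finsetSum fun i _ => contMDiffOn_finsetSum fun j _ => ?_
  exact (coordFrame_repr_smooth hUo hUs (hX.mono hUW) i).mul
    ((coordFrame_repr_smooth hUo hUs (hZ.mono hUW) j).mul
      (c.smooth U hUo _ ((coordFrame_smooth z₀).mono hUs) i j))

theorem WeightedForm.Smooth.apply_smooth {k : ℕ} {r : ℝ} {φ : WeightedForm I M k r}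
    (hφ : WeightedForm.Smooth φ)
    {Y : Fin k → ∀ x : M, TangentSpace I x} {W : Set M} (hW : IsOpen W)
    (hY : ∀ i, SmoothFieldOn I (Y i) W) {e : FrameField I M} (he : e.SmoothOn W) :
    ContMDiffOn I 𝓘(ℝ, ℝ) ∞ (fun x => (φ x (fun i => Y i x)).1 (e x)) W := by
  intro z₀ hz₀
  set U := W ∩ (chartAt H z₀).source with hU
  have hUo : IsOpen U := hW.inter (chartAt H z₀).open_source
  have hUs : U ⊆ (chartAt H z₀).source := Set.inter_subset_right
  have hUW : U ⊆ W := Set.inter_subset_left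
  have hz : U ∈ 𝓝 z₀ := hUo.mem_nhds ⟨hz₀, mem_chart_source H z₀⟩
  refine ContMDiffAt.contMDiffWithinAt (ContMDiffOn.contMDiffAt (s := U) ?_ hz)
  refine weight_smooth_of_coordFrame hUo hUs ?_ (he.mono hUW)
  have hs : ∀ x, (φ x (fun i => Y i x)).1 (coordFrame I z₀ x) =
      ∑ s : Fin k → Fin (finrank ℝ E), (∏ i, (coordFrame I z₀ x).repr (Y i x) (s i)) *
        (φ x (fun i => coordFrame I z₀ x (s i))).1 (coordFrame I z₀ x) := by
    intro x
    have h1 : (fun i => Y i x) = fun i => ∑ j, (coordFrame I z₀ x).repr (Y i x) j •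
        coordFrame I z₀ x j := by
      funext i; rw [(coordFrame I z₀ x).sum_repr]
    rw [h1]
    have h2 := (φ x).toMultilinearMap.map_sum
      (fun (i : Fin k) (j : Fin (finrank ℝ E)) =>
        (coordFrame I z₀ x).repr (Y i x) j • coordFrame I z₀ x j)
    simp only [AlternatingMap.coe_multilinearMap] at h2
    rw [h2]
    simp only [AlternatingMap.map_smul_univ,
      Submodule.coe_sum, Submodule.coe_smul, Finset.sum_apply, Pi.smul_apply, smul_eq_mul]
  simp only [hs]
  refine contMDiffOn_finsetSum fun s _ => ?_
  refine ContMDiffOn.mul (contMDiffOn_finsetProd fun i _ =>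
    coordFrame_repr_smooth hUo hUs ((hY i).mono hUW) _) ?_
  exact hφ U hUo _ ((coordFrame_smooth z₀).mono hUs) s

end Manifold

/-! ### Linear algebra of forms -/

section Algebra

variable {K : Type*} [AddCommGroup K] [Module ℝ K]

/-- A form of degree `k` vanishes if it vanishes on all families of vectors of the hyperplane `δ = 0`,
and on the families that contain a vector `a` off the hyperplane and are otherwise in it. -/
theorem AlternatingMap.eq_zero_of_hyperplane {k : ℕ} (Φ : K [⋀^Fin k]→ₗ[ℝ] ℝ) (δ : K →ₗ[ℝ] ℝ)
    {a : K} (ha : δ a ≠ 0) (h0 : ∀ u : Fin k → K, (∀ i, δ (u i) = 0) → Φ u = 0)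
    (h1 : ∀ (u : Fin k → K) (i : Fin k), u i = a → (∀ j, j ≠ i → δ (u j) = 0) → Φ u = 0) :
    Φ = 0 := by
  ext x
  set y : Fin k → K := fun i => x i - (δ (x i) / δ a) • a with hy
  have hyδ : ∀ i, δ (y i) = 0 := by
    intro i; simp [hy, ha]
  have hx : x = (fun i => (δ (x i) / δ a) • a) + y := by
    funext i; simp [hy]
  rw [hx]
  have h2 := Φ.toMultilinearMap.map_add_univ (fun i => (δ (x i) / δ a) • a) y
  simp only [AlternatingMap.coe_multilinearMap] at h2
  rw [h2, AlternatingMap.zero_apply]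
  refine Finset.sum_eq_zero fun s _ => ?_
  have h3 := Φ.toMultilinearMap.map_piecewise_smul (fun i => δ (x i) / δ a)
    (s.piecewise (fun _ => a) y) s
  simp only [AlternatingMap.coe_multilinearMap] at h3
  have h4 : s.piecewise (fun i => (δ (x i) / δ a) • s.piecewise (fun _ => a) y i)
      (s.piecewise (fun _ => a) y) = s.piecewise (fun i => (δ (x i) / δ a) • a) y := by
    funext i
    by_cases hi : i ∈ s <;> simp [hi]
  rw [h4] at h3
  rw [h3]
  suffices h : Φ (s.piecewise (fun _ => a) y) = 0 by rw [h, smul_zero]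
  rcases s.eq_empty_or_nonempty with rfl | ⟨i, hi⟩
  · exact h0 _ (by simpa using hyδ)
  · by_cases hj : ∃ j ∈ s, j ≠ i
    · obtain ⟨j, hj, hji⟩ := hj
      exact Φ.map_eq_zero_of_eq _ (by simp [hi, hj]) hji
    · push Not at hj
      refine h1 _ i (by simp [hi]) fun j hji => ?_
      have : j ∉ s := fun h => hji (hj j h)
      simp [this, hyδ]

/-- Two Weyl structures of the same conformal class on a space of dimension `n`, with difference
tensor `S` and Lee form `δ` of the difference, do not both preserve a nonzero weightless form of
degree `k`, `1 ≤ k < n`, unless `δ = 0`. -/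
theorem lee_eq_zero_of_form [FiniteDimensional ℝ K] {k : ℕ} (hk : 1 ≤ k) (hkn : k < finrank ℝ K)
    (g : K →ₗ[ℝ] K →ₗ[ℝ] ℝ) (hsymm : ∀ u v, g u v = g v u) (hpos : ∀ u, u ≠ 0 → 0 < g u u)
    (S : K → K → K) (hS : ∀ u v, S u v = S v u) (δ : K →ₗ[ℝ] ℝ)
    (hg : ∀ w u v, 2 * δ w * g u v = g (S w u) v + g u (S w v))
    (Φ : K [⋀^Fin k]→ₗ[ℝ] ℝ) (hΦ : Φ ≠ 0)
    (hp : ∀ w u, k * δ w * Φ u = ∑ i, Φ (Function.update u i (S w (u i)))) : δ = 0 := by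
  by_contra hδ
  have hnd : ∀ u, (∀ v, g u v = 0) → u = 0 := by
    intro u hu
    by_contra h
    exact (hpos u h).ne' (hu u)
  have hginj : Function.Injective g := by
    rw [← LinearMap.ker_eq_bot, LinearMap.ker_eq_bot']
    intro u hu
    exact hnd u fun v => by rw [hu, LinearMap.zero_apply]
  obtain ⟨a, hga⟩ : ∃ a, g a = δ :=
    (LinearMap.injective_iff_surjective_of_finrank_eq_finrank
      (Subspace.dual_finrank_eq (K := ℝ) (V := K)).symm).1 hginj δ
  have ha0 : a ≠ 0 := by
    rintro rfl
    exact hδ (by rw [← hga, map_zero])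
  have hga' : ∀ v, g v a = δ v := fun v => by rw [hsymm, hga]
  have haδ : δ a ≠ 0 := by rw [← hga]; exact (hpos a ha0).ne'
  -- the Koszul formula determines the difference tensor
  have hSf : ∀ w u, S w u = δ w • u + δ u • w - g w u • a := by
    intro w u
    rw [← sub_eq_zero]
    refine hnd _ fun v => ?_
    simp only [map_sub, map_add, map_smul, LinearMap.sub_apply, LinearMap.add_apply,
      LinearMap.smul_apply, smul_eq_mul, hga]
    have e1 := hg w u v
    have e2 := hg u v w
    have e3 := hg v w u
    rw [hS u w, hsymm v (S w u)] at e2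
    rw [hS v w, hS v u, hsymm w (S u v)] at e3
    rw [hsymm u (S w v)] at e1
    rw [hsymm v w] at e2
    linarith
  have hp' : ∀ w u, k * δ w * Φ u = ∑ i, (δ w * Φ u + δ (u i) * Φ (Function.update u i w)
      - g w (u i) * Φ (Function.update u i a)) := by
    intro w u
    rw [hp]
    refine Finset.sum_congr rfl fun i _ => ?_
    rw [hSf, AlternatingMap.map_update_sub, AlternatingMap.map_update_add,
      AlternatingMap.map_update_smul, AlternatingMap.map_update_smul,
      AlternatingMap.map_update_smul, Function.update_eq_self]
    simp only [smul_eq_mul]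
  have hp2 : ∀ w u, ∑ i, (δ (u i) * Φ (Function.update u i w)
      - g w (u i) * Φ (Function.update u i a)) = 0 := by
    intro w u
    have := hp' w u
    simp only [add_sub_assoc, Finset.sum_add_distrib, Finset.sum_const, Finset.card_univ,
      Fintype.card_fin, nsmul_eq_mul] at this
    linarith
  apply hΦ
  refine AlternatingMap.eq_zero_of_hyperplane Φ δ haδ ?_ ?_
  · intro u hu
    let i : Fin k := ⟨0, hk⟩
    have h := hp2 (u i) (Function.update u i a)
    rw [Finset.sum_eq_single i] at h
    · simpa [hga', hu i, haδ] using h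
    · intro j _ hji
      have h0 : Φ (Function.update (Function.update u i a) j a) = 0 :=
        Φ.map_eq_zero_of_eq _ (i := i) (j := j) (by simp [hji.symm]) hji.symm
      rw [h0, Function.update_of_ne hji, hu j]
      ring
    · simp
  · intro u i hui hu
    -- a nonzero vector orthogonal to all the vectors of the family, which includes `a`
    obtain ⟨w, hw, hw0⟩ : ∃ w, (∀ j, g w (u j) = 0) ∧ w ≠ 0 := by
      have hk' : LinearMap.ker (LinearMap.pi fun j : Fin k => g.flip (u j)) ≠ ⊥ :=
        LinearMap.ker_ne_bot_of_finrank_lt (by simpa using hkn)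
      obtain ⟨w, hw, hw0⟩ := (Submodule.ne_bot_iff _).1 hk'
      exact ⟨w, fun j => congrFun hw j, hw0⟩
    have hδw : δ w = 0 := by rw [← hga', ← hui]; exact hw i
    have h := hp2 w (Function.update u i w)
    rw [Finset.sum_eq_single i] at h
    · have hu' : Function.update u i a = u := by rw [← hui, Function.update_eq_self]
      simpa [hδw, hu', (hpos w hw0).ne'] using h
    · intro j _ hji
      rw [Function.update_of_ne hji, hu j hji, hw j]
      ring
    · simp

/-- The product of two values of a form of top degree is a Gram determinant, up to a constant. -/
theorem AlternatingMap.mul_gram_det {n : ℕ} (b : Basis (Fin n) ℝ K) (Φ : K [⋀^Fin n]→ₗ[ℝ] ℝ)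
    (g : K →ₗ[ℝ] K →ₗ[ℝ] ℝ) (Y : Fin n → K) :
    Φ Y * (Matrix.of fun j i => g (b i) (b j)).det
      = Φ b * (Matrix.of fun j i => g (Y i) (b j)).det := by
  have h : (Matrix.of fun j i => g (Y i) (b j))
      = (Matrix.of fun j i => g (b i) (b j)) * b.toMatrix Y := by
    ext j i
    rw [Matrix.of_apply]
    conv_lhs => rw [← b.sum_repr (Y i)]
    simp only [map_sum, map_smul, LinearMap.sum_apply, LinearMap.smul_apply, smul_eq_mul,
      Matrix.mul_apply, Matrix.of_apply, Basis.toMatrix_apply]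
    exact Finset.sum_congr rfl fun l _ => mul_comm _ _
  have hY : Φ Y = Φ b * (b.toMatrix Y).det := by
    conv_lhs => rw [Φ.eq_smul_basis_det b]
    simp [Basis.det_apply]
  rw [h, Matrix.det_mul, hY]
  ring

end Algebra

/-! ### Derivatives of determinants -/

section Determinant

variable {n : ℕ}

theorem Matrix.trace_adjugate_mul (A X : Matrix (Fin n) (Fin n) ℝ) :
    (A.adjugate * X).trace = ∑ i, (A.updateCol i fun j => X j i).det := by
  simp only [Matrix.trace, Matrix.diag_apply]
  refine Finset.sum_congr rfl fun i _ => ?_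
  rw [← Matrix.cramer_apply, Matrix.cramer_eq_adjugate_mulVec]
  rfl

/-- Jacobi's formula. -/
theorem hasDerivAt_det {A : ℝ → Matrix (Fin n) (Fin n) ℝ} {A' : Matrix (Fin n) (Fin n) ℝ} {t : ℝ}
    (h : ∀ i j, HasDerivAt (fun s => A s i j) (A' i j) t) :
    HasDerivAt (fun s => (A s).det) (((A t).adjugate * A').trace) t := by
  have h1 : HasDerivAt (fun s => ∑ σ : Equiv.Perm (Fin n), ((Equiv.Perm.sign σ : ℤ) : ℝ) *
      ∏ i, A s (σ i) i) (∑ σ : Equiv.Perm (Fin n), ((Equiv.Perm.sign σ : ℤ) : ℝ) *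
      ∑ i, (∏ j ∈ Finset.univ.erase i, A t (σ j) j) • A' (σ i) i) t :=
    HasDerivAt.fun_sum fun σ _ => HasDerivAt.const_mul _
      (HasDerivAt.fun_finsetProd fun i _ => h (σ i) i)
  simp only [← Matrix.det_apply'] at h1
  convert h1 using 1
  rw [Matrix.trace_adjugate_mul]
  simp only [Matrix.det_apply', Finset.mul_sum]
  rw [Finset.sum_comm]
  refine Finset.sum_congr rfl fun σ _ => Finset.sum_congr rfl fun i _ => ?_
  rw [← Finset.mul_prod_erase Finset.univ _ (Finset.mem_univ i), Matrix.updateCol_self, smul_eq_mul]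
  rw [mul_comm (A' (σ i) i)]
  congr 2
  refine Finset.prod_congr rfl fun j hj => ?_
  rw [Matrix.updateCol_ne (Finset.ne_of_mem_erase hj)]

end Determinant

/-! ### Calculus in a chart -/

section Calculus

theorem eq_zero_of_linear_ode {ι : Type*} [Fintype ι] {a : ℝ → ι → ℝ} {C : ι → ι → ℝ → ℝ}
    (hC : ∀ s t, ContinuousOn (C s t) (Set.Icc 0 1))
    (ha : ∀ τ ∈ Set.Icc (0 : ℝ) 1, ∀ s,
      HasDerivAt (fun τ => a τ s) (∑ t, C s t τ * a τ t) τ) (h0 : a 0 = 0) : a 1 = 0 := by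
  have hb : ∀ s t, ∃ B, ∀ τ ∈ Set.Icc (0 : ℝ) 1, |C s t τ| ≤ B := by
    intro s t
    obtain ⟨B, hB⟩ := isCompact_Icc.exists_bound_of_continuousOn (hC s t)
    exact ⟨B, hB⟩
  choose B hB using hb
  have hd : ∀ τ ∈ Set.Icc (0 : ℝ) 1, HasDerivAt a (fun s => ∑ t, C s t τ * a τ t) τ :=
    fun τ hτ => hasDerivAt_pi.2 (ha τ hτ)
  have hB0 : ∀ s t, 0 ≤ B s t := fun s t => (abs_nonneg _).trans (hB s t 0 (by simp))
  refine eq_zero_of_abs_deriv_le_mul_abs_self_of_eq_zero_right (f := a) (a := 0) (b := 1)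
    (K := ∑ s, ∑ t, B s t)
    (fun τ hτ => (hd τ hτ).continuousAt.continuousWithinAt)
    (fun τ hτ => (hd τ (Set.Ico_subset_Icc_self hτ)).hasDerivWithinAt) h0 ?_ 1 (by simp)
  intro τ hτ
  have hτ' := Set.Ico_subset_Icc_self hτ
  have hS : 0 ≤ ∑ s, ∑ t, B s t := Finset.sum_nonneg fun s _ => Finset.sum_nonneg fun t _ => hB0 s t
  rw [pi_norm_le_iff_of_nonneg (mul_nonneg hS (norm_nonneg _))]
  intro s
  refine (norm_sum_le _ _).trans ?_
  calc ∑ t, ‖C s t τ * a τ t‖ ≤ ∑ t, B s t * ‖a τ‖ := by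
        refine Finset.sum_le_sum fun t _ => ?_
        rw [norm_mul]
        exact mul_le_mul (hB s t τ hτ') (norm_le_pi_norm _ _) (norm_nonneg _) (hB0 s t)
    _ = (∑ t, B s t) * ‖a τ‖ := by rw [Finset.sum_mul]
    _ ≤ (∑ s, ∑ t, B s t) * ‖a τ‖ := by
        refine mul_le_mul_of_nonneg_right ?_ (norm_nonneg _)
        exact Finset.single_le_sum (f := fun s => ∑ t, B s t)
          (fun s _ => Finset.sum_nonneg fun t _ => hB0 s t) (Finset.mem_univ s)

variable {E : Type*} [NormedAddCommGroup E] [NormedSpace ℝ E]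

theorem Convex.eq_of_fderiv_apply_eq_zero {V : Set E} (hV : Convex ℝ V) {F : E → ℝ}
    (hF : ∀ p ∈ V, DifferentiableAt ℝ F p) {p q : E} (hp : p ∈ V) (hq : q ∈ V)
    (h : ∀ r ∈ V, fderiv ℝ F r (q - p) = 0) : F q = F p := by
  have hl : ∀ τ : ℝ, HasDerivAt (fun τ : ℝ => p + τ • (q - p)) (q - p) τ := fun τ => by
    simpa using ((hasDerivAt_id τ).smul_const (q - p)).const_add p
  have hm : ∀ τ ∈ Set.Icc (0 : ℝ) 1, p + τ • (q - p) ∈ V := fun τ hτ =>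
    hV.add_smul_sub_mem hp hq hτ
  have hd : ∀ τ ∈ Set.Icc (0 : ℝ) 1, HasDerivAt (fun τ : ℝ => F (p + τ • (q - p))) 0 τ := by
    intro τ hτ
    have := (hF _ (hm τ hτ)).hasFDerivAt.comp_hasDerivAt τ (hl τ)
    rwa [h _ (hm τ hτ)] at this
  have := constant_of_has_deriv_right_zero (a := 0) (b := 1)
    (fun τ hτ => (hd τ hτ).continuousAt.continuousWithinAt)
    (fun τ hτ => (hd τ (Set.Ico_subset_Icc_self hτ)).hasDerivWithinAt) 1 (by simp)
  simpa using this

end Calculus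

/-! ### Weyl structures in a gauge -/

section GaugeAtPoint

variable {E : Type*} [NormedAddCommGroup E] [NormedSpace ℝ E]
  {H : Type*} [TopologicalSpace H] {I : ModelWithCorners ℝ E H}
  {M : Type*} [TopologicalSpace M] [ChartedSpace H M] [FiniteDimensional ℝ E] [IsManifold I ∞ M]
  (c : ConformalStructure I M)

/-- The scalar product on `T_x M` in the conformal class `c` for which `y₀` is a unit vector. -/
def gaugeMetric {x : M} (y₀ : TangentSpace I x) :
    TangentSpace I x →ₗ[ℝ] TangentSpace I x →ₗ[ℝ] ℝ :=
  (c.inner x).compr₂ (weightQuot (c.inner x y₀ y₀))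

/-- The real-valued form at `x` that represents the weighted form `α` when weights are measured with
the scalar product in the conformal class `c` for which `y₀` is a unit vector. -/
def gaugeForm {x : M} (y₀ : TangentSpace I x) {k : ℕ} {r : ℝ}
    (α : TangentSpace I x [⋀^Fin k]→ₗ[ℝ] WeightAt I r x) : TangentSpace I x [⋀^Fin k]→ₗ[ℝ] ℝ :=
  (weightQuot (c.inner x y₀ y₀)).compAlternatingMap α

variable {c}

theorem gaugeMetric_apply {x : M} (y₀ X Z : TangentSpace I x) :
    gaugeMetric c y₀ X Z = weightQuot (c.inner x y₀ y₀) (c.inner x X Z) := rfl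

theorem gaugeForm_apply {x : M} (y₀ : TangentSpace I x) {k : ℕ} {r : ℝ}
    (α : TangentSpace I x [⋀^Fin k]→ₗ[ℝ] WeightAt I r x) (Y : Fin k → TangentSpace I x) :
    gaugeForm c y₀ α Y = weightQuot (c.inner x y₀ y₀) (α Y) := rfl

theorem gaugeMetric_symm {x : M} (y₀ X Z : TangentSpace I x) :
    gaugeMetric c y₀ X Z = gaugeMetric c y₀ Z X := by
  rw [gaugeMetric_apply, gaugeMetric_apply, c.symm x X Z]

theorem gaugeMetric_pos {x : M} {y₀ X : TangentSpace I x} (h₀ : y₀ ≠ 0) (hX : X ≠ 0) :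
    0 < gaugeMetric c y₀ X X := by
  have b : Basis (Fin (finrank ℝ E)) ℝ (TangentSpace I x) := (finBasis ℝ E : Basis _ ℝ E)
  rw [gaugeMetric_apply, weightQuot_eq (c.pos x y₀ h₀ b)]
  exact div_pos (c.pos x X hX b) (Real.rpow_pos_of_pos (c.pos x y₀ h₀ b) _)

theorem gaugeMetric_eq_zero {x : M} (y₀ : TangentSpace I x) {X Z : TangentSpace I x}
    (h : c.inner x X Z = 0) : gaugeMetric c y₀ X Z = 0 := by
  rw [gaugeMetric_apply, h, map_zero]

theorem gaugeForm_eq_zero_iff {x : M} {y₀ : TangentSpace I x} (h₀ : y₀ ≠ 0) {k : ℕ} {r : ℝ}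
    (α : TangentSpace I x [⋀^Fin k]→ₗ[ℝ] WeightAt I r x) (Y : Fin k → TangentSpace I x) :
    gaugeForm c y₀ α Y = 0 ↔ α Y = 0 := by
  have b : Basis (Fin (finrank ℝ E)) ℝ (TangentSpace I x) := (finBasis ℝ E : Basis _ ℝ E)
  refine ⟨fun h => ?_, fun h => by rw [gaugeForm_apply, h, map_zero]⟩
  refine Weight.ext_of_apply b ?_
  rw [apply_eq_weightQuot_mul (c.pos x y₀ h₀ b), ← gaugeForm_apply, h, zero_mul]
  rfl

end GaugeAtPoint

section Gauge

variable {E : Type*} [NormedAddCommGroup E] [NormedSpace ℝ E]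
  {H : Type*} [TopologicalSpace H] {I : ModelWithCorners ℝ E H}
  {M : Type*} [TopologicalSpace M] [ChartedSpace H M] [FiniteDimensional ℝ E] [IsManifold I ∞ M]
  {c : ConformalStructure I M}
  {W : Set M} {Y₀ : ∀ x : M, TangentSpace I x}

theorem weightQuot_smooth (hW : IsOpen W) (hY₀ : SmoothFieldOn I Y₀ W) (h₀ : ∀ x ∈ W, Y₀ x ≠ 0)
    {r : ℝ} {l : ∀ x : M, WeightAt I r x}
    (hl : ∀ U : Set M, IsOpen U → U ⊆ W → ∀ e : FrameField I M, e.SmoothOn U →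
      ContMDiffOn I 𝓘(ℝ, ℝ) ∞ (fun x => (l x).1 (e x)) U) :
    ContMDiffOn I 𝓘(ℝ, ℝ) ∞ (fun x => weightQuot (c.inner x (Y₀ x) (Y₀ x)) (l x)) W := by
  intro z₀ hz₀
  set U := W ∩ (chartAt H z₀).source with hU
  have hUo : IsOpen U := hW.inter (chartAt H z₀).open_source
  have hUs : U ⊆ (chartAt H z₀).source := Set.inter_subset_right
  have hUW : U ⊆ W := Set.inter_subset_left
  have hz : U ∈ 𝓝 z₀ := hUo.mem_nhds ⟨hz₀, mem_chart_source H z₀⟩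
  refine ContMDiffAt.contMDiffWithinAt (ContMDiffOn.contMDiffAt (s := U) ?_ hz)
  have he := (coordFrame_smooth (I := I) z₀).mono hUs
  have hK := c.inner_smooth hUo (hY₀.mono hUW) (hY₀.mono hUW) he
  have hl' := hl U hUo hUW _ he
  have hpos : ∀ x ∈ U, 0 < (c.inner x (Y₀ x) (Y₀ x)).1 (coordFrame I z₀ x) :=
    fun x hx => c.pos x _ (h₀ x (hUW hx)) _
  intro x hx
  have hr : ContDiffAt ℝ ∞ (fun t : ℝ => t ^ (-(r / 2)))
      ((c.inner x (Y₀ x) (Y₀ x)).1 (coordFrame I z₀ x)) :=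
    contDiffAt_id.rpow_const_of_ne (hpos x hx).ne'
  have h2 := (hl' x hx).mul (hr.contMDiffAt.comp_contMDiffWithinAt x (hK x hx))
  refine h2.congr (fun y hy => ?_) ?_
  · simp [weightQuot_eq (hpos y hy), Real.rpow_neg (hpos y hy).le, div_eq_mul_inv]
  · simp [weightQuot_eq (hpos x hx), Real.rpow_neg (hpos x hx).le, div_eq_mul_inv]

theorem gaugeMetric_smooth (hW : IsOpen W) (hY₀ : SmoothFieldOn I Y₀ W) (h₀ : ∀ x ∈ W, Y₀ x ≠ 0)
    {X Z : ∀ x : M, TangentSpace I x} (hX : SmoothFieldOn I X W) (hZ : SmoothFieldOn I Z W) :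
    ContMDiffOn I 𝓘(ℝ, ℝ) ∞ (fun x => gaugeMetric c (Y₀ x) (X x) (Z x)) W :=
  weightQuot_smooth hW hY₀ h₀ fun _ hU hUW _ he =>
    c.inner_smooth hU (hX.mono hUW) (hZ.mono hUW) he

theorem gaugeForm_smooth (hW : IsOpen W) (hY₀ : SmoothFieldOn I Y₀ W) (h₀ : ∀ x ∈ W, Y₀ x ≠ 0)
    {k : ℕ} {r : ℝ} {φ : WeightedForm I M k r} (hφ : WeightedForm.Smooth φ)
    {Y : Fin k → ∀ x : M, TangentSpace I x} (hY : ∀ i, SmoothFieldOn I (Y i) W) :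
    ContMDiffOn I 𝓘(ℝ, ℝ) ∞ (fun x => gaugeForm c (Y₀ x) (φ x) (fun i => Y i x)) W :=
  weightQuot_smooth hW hY₀ h₀ fun _ hU hUW _ he =>
    hφ.apply_smooth hU (fun i => (hY i).mono hUW) he

variable (D : WeylStructure c)

/-- The connection form of `D` on the weight bundle `L`, in the trivialization of `L` by the length of
the vector field `Y₀`. -/
def WeylStructure.leeForm (Y₀ : ∀ x : M, TangentSpace I x) (x : M) : TangentSpace I x →ₗ[ℝ] ℝ :=
  (gaugeMetric c (Y₀ x)).flip (Y₀ x) ∘ₗ (D.cov Y₀ x).toLinearMap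

theorem WeylStructure.leeForm_apply (x : M) (v : TangentSpace I x) :
    D.leeForm Y₀ x v = gaugeMetric c (Y₀ x) (D.cov Y₀ x v) (Y₀ x) := rfl

variable [I.Boundaryless]

/-- The covariant derivative of a weight in a gauge: no choice of frame enters the factor that decides
whether the weight is parallel. The trace of the connection in the frame `e` is eliminated with the
equation `D c = 0`, applied to the vector field that defines the gauge. -/
theorem weightDeriv_eq (hW : IsOpen W) (hY₀ : SmoothFieldOn I Y₀ W) (h₀ : ∀ x ∈ W, Y₀ x ≠ 0)
    {e : FrameField I M} (he : e.SmoothOn W) {r : ℝ} (l : ∀ x : M, WeightAt I r x) {x : M}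
    (hx : x ∈ W) (hl : MDifferentiableAt I 𝓘(ℝ, ℝ)
      (fun y => weightQuot (c.inner y (Y₀ y) (Y₀ y)) (l y)) x) (v : TangentSpace I x) :
    weightDeriv D.cov l e x v =
      (mvfderiv I (fun y => weightQuot (c.inner y (Y₀ y) (Y₀ y)) (l y)) x v
        + r * D.leeForm Y₀ x v * weightQuot (c.inner x (Y₀ x) (Y₀ x)) (l x))
      * ((c.inner x (Y₀ x) (Y₀ x)).1 (e x)) ^ (r / 2) := by
  set κ : ∀ y : M, WeightAt I 2 y := fun y => c.inner y (Y₀ y) (Y₀ y) with hκ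
  have hpos : ∀ y ∈ W, 0 < (κ y).1 (e y) := fun y hy => c.pos y _ (h₀ y hy) _
  have hK : MDifferentiableAt I 𝓘(ℝ, ℝ) (fun y => (κ y).1 (e y)) x :=
    ((c.inner_smooth hW hY₀ hY₀ he).contMDiffAt (hW.mem_nhds hx)).mdifferentiableAt (by simp)
  have hr : ContDiffAt ℝ ∞ (fun t : ℝ => t ^ (r / 2)) ((κ x).1 (e x)) :=
    contDiffAt_id.rpow_const_of_ne (hpos x hx).ne'
  have hKr : MDifferentiableAt I 𝓘(ℝ, ℝ) (fun y => (κ y).1 (e y) ^ (r / 2)) x :=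
    (hr.differentiableAt (by simp)).mdifferentiableAt.comp x hK
  have heq : ∀ᶠ y in 𝓝 x, (l y).1 (e y) = weightQuot (κ y) (l y) * (κ y).1 (e y) ^ (r / 2) := by
    filter_upwards [hW.mem_nhds hx] with y hy
    exact apply_eq_weightQuot_mul (hpos y hy) _
  have hle : MDifferentiableAt I 𝓘(ℝ, ℝ) (fun y => (l y).1 (e y)) x :=
    (hl.mul hKr).congr_of_eventuallyEq heq
  obtain ⟨γ, rfl, hγ, hd⟩ := exists_curve x v
  have d1 := hd _ hle
  have d2 := (hd _ hl).mul ((hd _ hK).rpow_const (p := r / 2) (Or.inl (hpos _ hx).ne'))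
  have d3 := d1.unique (d2.congr_of_eventuallyEq (hγ.tendsto.eventually heq))
  -- the derivative of the length of `Y₀`
  have hc := D.conformal W hW e he Y₀ Y₀ hY₀ hY₀ _ hx v
  rw [c.symm _ (Y₀ _), apply_eq_weightQuot_mul (hpos _ hx) (c.inner _ (D.cov Y₀ _ v) (Y₀ _)),
    ← gaugeMetric_apply, ← D.leeForm_apply] at hc
  unfold weightDeriv at hc ⊢
  rw [d3, apply_eq_weightQuot_mul (hpos _ hx) (l _)]
  set tr := ∑ j, (e (γ 0)).repr (D.cov (fun y => e y j) (γ 0) v) j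
  set q := D.leeForm Y₀ (γ 0) v
  set k := mvfderiv I (fun y => (κ y).1 (e y)) (γ 0) v
  have hk : k = 2 * q * (κ (γ 0)).1 (e (γ 0)) - 2 / (finrank ℝ E : ℝ) * tr * (κ (γ 0)).1 (e (γ 0)) := by
    rw [show (2 : ℝ) / 2 = 1 by norm_num, Real.rpow_one] at hc
    linear_combination hc
  rw [hk, Real.rpow_sub_one (hpos _ hx).ne']
  have := (hpos _ hx).ne'
  field_simp
  ring

theorem mvfderiv_gaugeMetric (hW : IsOpen W) (hY₀ : SmoothFieldOn I Y₀ W)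
    (h₀ : ∀ x ∈ W, Y₀ x ≠ 0) {X Z : ∀ x : M, TangentSpace I x} (hX : SmoothFieldOn I X W)
    (hZ : SmoothFieldOn I Z W) {x : M} (hx : x ∈ W) (v : TangentSpace I x) :
    mvfderiv I (fun y => gaugeMetric c (Y₀ y) (X y) (Z y)) x v =
      gaugeMetric c (Y₀ x) (D.cov X x v) (Z x) + gaugeMetric c (Y₀ x) (X x) (D.cov Z x v)
        - 2 * D.leeForm Y₀ x v * gaugeMetric c (Y₀ x) (X x) (Z x) := by
  set U := W ∩ (chartAt H x).source with hU
  have hUo : IsOpen U := hW.inter (chartAt H x).open_source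
  have hUW : U ⊆ W := Set.inter_subset_left
  have hxU : x ∈ U := ⟨hx, mem_chart_source H x⟩
  have he := (coordFrame_smooth (I := I) x).mono (Set.inter_subset_right : U ⊆ _)
  have hl := ((gaugeMetric_smooth (c := c) hW hY₀ h₀ hX hZ).contMDiffAt
    (hW.mem_nhds hx)).mdifferentiableAt (by simp)
  have h1 := weightDeriv_eq D hUo (hY₀.mono hUW) (fun y hy => h₀ y (hUW hy)) he
    (fun y => c.inner y (X y) (Z y)) hxU hl v
  have hpos := c.pos x _ (h₀ x hx) (coordFrame I x x)
  rw [D.conformal U hUo _ he X Z (hX.mono hUW) (hZ.mono hUW) x hxU v,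
    apply_eq_weightQuot_mul hpos (c.inner x (D.cov X x v) (Z x)),
    apply_eq_weightQuot_mul hpos (c.inner x (X x) (D.cov Z x v)), ← add_mul] at h1
  have h2 := mul_right_cancel₀ (Real.rpow_pos_of_pos hpos _).ne' h1
  simp only [gaugeMetric_apply]
  linear_combination -h2

theorem mvfderiv_gaugeForm (hW : IsOpen W) (hY₀ : SmoothFieldOn I Y₀ W)
    (h₀ : ∀ x ∈ W, Y₀ x ≠ 0) {k : ℕ} {φ : WeightlessForm I M k} (hφ : WeightedForm.Smooth φ)
    (hp : WeightedForm.Parallel D.cov φ)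
    {Y : Fin k → ∀ x : M, TangentSpace I x} (hY : ∀ i, SmoothFieldOn I (Y i) W)
    {x : M} (hx : x ∈ W) (v : TangentSpace I x) :
    mvfderiv I (fun y => gaugeForm c (Y₀ y) (φ y) (fun i => Y i y)) x v =
      ∑ i, gaugeForm c (Y₀ x) (φ x) (Function.update (fun j => Y j x) i (D.cov (Y i) x v))
        - k * D.leeForm Y₀ x v * gaugeForm c (Y₀ x) (φ x) (fun i => Y i x) := by
  set U := W ∩ (chartAt H x).source with hU
  have hUo : IsOpen U := hW.inter (chartAt H x).open_source
  have hUW : U ⊆ W := Set.inter_subset_left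
  have hxU : x ∈ U := ⟨hx, mem_chart_source H x⟩
  have he := (coordFrame_smooth (I := I) x).mono (Set.inter_subset_right : U ⊆ _)
  have hl := ((gaugeForm_smooth (c := c) hW hY₀ h₀ hφ hY).contMDiffAt
    (hW.mem_nhds hx)).mdifferentiableAt (by simp)
  have h1 := weightDeriv_eq D hUo (hY₀.mono hUW) (fun y hy => h₀ y (hUW hy)) he
    (fun y => φ y (fun i => Y i y)) hxU hl v
  have hpos := c.pos x _ (h₀ x hx) (coordFrame I x x)
  rw [hp U hUo _ he Y (fun i => (hY i).mono hUW) x hxU v] at h1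
  simp only [apply_eq_weightQuot_mul hpos (φ x _)] at h1
  rw [← Finset.sum_mul] at h1
  have h2 := mul_right_cancel₀ (Real.rpow_pos_of_pos hpos _).ne' h1
  simp only [gaugeForm_apply]
  linear_combination -h2

/-- Whether a form is parallel can be checked in one gauge around each point. -/
theorem parallel_of_mvfderiv_gaugeForm {k : ℕ} {φ : WeightlessForm I M k}
    (hφ : WeightedForm.Smooth φ)
    (h : ∀ x : M, ∃ U : Set M, IsOpen U ∧ x ∈ U ∧ ∃ Y₀ : ∀ y : M, TangentSpace I y,
      SmoothFieldOn I Y₀ U ∧ (∀ y ∈ U, Y₀ y ≠ 0) ∧ ∀ W : Set M, IsOpen W → x ∈ W → W ⊆ U →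
      ∀ Y : Fin k → ∀ x : M, TangentSpace I x, (∀ i, SmoothFieldOn I (Y i) W) →
      ∀ v : TangentSpace I x,
      mvfderiv I (fun y => gaugeForm c (Y₀ y) (φ y) (fun i => Y i y)) x v =
      ∑ i, gaugeForm c (Y₀ x) (φ x) (Function.update (fun j => Y j x) i (D.cov (Y i) x v))
        - k * D.leeForm Y₀ x v * gaugeForm c (Y₀ x) (φ x) (fun i => Y i x)) :
    WeightedForm.Parallel D.cov φ := by
  intro W hW e he Y hY x hx v
  obtain ⟨U, hU, hxU, Y₀, hY₀, h₀, h⟩ := h x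
  have hUW : W ∩ U ⊆ W := Set.inter_subset_left
  have hUU : W ∩ U ⊆ U := Set.inter_subset_right
  have hYU := fun i => (hY i).mono hUW
  have h1 := h (W ∩ U) (hW.inter hU) ⟨hx, hxU⟩ hUU Y hYU v
  have hl := ((gaugeForm_smooth (c := c) (hW.inter hU) (hY₀.mono hUU) (fun y hy => h₀ y (hUU hy))
    hφ hYU).contMDiffAt ((hW.inter hU).mem_nhds ⟨hx, hxU⟩)).mdifferentiableAt (by simp)
  rw [weightDeriv_eq D (hW.inter hU) (hY₀.mono hUU) (fun y hy => h₀ y (hUU hy)) (he.mono hUW)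
    (fun y => φ y (fun i => Y i y)) ⟨hx, hxU⟩ hl v]
  have hpos := c.pos x _ (h₀ x hxU) (e x)
  simp only [apply_eq_weightQuot_mul hpos (φ x _)]
  rw [← Finset.sum_mul]
  simp only [gaugeForm_apply] at h1
  rw [h1]
  ring

end Gauge

/-! ### Parallel forms are determined by their value at a point -/

section Parallel

variable {E : Type*} [NormedAddCommGroup E] [NormedSpace ℝ E]
  {H : Type*} [TopologicalSpace H] {I : ModelWithCorners ℝ E H}
  {M : Type*} [TopologicalSpace M] [ChartedSpace H M] [FiniteDimensional ℝ E] [IsManifold I ∞ M]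
  {c : ConformalStructure I M}

omit [FiniteDimensional ℝ E] in
theorem SmoothFieldOn.mdifferentiableAt {Y : ∀ x : M, TangentSpace I x} {U : Set M} (hU : IsOpen U)
    (h : SmoothFieldOn I Y U) {x : M} (hx : x ∈ U) :
    MDifferentiableAt I I.tangent (fun x => (⟨x, Y x⟩ : TangentBundle I M)) x :=
  (ContMDiffOn.contMDiffAt h (hU.mem_nhds hx)).mdifferentiableAt (by simp)

/-- Derivatives of fields that are only defined on an open set: `D.smooth` concerns global sections, so
the field is cut off with a bump function. -/
theorem WeylStructure.cov_smooth [T2Space M] (D : WeylStructure c)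
    {X Y : ∀ x : M, TangentSpace I x} {U : Set M} (hU : IsOpen U) (hX : SmoothFieldOn I X U)
    (hY : SmoothFieldOn I Y U) : SmoothFieldOn I (fun x => D.cov Y x (X x)) U := by
  intro x hx
  obtain ⟨f, -, hf⟩ := (SmoothBumpFunction.nhds_basis_tsupport (I := I) x).mem_iff.1 (hU.mem_nhds hx)
  set Y' : ∀ x : M, TangentSpace I x := (f : M → ℝ) • Y with hY'
  have hs : ContMDiff I I.tangent ∞ (fun x => (⟨x, Y' x⟩ : TangentBundle I M)) :=
    ContMDiffOn.smul_section_of_tsupport (f.contMDiff.contMDiffOn) hU hf hY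
  have hD := D.smooth.contMDiff.contMDiff (σ := Y') hs.contMDiffOn
  have h1 := (hD.contMDiffAt Filter.univ_mem).clm_bundle_apply (v := X) (x := x)
    (ContMDiffOn.contMDiffAt hX (hU.mem_nhds hx))
  refine ContMDiffAt.contMDiffWithinAt (h1.congr_of_eventuallyEq ?_)
  filter_upwards [f.eventuallyEq_one.eventuallyEq_nhds, hU.mem_nhds hx] with y hy hyU
  have h2 : D.cov Y y = D.cov Y' y := by
    refine D.cov.isCovariantDerivativeOnUniv.congr_of_eventuallyEq (hY.mdifferentiableAt hU hyU)
      (hs.mdifferentiableAt (by simp)) Filter.univ_mem ?_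
    filter_upwards [hy] with w hw
    simp [hY', hw]
  exact congrArg (fun v => (⟨y, v⟩ : TangentBundle I M)) (congrArg (fun L => L (X y)) h2)

omit [FiniteDimensional ℝ E] in
theorem coordField_ne_zero {z₀ z : M} (hz : z ∈ (chartAt H z₀).source) {u : E} (hu : u ≠ 0) :
    coordField I z₀ u z ≠ 0 := by
  intro h
  have := coordVec_coordField (I := I) hz u
  rw [h, map_zero] at this
  exact hu this.symm

theorem coordFrame_sum {z₀ z : M} (hz : z ∈ (chartAt H z₀).source) (v : TangentSpace I z) :
    v = ∑ j, (finBasis ℝ E).repr (coordVec I z₀ z v) j • coordField I z₀ (finBasis ℝ E j) z := by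
  conv_lhs => rw [← (coordFrame I z₀ z).sum_repr v]
  exact Finset.sum_congr rfl fun j _ => by rw [coordFrame_repr hz, coordFrame_apply hz]

variable [I.Boundaryless]

/-- Near a zero, a parallel weightless form vanishes: along the coordinate lines through the zero, its
coefficients solve a linear differential equation. -/
theorem eventually_eq_zero_of_parallel [T2Space M] (hn : 1 ≤ finrank ℝ E) (D : WeylStructure c)
    {k : ℕ} {φ : WeightlessForm I M k} (hφ : WeightedForm.Smooth φ)
    (hp : WeightedForm.Parallel D.cov φ) {z₀ : M} (h0 : φ z₀ = 0) : ∀ᶠ z in 𝓝 z₀, φ z = 0 := by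
  have : CompleteSpace E := FiniteDimensional.complete ℝ E
  let B := finBasis ℝ E
  let j₀ : Fin (finrank ℝ E) := ⟨0, hn⟩
  set U := (chartAt H z₀).source with hU
  have hUo : IsOpen U := (chartAt H z₀).open_source
  let X : E → ∀ x : M, TangentSpace I x := coordField I z₀
  have hX : ∀ u, SmoothFieldOn I (X u) U := coordField_smooth z₀
  have hY₀ : ∀ z ∈ U, X (B j₀) z ≠ 0 := fun z hz => coordField_ne_zero hz (B.ne_zero j₀)
  let a : M → (Fin k → Fin (finrank ℝ E)) → ℝ := fun z s =>
    gaugeForm c (X (B j₀) z) (φ z) (fun i => X (B (s i)) z)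
  have ha : ∀ s, ContMDiffOn I 𝓘(ℝ, ℝ) ∞ (fun z => a z s) U := fun s =>
    gaugeForm_smooth hUo (hX _) hY₀ hφ fun i => hX _
  have hazero : ∀ z ∈ U, (a z = 0 ↔ φ z = 0) := by
    intro z hz
    constructor
    · intro h
      refine Basis.ext_alternating (coordFrame I z₀ z) fun s _ => ?_
      have h1 := (gaugeForm_eq_zero_iff (c := c) (hY₀ z hz) (φ z) _).1 (congrFun h s)
      simp only [coordFrame_apply hz]
      rw [AlternatingMap.zero_apply]
      exact h1
    · intro h
      funext s
      refine (gaugeForm_eq_zero_iff (c := c) (hY₀ z hz) (φ z) _).2 ?_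
      rw [h, AlternatingMap.zero_apply]
  have hz₀ : z₀ ∈ U := mem_chart_source H z₀
  have ht : (extChartAt I z₀).target ∈ 𝓝 (extChartAt I z₀ z₀) := extChartAt_target_mem_nhds z₀
  obtain ⟨ε, hε, hball⟩ := Metric.mem_nhds_iff.1 ht
  have hpre : extChartAt I z₀ ⁻¹' Metric.ball (extChartAt I z₀ z₀) ε ∈ 𝓝 z₀ :=
    (continuousAt_extChartAt z₀).preimage_mem_nhds (Metric.ball_mem_nhds _ hε)
  filter_upwards [hpre, hUo.mem_nhds hz₀] with z hz hzU
  refine (hazero z hzU).1 ?_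
  set p₀ := extChartAt I z₀ z₀ with hp₀
  set w := extChartAt I z₀ z - p₀ with hw
  let γ : ℝ → M := fun τ => (extChartAt I z₀).symm (p₀ + τ • w)
  have hmem : ∀ τ ∈ Set.Icc (0 : ℝ) 1, p₀ + τ • w ∈ (extChartAt I z₀).target := fun τ hτ =>
    hball ((convex_ball _ _).add_smul_sub_mem (Metric.mem_ball_self hε) hz hτ)
  have hγU : ∀ τ ∈ Set.Icc (0 : ℝ) 1, γ τ ∈ U := fun τ hτ => by
    have := (extChartAt I z₀).map_target (hmem τ hτ)
    rwa [extChartAt_source] at this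
  have hγc : ContinuousOn γ (Set.Icc 0 1) := by
    refine (continuousOn_extChartAt_symm z₀).comp (by fun_prop) hmem
  -- the coefficients of the connection
  let Γ : Fin (finrank ℝ E) → Fin (finrank ℝ E) → M → ℝ := fun j l z =>
    B.repr (coordVec I z₀ z (D.cov (X (B j)) z (X w z))) l
  have hΓ : ∀ j l, ContinuousOn (fun τ => Γ j l (γ τ)) (Set.Icc 0 1) := by
    intro j l
    have h1 := (coordVec_smooth hUo subset_rfl (D.cov_smooth hUo (hX w) (hX (B j)))).continuousOn
    exact ((LinearMap.continuous_of_finiteDimensional (B.coord l)).comp_continuousOn h1).comp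
      hγc hγU
  have hq : ContinuousOn (fun τ => D.leeForm (X (B j₀)) (γ τ) (X w (γ τ))) (Set.Icc 0 1) := by
    have h1 := (gaugeMetric_smooth (c := c) hUo (hX (B j₀)) hY₀
      (D.cov_smooth hUo (hX w) (hX (B j₀))) (hX (B j₀))).continuousOn
    exact h1.comp hγc hγU
  let C : (Fin k → Fin (finrank ℝ E)) → (Fin k → Fin (finrank ℝ E)) → ℝ → ℝ := fun s t τ =>
    (∑ i, ∑ l, (if Function.update s i l = t then Γ (s i) l (γ τ) else 0))
      - if s = t then k * D.leeForm (X (B j₀)) (γ τ) (X w (γ τ)) else 0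
  have hCsum : ∀ s τ, ∑ t, C s t τ * a (γ τ) t =
      ∑ i, ∑ l, Γ (s i) l (γ τ) * a (γ τ) (Function.update s i l)
        - k * D.leeForm (X (B j₀)) (γ τ) (X w (γ τ)) * a (γ τ) s := by
    intro s τ
    simp only [C, sub_mul, Finset.sum_sub_distrib, Finset.sum_mul, ite_mul, zero_mul]
    congr 1
    · rw [Finset.sum_comm]
      refine Finset.sum_congr rfl fun i _ => ?_
      rw [Finset.sum_comm]
      simp only [Finset.sum_ite_eq, Finset.mem_univ, if_true]
    · simp only [Finset.sum_ite_eq, Finset.mem_univ, if_true]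
  have hC : ∀ s t, ContinuousOn (C s t) (Set.Icc 0 1) := by
    intro s t
    refine ContinuousOn.sub (continuousOn_finsetSum _ fun i _ => continuousOn_finsetSum _
      fun l _ => ?_) ?_
    · split_ifs
      exacts [hΓ _ _, continuousOn_const]
    · split_ifs
      exacts [continuousOn_const.mul hq, continuousOn_const]
  have hγ1 : γ 1 = z := by
    simp only [γ, hw, one_smul, add_sub_cancel]
    exact (extChartAt I z₀).left_inv (by simpa using hzU)
  have hγ0 : γ 0 = z₀ := by simp [γ, hp₀]
  have := eq_zero_of_linear_ode (a := fun τ => a (γ τ)) hC ?_ ?_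
  · simpa only [hγ1] using this
  · intro τ hτ s
    have hzτ := hγU τ hτ
    have hd : MDifferentiableAt I 𝓘(ℝ, ℝ) (fun z => a z s) (γ τ) :=
      ((ha s).contMDiffAt (hUo.mem_nhds hzτ)).mdifferentiableAt (by simp)
    have hext : extChartAt I z₀ (γ τ) = p₀ + τ • w := (extChartAt I z₀).right_inv (hmem τ hτ)
    have h1 := (differentiableAt_comp_extChartAt_symm hzτ hd).hasFDerivAt
    rw [hext] at h1
    have hl : HasDerivAt (fun τ : ℝ => p₀ + τ • w) w τ := by
      simpa using ((hasDerivAt_id τ).smul_const w).const_add p₀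
    have h2 := h1.comp_hasDerivAt τ hl
    have h3 := mvfderiv_eq_fderiv hzτ hd (X w (γ τ))
    rw [hext, coordVec_coordField hzτ] at h3
    rw [← h3, mvfderiv_gaugeForm D hUo (hX _) hY₀ hφ hp (fun i => hX _) hzτ] at h2
    refine h2.congr_deriv ?_
    refine Eq.trans ?_ (hCsum s τ).symm
    congr 1
    refine Finset.sum_congr rfl fun i _ => ?_
    conv_lhs => rw [coordFrame_sum hzτ (D.cov _ _ _)]
    rw [AlternatingMap.map_update_sum]
    refine Finset.sum_congr rfl fun l _ => ?_
    rw [AlternatingMap.map_update_smul, smul_eq_mul]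
    refine congrArg (fun Y => Γ (s i) l (γ τ) * gaugeForm c (X (B j₀) (γ τ)) (φ (γ τ)) Y) ?_
    funext j
    by_cases hj : j = i
    · subst hj; simp [X, B]
    · simp [Function.update_of_ne hj]
  · simp only [hγ0]
    exact (hazero z₀ hz₀).2 h0

theorem parallel_ne_zero [T2Space M] [ConnectedSpace M] (hn : 1 ≤ finrank ℝ E)
    (D : WeylStructure c) {k : ℕ} {φ : WeightlessForm I M k} (hφ : WeightedForm.Smooth φ)
    (hp : WeightedForm.Parallel D.cov φ) (h : ∃ z, φ z ≠ 0) (z : M) : φ z ≠ 0 := by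
  have : CompleteSpace E := FiniteDimensional.complete ℝ E
  have hopen : IsOpen {z | φ z = 0} := isOpen_iff_mem_nhds.2 fun z hz =>
    eventually_eq_zero_of_parallel hn D hφ hp hz
  have hclosed : IsOpen {z | φ z = 0}ᶜ := by
    refine isOpen_iff_mem_nhds.2 fun z₀ hz₀ => ?_
    let B := finBasis ℝ E
    let j₀ : Fin (finrank ℝ E) := ⟨0, hn⟩
    have hUo : IsOpen (chartAt H z₀).source := (chartAt H z₀).open_source
    have hzU := mem_chart_source H z₀
    have hX : ∀ u, SmoothFieldOn I (coordField I z₀ u) (chartAt H z₀).source := coordField_smooth z₀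
    have hY₀ : ∀ z ∈ (chartAt H z₀).source, coordField I z₀ (B j₀) z ≠ 0 :=
      fun z hz => coordField_ne_zero hz (B.ne_zero j₀)
    obtain ⟨s, hs⟩ : ∃ s : Fin k → Fin (finrank ℝ E),
        φ z₀ (fun i => coordFrame I z₀ z₀ (s i)) ≠ 0 := by
      by_contra! hcon
      exact hz₀ (Basis.ext_alternating (coordFrame I z₀ z₀) fun s _ => by
        rw [hcon s, AlternatingMap.zero_apply])
    simp only [coordFrame_apply hzU] at hs
    have hcont := (gaugeForm_smooth (c := c) hUo (hX (B j₀)) hY₀ hφ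
      (fun i => hX (B (s i)))).continuousOn.continuousAt (hUo.mem_nhds hzU)
    have hne := hcont.eventually_ne (y := 0) (by
      rwa [Ne, gaugeForm_eq_zero_iff (hY₀ z₀ hzU)])
    filter_upwards [hne] with z hz hφz
    apply hz
    have hφz' : φ z = 0 := hφz
    rw [gaugeForm_apply, hφz', AlternatingMap.zero_apply, map_zero]
  intro hz
  obtain ⟨z₁, hz₁⟩ := h
  have hcl : IsClopen {z | φ z = 0} := ⟨⟨hclosed⟩, hopen⟩
  exact hz₁ (Set.eq_univ_iff_forall.1 (hcl.eq_univ ⟨z, hz⟩) z₁)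

end Parallel

/-! ### Manifolds with two complementary projections -/

section Projection

variable {E : Type*} [NormedAddCommGroup E] [NormedSpace ℝ E]
  {H : Type*} [TopologicalSpace H] {I : ModelWithCorners ℝ E H}
  {M : Type*} [TopologicalSpace M] [ChartedSpace H M]
  {E' : Type*} [NormedAddCommGroup E'] [NormedSpace ℝ E']
  {H' : Type*} [TopologicalSpace H'] {I' : ModelWithCorners ℝ E' H'}
  {N : Type*} [TopologicalSpace N] [ChartedSpace H' N]

variable (I I') in
/-- The smooth map `p` is given by the linear map `π` in the preferred charts. -/
structure IsChartProjection (p : M → N) (π : E →L[ℝ] E') : Prop where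
  contMDiff : ContMDiff I I' ∞ p
  mem_source : ∀ z₀ z : M, z ∈ (chartAt H z₀).source → p z ∈ (chartAt H' (p z₀)).source
  extChartAt_eq : ∀ z₀ z : M, z ∈ (chartAt H z₀).source →
    extChartAt I' (p z₀) (p z) = π (extChartAt I z₀ z)

variable [IsManifold I ∞ M] [IsManifold I' ∞ N]

theorem IsChartProjection.coordVec_mfderiv {p : M → N} {π : E →L[ℝ] E'}
    (h : IsChartProjection I I' p π) {z₀ z : M} (hz : z ∈ (chartAt H z₀).source)
    (v : TangentSpace I z) :
    coordVec I' (p z₀) (p z) (mfderiv I I' p z v) = π (coordVec I z₀ z v) := by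
  have he : extChartAt I' (p z₀) ∘ p =ᶠ[𝓝 z] π ∘ extChartAt I z₀ := by
    filter_upwards [(chartAt H z₀).open_source.mem_nhds hz] with y hy
    exact h.extChartAt_eq z₀ y hy
  have h1 := mfderiv_comp z (I := I) (I' := I') (I'' := 𝓘(ℝ, E'))
    (mdifferentiableAt_extChartAt (h.mem_source z₀ z hz))
    (h.contMDiff.mdifferentiableAt (x := z) (by simp))
  have h2 := mfderiv_comp z (I := I) (I' := 𝓘(ℝ, E)) (I'' := 𝓘(ℝ, E'))
    (π.differentiableAt (x := extChartAt I z₀ z)).mdifferentiableAt (mdifferentiableAt_extChartAt hz)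
  have h3 := h1.symm.trans ((he.mfderiv_eq (I := I) (I' := 𝓘(ℝ, E'))).trans h2)
  rw [mfderiv_eq_fderiv, π.fderiv] at h3
  exact congrArg (fun L : TangentSpace I z →L[ℝ] E' => L v) h3

theorem IsChartProjection.mfderiv_eq_zero_iff {p : M → N} {π : E →L[ℝ] E'}
    (h : IsChartProjection I I' p π) {z₀ z : M} (hz : z ∈ (chartAt H z₀).source)
    (v : TangentSpace I z) : mfderiv I I' p z v = 0 ↔ π (coordVec I z₀ z v) = 0 := by
  rw [← h.coordVec_mfderiv hz]
  refine ⟨fun h0 => by rw [h0, map_zero], fun h0 => ?_⟩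
  have h1 := coordField_coordVec (h.mem_source z₀ z hz) (mfderiv I I' p z v)
  rw [h0] at h1
  exact h1.symm.trans (map_zero (mfderiv I' 𝓘(ℝ, E') (extChartAt I' (p z₀)) (p z)).inverse)

theorem IsChartProjection.mfderiv_coordField {p : M → N} {π : E →L[ℝ] E'}
    (h : IsChartProjection I I' p π) {z₀ z : M} (hz : z ∈ (chartAt H z₀).source) (u : E) :
    mfderiv I I' p z (coordField I z₀ u z) = coordField I' (p z₀) (π u) (p z) := by
  have h1 := coordField_coordVec (h.mem_source z₀ z hz) (mfderiv I I' p z (coordField I z₀ u z))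
  rw [h.coordVec_mfderiv hz, coordVec_coordField hz] at h1
  exact h1.symm

end Projection

section AdaptedPair

variable {E : Type*} [NormedAddCommGroup E] [NormedSpace ℝ E]
  {H : Type*} [TopologicalSpace H] {I : ModelWithCorners ℝ E H}
  {M : Type*} [TopologicalSpace M] [ChartedSpace H M] [FiniteDimensional ℝ E] [IsManifold I ∞ M]
  {E' : Type*} [NormedAddCommGroup E'] [NormedSpace ℝ E']
  {H' : Type*} [TopologicalSpace H'] {I' : ModelWithCorners ℝ E' H'}
  {N : Type*} [TopologicalSpace N] [ChartedSpace H' N] [IsManifold I' ∞ N]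
  {E'' : Type*} [NormedAddCommGroup E''] [NormedSpace ℝ E'']
  {H'' : Type*} [TopologicalSpace H''] {I'' : ModelWithCorners ℝ E'' H''}
  {N' : Type*} [TopologicalSpace N'] [ChartedSpace H'' N'] [IsManifold I'' ∞ N']
  {c : ConformalStructure I M}

variable (I' I'') in
/-- The maps `p` and `p'` are, in the preferred charts, the projections of a direct sum
`E' × E'' ≃ E` (with inclusions `ι`, `ι'`), their fibres are orthogonal, and the Weyl structure `D`
preserves the tangent bundles of the fibres. This is the situation of a conformal product, with the
two factors in either order. The bounds on the norms make the projections preserve balls of the model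
space. -/
structure IsAdaptedPair (D : WeylStructure c) (p : M → N) (p' : M → N') (π : E →L[ℝ] E')
    (π' : E →L[ℝ] E'') (ι : E' →L[ℝ] E) (ι' : E'' →L[ℝ] E) : Prop where
  fst : IsChartProjection I I' p π
  snd : IsChartProjection I I'' p' π'
  fst_inl : ∀ u, π (ι u) = u
  snd_inr : ∀ u, π' (ι' u) = u
  fst_inr : ∀ u, π (ι' u) = 0
  snd_inl : ∀ u, π' (ι u) = 0
  inl_add_inr : ∀ x, ι (π x) + ι' (π' x) = x
  norm_inl_le : ∀ x, ‖ι (π x)‖ ≤ ‖x‖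
  norm_inr_le : ∀ x, ‖ι' (π' x)‖ ≤ ‖x‖
  orthogonal : ∀ (z : M) (X Y : TangentSpace I z), mfderiv I I'' p' z X = 0 →
    mfderiv I I' p z Y = 0 → c.inner z X Y = 0
  parallel_fst : ∀ W : Set M, IsOpen W → ∀ Y : ∀ z : M, TangentSpace I z, SmoothFieldOn I Y W →
    (∀ z ∈ W, mfderiv I I'' p' z (Y z) = 0) →
      ∀ z ∈ W, ∀ v : TangentSpace I z, mfderiv I I'' p' z (D.cov Y z v) = 0
  parallel_snd : ∀ W : Set M, IsOpen W → ∀ Y : ∀ z : M, TangentSpace I z, SmoothFieldOn I Y W →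
    (∀ z ∈ W, mfderiv I I' p z (Y z) = 0) →
      ∀ z ∈ W, ∀ v : TangentSpace I z, mfderiv I I' p z (D.cov Y z v) = 0

variable {D : WeylStructure c} {p : M → N} {p' : M → N'} {π : E →L[ℝ] E'}
  {π' : E →L[ℝ] E''} {ι : E' →L[ℝ] E} {ι' : E'' →L[ℝ] E}

omit [IsManifold I' ∞ N] [IsManifold I'' ∞ N'] in
theorem IsAdaptedPair.symm (h : IsAdaptedPair I' I'' D p p' π π' ι ι') :
    IsAdaptedPair I'' I' D p' p π' π ι' ι where
  fst := h.snd
  snd := h.fst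
  fst_inl := h.snd_inr
  snd_inr := h.fst_inl
  fst_inr := h.snd_inl
  snd_inl := h.fst_inr
  inl_add_inr x := by rw [add_comm, h.inl_add_inr]
  norm_inl_le := h.norm_inr_le
  norm_inr_le := h.norm_inl_le
  orthogonal z X Y hX hY := by rw [c.symm]; exact h.orthogonal z Y X hY hX
  parallel_fst := h.parallel_snd
  parallel_snd := h.parallel_fst

omit [FiniteDimensional ℝ E] [IsManifold I ∞ M] in
theorem coordField_add (z₀ z : M) (u v : E) :
    coordField I z₀ (u + v) z = coordField I z₀ u z + coordField I z₀ v z :=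
  map_add (mfderiv I 𝓘(ℝ, E) (extChartAt I z₀) z).inverse u v

/-- Coordinate vector fields commute, so their covariant derivatives are symmetric. -/
theorem cov_coordField_comm (D : WeylStructure c) {z₀ z : M} (hz : z ∈ (chartAt H z₀).source)
    (u v : E) : D.cov (coordField I z₀ u) z (coordField I z₀ v z)
      = D.cov (coordField I z₀ v) z (coordField I z₀ u z) := by
  have : CompleteSpace E := FiniteDimensional.complete ℝ E
  have hUo : IsOpen (chartAt H z₀).source := (chartAt H z₀).open_source
  have h := D.cov.torsion_eq_zero_iff.1 D.torsion_eq_zero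
    ((coordField_smooth (I := I) z₀ v).mdifferentiableAt hUo hz)
    ((coordField_smooth (I := I) z₀ u).mdifferentiableAt hUo hz)
  rwa [mlieBracket_coordField hz, sub_eq_zero] at h

omit [IsManifold I' ∞ N] in
theorem IsAdaptedPair.snd_coordVec_cov (h : IsAdaptedPair I' I'' D p p' π π' ι ι') {z₀ z : M}
    (hz : z ∈ (chartAt H z₀).source) (u : E') (v : TangentSpace I z) :
    π' (coordVec I z₀ z (D.cov (coordField I z₀ (ι u)) z v)) = 0 := by
  have : CompleteSpace E := FiniteDimensional.complete ℝ E
  refine (h.snd.mfderiv_eq_zero_iff hz _).1 (h.parallel_fst _ (chartAt H z₀).open_source _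
    (coordField_smooth z₀ (ι u)) (fun y hy => ?_) z hz v)
  rw [h.snd.mfderiv_eq_zero_iff hy, coordVec_coordField hy, h.snd_inl]

omit [IsManifold I' ∞ N] in
theorem IsAdaptedPair.cov_inl (h : IsAdaptedPair I' I'' D p p' π π' ι ι') {z₀ z : M}
    (hz : z ∈ (chartAt H z₀).source) (u : E') (v : TangentSpace I z) :
    D.cov (coordField I z₀ (ι u)) z v =
      coordField I z₀ (ι (π (coordVec I z₀ z (D.cov (coordField I z₀ (ι u)) z v)))) z := by
  have h1 := h.inl_add_inr (coordVec I z₀ z (D.cov (coordField I z₀ (ι u)) z v))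
  rw [h.snd_coordVec_cov hz, map_zero, add_zero] at h1
  rw [h1, coordField_coordVec hz]

/-- A coordinate field of one factor is parallel in the directions of the other factor. -/
theorem IsAdaptedPair.cov_inl_inr (h : IsAdaptedPair I' I'' D p p' π π' ι ι') {z₀ z : M}
    (hz : z ∈ (chartAt H z₀).source) (u : E') (v : E'') :
    D.cov (coordField I z₀ (ι u)) z (coordField I z₀ (ι' v) z) = 0 := by
  have h1 := h.snd_coordVec_cov hz u (coordField I z₀ (ι' v) z)
  have h2 := h.symm.snd_coordVec_cov hz v (coordField I z₀ (ι u) z)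
  rw [cov_coordField_comm D hz] at h2
  have h3 := h.inl_add_inr (coordVec I z₀ z
    (D.cov (coordField I z₀ (ι u)) z (coordField I z₀ (ι' v) z)))
  rw [h1, h2, map_zero, map_zero, add_zero] at h3
  rw [← coordField_coordVec hz (D.cov _ z _), ← h3]
  exact map_zero (mfderiv I 𝓘(ℝ, E) (extChartAt I z₀) z).inverse

theorem IsAdaptedPair.leeForm_inr (h : IsAdaptedPair I' I'' D p p' π π' ι ι') {z₀ z : M}
    (hz : z ∈ (chartAt H z₀).source) (u : E') (v : E'') :
    D.leeForm (coordField I z₀ (ι u)) z (coordField I z₀ (ι' v) z) = 0 := by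
  rw [D.leeForm_apply, h.cov_inl_inr hz, map_zero, LinearMap.zero_apply]

end AdaptedPair

/-! ### Closedness from a parallel form of low degree -/

section Retraction

variable {E : Type*} [NormedAddCommGroup E] [NormedSpace ℝ E]
  {H : Type*} [TopologicalSpace H] {I : ModelWithCorners ℝ E H}
  {M : Type*} [TopologicalSpace M] [ChartedSpace H M] [IsManifold I ∞ M] [I.Boundaryless]

/-- Around every point, a linear projection of the model space induces a retraction `ρ` of a coordinate
ball. Functions that are constant in the direction of the kernel are invariant under `ρ`, and so are
their derivatives in the directions of the image. -/
theorem exists_chart_retraction (A : E →L[ℝ] E) (hA : ∀ x, ‖A x‖ ≤ ‖x‖) (z₀ : M) :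
    ∃ (V : Set M) (ρ : M → M), IsOpen V ∧ z₀ ∈ V ∧ V ⊆ (chartAt H z₀).source ∧ Set.MapsTo ρ V V ∧
      ContMDiffOn I I ∞ ρ V ∧
      (∀ F : M → ℝ, (∀ z ∈ V, MDifferentiableAt I 𝓘(ℝ, ℝ) F z) → ∀ z ∈ V, ∀ v : TangentSpace I z,
        mvfderiv I (F ∘ ρ) z v
          = mvfderiv I F (ρ z) (coordField I z₀ (A (coordVec I z₀ z v)) (ρ z))) ∧
      ∀ F : M → ℝ, (∀ z ∈ V, MDifferentiableAt I 𝓘(ℝ, ℝ) F z) →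
        (∀ z ∈ V, ∀ x, mvfderiv I F z (coordField I z₀ (x - A x) z) = 0) →
        ∀ z ∈ V, F z = F (ρ z) := by
  set f := extChartAt I z₀ with hf
  set p₀ := f z₀ with hp₀
  obtain ⟨ε, hε, hball⟩ := Metric.mem_nhds_iff.1 (extChartAt_target_mem_nhds (I := I) z₀)
  have hsrc : f.source = (chartAt H z₀).source := extChartAt_source I z₀
  set α : E → E := fun x => p₀ + A (x - p₀) with hα
  have hαb : ∀ x ∈ Metric.ball p₀ ε, α x ∈ Metric.ball p₀ ε := by
    intro x hx
    rw [mem_ball_iff_norm] at hx ⊢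
    simp only [hα, add_sub_cancel_left]
    exact (hA _).trans_lt hx
  have hαd : ∀ x, HasFDerivAt α A x := fun x =>
    (A.hasFDerivAt.comp x ((hasFDerivAt_id x).sub_const p₀)).const_add p₀
  set V : Set M := f.source ∩ f ⁻¹' Metric.ball p₀ ε with hV
  have hVo : IsOpen V := (continuousOn_extChartAt z₀).isOpen_inter_preimage
    (isOpen_extChartAt_source z₀) Metric.isOpen_ball
  have hVs : V ⊆ (chartAt H z₀).source := fun z hz => hsrc ▸ hz.1
  set ρ : M → M := fun z => f.symm (α (f z)) with hρ
  have hfρ : ∀ z ∈ V, f (ρ z) = α (f z) := fun z hz => f.right_inv (hball (hαb _ hz.2))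
  have hmaps : Set.MapsTo ρ V V := fun z hz => by
    refine ⟨f.map_target (hball (hαb _ hz.2)), ?_⟩
    rw [Set.mem_preimage, hfρ z hz]
    exact hαb _ hz.2
  have hsymm : ∀ x ∈ Metric.ball p₀ ε, f.symm x ∈ V := fun x hx =>
    ⟨f.map_target (hball hx), by rwa [Set.mem_preimage, f.right_inv (hball hx)]⟩
  have hsm : ContMDiffOn I I ∞ ρ V := by
    have h1 : ContMDiffOn I 𝓘(ℝ, E) ∞ f V := (contMDiffOn_extChartAt (x := z₀)).mono hVs
    have h2 : ContDiff ℝ ∞ α := contDiff_const.add (A.contDiff.comp (contDiff_id.sub contDiff_const))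
    exact (contMDiffOn_extChartAt_symm (n := ∞) z₀).comp (h2.contMDiff.comp_contMDiffOn h1)
      fun z hz => hball (hαb _ hz.2)
  refine ⟨V, ρ, hVo, ⟨mem_extChartAt_source z₀, Metric.mem_ball_self hε⟩, hVs, hmaps, hsm, ?_, ?_⟩
  · intro F hF z hz v
    have hd := hF _ (hmaps hz)
    have h1 : MDifferentiableAt I 𝓘(ℝ, ℝ) (F ∘ ρ) z := hd.comp z
      ((hsm.contMDiffAt (hVo.mem_nhds hz)).mdifferentiableAt (by simp))
    rw [mvfderiv_eq_fderiv (hVs hz) h1, mvfderiv_eq_fderiv (hVs (hmaps hz)) hd,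
      coordVec_coordField (hVs (hmaps hz)), ← hf, hfρ z hz]
    have h2 : (F ∘ ρ) ∘ f.symm =ᶠ[𝓝 (f z)] (F ∘ f.symm) ∘ α := by
      filter_upwards [Metric.isOpen_ball.mem_nhds hz.2] with x hx
      simp only [Function.comp_apply, hρ, f.right_inv (hball hx)]
    have h3 := differentiableAt_comp_extChartAt_symm (hVs (hmaps hz)) hd
    rw [← hf, hfρ z hz] at h3
    rw [h2.fderiv_eq, (h3.hasFDerivAt.comp (f z) (hαd (f z))).fderiv]
    rfl
  · intro F hF h0 z hz
    have h1 := (convex_ball p₀ ε).eq_of_fderiv_apply_eq_zero (F := F ∘ f.symm) (p := f z)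
      (q := α (f z)) (fun x hx => ?_) hz.2 (hαb _ hz.2) (fun x hx => ?_)
    · simp only [Function.comp_apply, f.left_inv hz.1] at h1
      exact h1.symm
    · have h2 := differentiableAt_comp_extChartAt_symm (hVs (hsymm x hx)) (hF _ (hsymm x hx))
      rwa [← hf, f.right_inv (hball hx)] at h2
    · have h2 := mvfderiv_eq_fderiv (hVs (hsymm x hx)) (hF _ (hsymm x hx))
        (coordField I z₀ ((f z - p₀) - A (f z - p₀)) (f.symm x))
      rw [h0 _ (hsymm x hx), coordVec_coordField (hVs (hsymm x hx)), ← hf,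
        f.right_inv (hball hx)] at h2
      have h3 : α (f z) - f z = -((f z - p₀) - A (f z - p₀)) := by simp only [hα]; abel
      rw [h3, map_neg, ← h2, neg_zero]

end Retraction

/-- A form that vanishes as soon as one argument is in the kernel of `P` factors through `P`. -/
theorem AlternatingMap.eq_of_apply_eq_zero_of_ker {V W U : Type*} [AddCommGroup V] [Module ℝ V]
    [AddCommGroup W] [Module ℝ W] [AddCommGroup U] [Module ℝ U] {k : ℕ} (f : V [⋀^Fin k]→ₗ[ℝ] W)
    (P : V →ₗ[ℝ] U) (hf : ∀ Y i, P (Y i) = 0 → f Y = 0) {Y Z : Fin k → V}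
    (h : ∀ i, P (Y i) = P (Z i)) : f Y = f Z := by
  have h1 := f.toMultilinearMap.map_add_univ Z (Y - Z)
  simp only [AlternatingMap.coe_multilinearMap, add_sub_cancel] at h1
  rw [h1, Finset.sum_eq_single Finset.univ]
  · rw [Finset.piecewise_univ]
  · intro s _ hs
    obtain ⟨i, hi⟩ : ∃ i, i ∉ s := by
      by_contra! hcon
      exact hs (Finset.eq_univ_iff_forall.2 hcon)
    refine hf _ i ?_
    rw [Finset.piecewise_eq_of_notMem _ _ _ hi, Pi.sub_apply, map_sub, h, sub_self]
  · exact fun hs => absurd (Finset.mem_univ _) hs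

section AdaptedPair

variable {E : Type*} [NormedAddCommGroup E] [NormedSpace ℝ E]
  {H : Type*} [TopologicalSpace H] {I : ModelWithCorners ℝ E H}
  {M : Type*} [TopologicalSpace M] [ChartedSpace H M] [FiniteDimensional ℝ E] [IsManifold I ∞ M]
  {E' : Type*} [NormedAddCommGroup E'] [NormedSpace ℝ E']
  {H' : Type*} [TopologicalSpace H'] {I' : ModelWithCorners ℝ E' H'}
  {N : Type*} [TopologicalSpace N] [ChartedSpace H' N] [IsManifold I' ∞ N]
  {E'' : Type*} [NormedAddCommGroup E''] [NormedSpace ℝ E'']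
  {H'' : Type*} [TopologicalSpace H''] {I'' : ModelWithCorners ℝ E'' H''}
  {N' : Type*} [TopologicalSpace N'] [ChartedSpace H'' N'] [IsManifold I'' ∞ N']
  {c : ConformalStructure I M} {D : WeylStructure c} {p : M → N} {p' : M → N'} {π : E →L[ℝ] E'}
  {π' : E →L[ℝ] E''} {ι : E' →L[ℝ] E} {ι' : E'' →L[ℝ] E}

omit [IsManifold I' ∞ N] [IsManifold I'' ∞ N'] in
theorem IsAdaptedPair.inl_ne_zero (h : IsAdaptedPair I' I'' D p p' π π' ι ι') {u : E'} (hu : u ≠ 0) :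
    ι u ≠ 0 := fun h0 => hu (by rw [← h.fst_inl u, h0, map_zero])

omit [IsManifold I' ∞ N] [IsManifold I'' ∞ N'] in
theorem IsAdaptedPair.finiteDimensional (h : IsAdaptedPair I' I'' D p p' π π' ι ι') :
    FiniteDimensional ℝ E' :=
  Module.Finite.of_surjective π.toLinearMap fun u => ⟨ι u, h.fst_inl u⟩

/-- The tangent space of the first factor, as a subspace of the tangent space at a point of a chart. -/
def coordInl {z₀ z : M} (hz : z ∈ (chartAt H z₀).source) (ι : E' →L[ℝ] E) :
    E' →ₗ[ℝ] TangentSpace I z :=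
  (coordEquiv hz).symm.toLinearMap ∘ₗ ι.toLinearMap

omit [IsManifold I'' ∞ N'] in
theorem IsAdaptedPair.form_apply_eq (h : IsAdaptedPair I' I'' D p p' π π' ι ι')
    {z₀ z : M} (hz : z ∈ (chartAt H z₀).source) {k : ℕ} {r : ℝ}
    {α : TangentSpace I z [⋀^Fin k]→ₗ[ℝ] WeightAt I r z}
    (hα : ∀ Y i, mfderiv I I' p z (Y i) = 0 → α Y = 0) (Y : Fin k → TangentSpace I z) :
    α Y = α fun i => coordField I z₀ (ι (π (coordVec I z₀ z (Y i)))) z := by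
  refine AlternatingMap.eq_of_apply_eq_zero_of_ker α (mfderiv I I' p z).toLinearMap hα fun i => ?_
  refine sub_eq_zero.1 ((map_sub (mfderiv I I' p z) _ _).symm.trans ?_)
  rw [h.fst.mfderiv_eq_zero_iff hz, map_sub, map_sub, coordVec_coordField hz, h.fst_inl, sub_self]

variable [I.Boundaryless]

/-- The connection form of the gauge defined by a coordinate field of the first factor is constant
along the second factor if there is a parallel form of low degree on the first factor: the difference
of two values satisfies the hypotheses of `lee_eq_zero_of_form`. -/
theorem IsAdaptedPair.exists_retraction [T2Space M] [ConnectedSpace M]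
    (h : IsAdaptedPair I' I'' D p p' π π' ι ι') {k : ℕ} (hk : 1 ≤ k) (hkn : k < finrank ℝ E')
    {φ : WeightlessForm I M k} (hφ : WeightedForm.Smooth φ)
    (hp : WeightedForm.Parallel D.cov φ) (hne : ∃ z, φ z ≠ 0)
    (hker : ∀ z Y i, mfderiv I I' p z (Y i) = 0 → φ z Y = 0) (z₀ : M) {u₀ : E'} (hu₀ : u₀ ≠ 0) :
    ∃ (V : Set M) (ρ : M → M), IsOpen V ∧ z₀ ∈ V ∧ V ⊆ (chartAt H z₀).source ∧ Set.MapsTo ρ V V ∧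
      ContMDiffOn I I ∞ ρ V ∧
      (∀ F : M → ℝ, (∀ z ∈ V, MDifferentiableAt I 𝓘(ℝ, ℝ) F z) → ∀ z ∈ V, ∀ v : TangentSpace I z,
        mvfderiv I (F ∘ ρ) z v
          = mvfderiv I F (ρ z) (coordField I z₀ (ι (π (coordVec I z₀ z v))) (ρ z))) ∧
      ∀ z ∈ V, ∀ w : E', D.leeForm (coordField I z₀ (ι u₀)) z (coordField I z₀ (ι w) z)
        = D.leeForm (coordField I z₀ (ι u₀)) (ρ z) (coordField I z₀ (ι w) (ρ z)) := by
  have : CompleteSpace E := FiniteDimensional.complete ℝ E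
  have : FiniteDimensional ℝ E' := h.finiteDimensional
  have hn : 1 ≤ finrank ℝ E := finrank_pos_iff.2 ⟨ι u₀, 0, h.inl_ne_zero hu₀⟩
  obtain ⟨V, ρ, hVo, hz₀, hVs, hmaps, hsm, hder, hinv⟩ :=
    exists_chart_retraction (I := I) (ι ∘L π) h.norm_inl_le z₀
  refine ⟨V, ρ, hVo, hz₀, hVs, hmaps, hsm, hder, ?_⟩
  have hUo : IsOpen (chartAt H z₀).source := (chartAt H z₀).open_source
  let X : E' → ∀ x : M, TangentSpace I x := fun u => coordField I z₀ (ι u)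
  have hX : ∀ u, SmoothFieldOn I (X u) (chartAt H z₀).source := fun u => coordField_smooth z₀ (ι u)
  have hY₀ : ∀ z ∈ (chartAt H z₀).source, X u₀ z ≠ 0 :=
    fun z hz => coordField_ne_zero hz (h.inl_ne_zero hu₀)
  -- invariant functions have the same values and derivatives along the first factor at `z` and `ρ z`
  have hinv' : ∀ F : M → ℝ, (∀ z ∈ V, MDifferentiableAt I 𝓘(ℝ, ℝ) F z) →
      (∀ z ∈ V, ∀ v, mvfderiv I F z (coordField I z₀ (ι' v) z) = 0) → ∀ z ∈ V, F z = F (ρ z) ∧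
        ∀ w, mvfderiv I F z (X w z) = mvfderiv I F (ρ z) (X w (ρ z)) := by
    intro F hF h0
    have h1 := hinv F hF fun z hz x => by
      have h2 : x - (ι ∘L π) x = ι' (π' x) := sub_eq_of_eq_add' (h.inl_add_inr x).symm
      rw [h2, h0 z hz]
    refine fun z hz => ⟨h1 z hz, fun w => ?_⟩
    have h2 : F =ᶠ[𝓝 z] F ∘ ρ := by
      filter_upwards [hVo.mem_nhds hz] with y hy using h1 y hy
    have h3 := hder F hF z hz (X w z)
    have h4 : (ι ∘L π) (coordVec I z₀ z (X w z)) = ι w := by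
      rw [coordVec_coordField (hVs hz), ContinuousLinearMap.comp_apply, h.fst_inl]
    rw [h4] at h3
    refine Eq.trans ?_ h3
    exact congrArg (fun L : TangentSpace I z →L[ℝ] ℝ => L (X w z)) (h2.mfderiv_eq (I := I))
  -- the connection on the first factor, in coordinates
  let Γ : M → E' → E' → E' := fun z w u => π (coordVec I z₀ z (D.cov (X u) z (X w z)))
  have hΓ : ∀ z ∈ V, ∀ w u, D.cov (X u) z (X w z) = X (Γ z w u) z := fun z hz w u =>
    h.cov_inl (hVs hz) u (X w z)
  have hgd : ∀ z ∈ V, ∀ u v x, mvfderiv I (fun y => gaugeMetric c (X u₀ y) (X u y) (X v y)) z x = _ :=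
    fun z hz u v x => mvfderiv_gaugeMetric D hUo (hX u₀) hY₀ (hX u) (hX v) (hVs hz) x
  have hΦd : ∀ z ∈ V, ∀ (s : Fin k → E') x,
      mvfderiv I (fun y => gaugeForm c (X u₀ y) (φ y) (fun i => X (s i) y)) z x = _ :=
    fun z hz s x => mvfderiv_gaugeForm D hUo (hX u₀) hY₀ hφ hp (fun i => hX (s i)) (hVs hz) x
  have hg := fun u v => hinv' (fun z => gaugeMetric c (X u₀ z) (X u z) (X v z)) (fun z hz =>
    ((gaugeMetric_smooth (c := c) hUo (hX u₀) hY₀ (hX u) (hX v)).contMDiffAt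
      (hUo.mem_nhds (hVs hz))).mdifferentiableAt (by simp)) fun z hz w => by
    rw [hgd z hz, h.cov_inl_inr (hVs hz), h.cov_inl_inr (hVs hz), h.leeForm_inr (hVs hz)]
    simp
  have hΦ := fun s : Fin k → E' => hinv' (fun z => gaugeForm c (X u₀ z) (φ z) (fun i => X (s i) z))
    (fun z hz => ((gaugeForm_smooth (c := c) hUo (hX u₀) hY₀ hφ fun i => hX (s i)).contMDiffAt
      (hUo.mem_nhds (hVs hz))).mdifferentiableAt (by simp)) fun z hz w => by
    rw [hΦd z hz, h.leeForm_inr (hVs hz)]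
    simp only [mul_zero, zero_mul, sub_zero]
    refine Finset.sum_eq_zero fun i _ => AlternatingMap.map_coord_zero _ i ?_
    rw [Function.update_self]
    exact h.cov_inl_inr (hVs hz) _ _
  intro z hz
  have hρ := hmaps hz
  -- the metric and the form at `z` and `ρ z`, transported to `E'`, coincide; the connections differ by
  -- `Γ z - Γ (ρ z)`
  let g : E' →ₗ[ℝ] E' →ₗ[ℝ] ℝ :=
    (gaugeMetric c (X u₀ z)).compl₁₂ (coordInl (hVs hz) ι) (coordInl (hVs hz) ι)
  let Φ : E' [⋀^Fin k]→ₗ[ℝ] ℝ :=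
    (gaugeForm c (X u₀ z) (φ z)).compLinearMap (coordInl (hVs hz) ι)
  let δ : E' →ₗ[ℝ] ℝ := D.leeForm (X u₀) z ∘ₗ coordInl (hVs hz) ι
    - D.leeForm (X u₀) (ρ z) ∘ₗ coordInl (hVs hρ) ι
  suffices hδ : δ = 0 from fun w => sub_eq_zero.1 (congrArg (fun L : E' →ₗ[ℝ] ℝ => L w) hδ)
  have hXsub : ∀ y ∈ V, ∀ u v, X (u - v) y = X u y - X v y := by
    intro y hy u v
    exact map_sub (coordInl (I := I) (hVs hy) ι) u v
  refine lee_eq_zero_of_form hk hkn g (fun u v => gaugeMetric_symm _ _ _) (fun u hu => ?_)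
    (fun w u => Γ z w u - Γ (ρ z) w u) (fun u v => ?_) δ (fun w u v => ?_) Φ ?_ (fun w s => ?_)
  · exact gaugeMetric_pos (hY₀ z (hVs hz)) (coordField_ne_zero (hVs hz) (h.inl_ne_zero hu))
  · have h1 : ∀ y ∈ V, Γ y u v = Γ y v u := fun y hy => by
      simp only [Γ, X]
      rw [cov_coordField_comm D (hVs hy)]
    simp only [h1 z hz, h1 _ hρ]
  · have h1 := ((hg u v) z hz).2 w
    rw [hgd z hz, hgd _ hρ, hΓ z hz, hΓ z hz, hΓ _ hρ, hΓ _ hρ, ← (hg _ _ z hz).1,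
      ← (hg _ _ z hz).1, ← (hg _ _ z hz).1] at h1
    change 2 * (D.leeForm (X u₀) z (X w z) - D.leeForm (X u₀) (ρ z) (X w (ρ z)))
      * gaugeMetric c (X u₀ z) (X u z) (X v z) =
      gaugeMetric c (X u₀ z) (X (Γ z w u - Γ (ρ z) w u) z) (X v z)
        + gaugeMetric c (X u₀ z) (X u z) (X (Γ z w v - Γ (ρ z) w v) z)
    rw [hXsub z hz, hXsub z hz, map_sub, map_sub, LinearMap.sub_apply]
    linear_combination -h1
  · intro h0
    refine parallel_ne_zero hn D hφ hp hne z (AlternatingMap.ext fun Y => ?_)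
    rw [h.form_apply_eq (hVs hz) (hker z), AlternatingMap.zero_apply,
      ← gaugeForm_eq_zero_iff (c := c) (hY₀ z (hVs hz))]
    exact congrArg (fun L : E' [⋀^Fin k]→ₗ[ℝ] ℝ => L fun i => π (coordVec I z₀ z (Y i))) h0
  · have h1 := ((hΦ s) z hz).2 w
    have h2 : ∀ y ∈ V, ∀ i, Function.update (fun j => X (s j) y) i (D.cov (X (s i)) y (X w y))
        = fun j => X (Function.update s i (Γ y w (s i)) j) y := by
      intro y hy i
      rw [hΓ y hy]
      funext j
      by_cases hj : j = i
      · subst hj; simp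
      · simp [Function.update_of_ne hj]
    rw [hΦd z hz, hΦd _ hρ] at h1
    simp only [h2 z hz, h2 _ hρ, ← (hΦ _ z hz).1] at h1
    have h3 : ∀ t : Fin k → E', gaugeForm c (X u₀ z) (φ z) (fun j => X (t j) z) = Φ t :=
      fun t => rfl
    simp only [h3] at h1
    change k * (D.leeForm (X u₀) z (X w z) - D.leeForm (X u₀) (ρ z) (X w (ρ z))) * Φ s = _
    simp only [Φ.map_update_sub, Finset.sum_sub_distrib]
    linear_combination -h1

end AdaptedPair

theorem exists_weightQuot_eq {E : Type*} [NormedAddCommGroup E] [NormedSpace ℝ E]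
    {H : Type*} [TopologicalSpace H] {I : ModelWithCorners ℝ E H}
    {M : Type*} [TopologicalSpace M] [ChartedSpace H M] [FiniteDimensional ℝ E] {x : M}
    {κ : WeightAt I 2 x} (hκ : ∀ b, 0 < κ.1 b) (r a : ℝ) :
    ∃ l : WeightAt I r x, weightQuot κ l = a := by
  refine ⟨⟨fun b => a * (κ.1 b) ^ (r / 2), fun b b' => ?_⟩, ?_⟩
  · have hd : 0 < |b.det b'| := abs_pos.2 (b.isUnit_det b').ne_zero
    beta_reduce
    rw [κ.2 b b', Real.mul_rpow (Real.rpow_nonneg hd.le _) (hκ b).le, ← Real.rpow_mul hd.le,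
      show -(2 / ((finrank ℝ E : ℕ) : ℝ)) * (r / 2) = -(r / (finrank ℝ E : ℕ)) by ring]
    ring
  · have b : Basis (Fin (finrank ℝ E)) ℝ (TangentSpace I x) := (finBasis ℝ E : Basis _ ℝ E)
    rw [weightQuot_eq (hκ b)]
    exact mul_div_cancel_right₀ _ (Real.rpow_pos_of_pos (hκ b) _).ne'

section AdaptedPair

variable {E : Type*} [NormedAddCommGroup E] [NormedSpace ℝ E]
  {H : Type*} [TopologicalSpace H] {I : ModelWithCorners ℝ E H}
  {M : Type*} [TopologicalSpace M] [ChartedSpace H M] [FiniteDimensional ℝ E] [IsManifold I ∞ M]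
  {E' : Type*} [NormedAddCommGroup E'] [NormedSpace ℝ E']
  {H' : Type*} [TopologicalSpace H'] {I' : ModelWithCorners ℝ E' H'}
  {N : Type*} [TopologicalSpace N] [ChartedSpace H' N] [IsManifold I' ∞ N]
  {E'' : Type*} [NormedAddCommGroup E''] [NormedSpace ℝ E'']
  {H'' : Type*} [TopologicalSpace H''] {I'' : ModelWithCorners ℝ E'' H''}
  {N' : Type*} [TopologicalSpace N'] [ChartedSpace H'' N'] [IsManifold I'' ∞ N']
  {c : ConformalStructure I M} {D : WeylStructure c} {p : M → N} {p' : M → N'} {π : E →L[ℝ] E'}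
  {π' : E →L[ℝ] E''} {ι : E' →L[ℝ] E} {ι' : E'' →L[ℝ] E}

omit [IsManifold I' ∞ N] [IsManifold I'' ∞ N'] in
theorem IsAdaptedPair.coordField_add_coordField (h : IsAdaptedPair I' I'' D p p' π π' ι ι')
    {z₀ z : M} (hz : z ∈ (chartAt H z₀).source) (v : TangentSpace I z) :
    coordField I z₀ (ι (π (coordVec I z₀ z v))) z + coordField I z₀ (ι' (π' (coordVec I z₀ z v))) z
      = v := by
  rw [← coordField_add, h.inl_add_inr, coordField_coordVec hz]

variable [I.Boundaryless]

/-- If there is a parallel form of low degree on the first factor, the connection form of the weight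
bundle is, in a chart, pulled back from the slice through the centre; there it is exact, because the
coordinate fields of the second factor are parallel along the slice. -/
theorem IsAdaptedPair.closed [T2Space M] [ConnectedSpace M]
    (h : IsAdaptedPair I' I'' D p p' π π' ι ι') (hn : 1 ≤ finrank ℝ E'') {k : ℕ} (hk : 1 ≤ k)
    (hkn : k < finrank ℝ E') {φ : WeightlessForm I M k} (hφ : WeightedForm.Smooth φ)
    (hp : WeightedForm.Parallel D.cov φ) (hne : ∃ z, φ z ≠ 0)
    (hker : ∀ z Y i, mfderiv I I' p z (Y i) = 0 → φ z Y = 0) : D.Closed := by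
  have : CompleteSpace E := FiniteDimensional.complete ℝ E
  have : FiniteDimensional ℝ E' := h.finiteDimensional
  have : FiniteDimensional ℝ E'' := h.symm.finiteDimensional
  have : Nontrivial E' := finrank_pos_iff.1 (hk.trans hkn.le)
  have : Nontrivial E'' := finrank_pos_iff.1 hn
  obtain ⟨u₀, hu₀⟩ := exists_ne (0 : E')
  obtain ⟨v₀, hv₀⟩ := exists_ne (0 : E'')
  intro z₀
  obtain ⟨V, ρ, hVo, hz₀, hVs, hmaps, hsm, hder, hlee⟩ :=
    h.exists_retraction hk hkn hφ hp hne hker z₀ hu₀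
  have hUo : IsOpen (chartAt H z₀).source := (chartAt H z₀).open_source
  let X : E' → ∀ x : M, TangentSpace I x := fun u => coordField I z₀ (ι u)
  let X' : E'' → ∀ x : M, TangentSpace I x := fun u => coordField I z₀ (ι' u)
  have hX : SmoothFieldOn I (X u₀) (chartAt H z₀).source := coordField_smooth z₀ (ι u₀)
  have hX' : SmoothFieldOn I (X' v₀) (chartAt H z₀).source := coordField_smooth z₀ (ι' v₀)
  have hY₀ : ∀ z ∈ (chartAt H z₀).source, X u₀ z ≠ 0 :=
    fun z hz => coordField_ne_zero hz (h.inl_ne_zero hu₀)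
  have hY₀' : ∀ z ∈ (chartAt H z₀).source, X' v₀ z ≠ 0 :=
    fun z hz => coordField_ne_zero hz (h.symm.inl_ne_zero hv₀)
  -- along the slice, the derivative of `G` is `-2 q G` because `X' v₀` is parallel in its directions, so
  -- that `√G` is the coefficient of a parallel section of `L`
  set G : M → ℝ := fun z => gaugeMetric c (X u₀ z) (X' v₀ z) (X' v₀ z) with hG
  have hGsm : ContMDiffOn I 𝓘(ℝ, ℝ) ∞ G (chartAt H z₀).source :=
    gaugeMetric_smooth hUo hX hY₀ hX' hX'
  have hGpos : ∀ z ∈ V, 0 < G (ρ z) := fun z hz =>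
    gaugeMetric_pos (hY₀ _ (hVs (hmaps hz))) (hY₀' _ (hVs (hmaps hz)))
  have hGρ : ContMDiffOn I 𝓘(ℝ, ℝ) ∞ (G ∘ ρ) V := (hGsm.mono hVs).comp hsm hmaps
  set s : M → ℝ := fun z => Real.sqrt (G (ρ z)) with hs
  have hssm : ContMDiffOn I 𝓘(ℝ, ℝ) ∞ s V := fun z hz =>
    (Real.contDiffAt_sqrt (n := ∞) (hGpos z hz).ne').contMDiffAt.comp_contMDiffWithinAt z (hGρ z hz)
  have hsd : ∀ z ∈ V, ∀ v, mvfderiv I s z v = -(D.leeForm (X u₀) z v * s z) := by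
    intro z hz v
    have h1 : mvfderiv I (G ∘ ρ) z v = -(2 * D.leeForm (X u₀) z v * G (ρ z)) := by
      rw [hder G (fun y hy => (hGsm.contMDiffAt (hUo.mem_nhds (hVs hy))).mdifferentiableAt (by simp))
        z hz v, hG, mvfderiv_gaugeMetric D hUo hX hY₀ hX' hX' (hVs (hmaps hz)),
        h.symm.cov_inl_inr (hVs (hmaps hz)), map_zero, map_zero, LinearMap.zero_apply,
        ← hlee z hz]
      have h2 := congrArg (D.leeForm (X u₀) z) (h.coordField_add_coordField (hVs hz) v)
      rw [map_add, h.leeForm_inr (hVs hz), add_zero] at h2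
      rw [h2]
      ring
    have hsdiff : MDifferentiableAt I 𝓘(ℝ, ℝ) s z :=
      (hssm.contMDiffAt (hVo.mem_nhds hz)).mdifferentiableAt (by simp)
    have hGdiff : MDifferentiableAt I 𝓘(ℝ, ℝ) (G ∘ ρ) z :=
      (hGρ.contMDiffAt (hVo.mem_nhds hz)).mdifferentiableAt (by simp)
    obtain ⟨γ, rfl, -, hd⟩ := exists_curve z v
    have h3 := (hd _ hGdiff).sqrt (hGpos _ hz).ne'
    rw [(hd _ hsdiff).unique h3, h1]
    have h4 : s (γ 0) ≠ 0 := (Real.sqrt_pos.2 (hGpos _ hz)).ne'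
    have h5 : s (γ 0) * s (γ 0) = G (ρ (γ 0)) := Real.mul_self_sqrt (hGpos _ hz).le
    change _ / (2 * s (γ 0)) = _
    rw [← h5]
    field_simp
  -- the section of `L` with coefficient `s` in the gauge
  have hκ : ∀ z ∈ V, ∀ b, 0 < (c.inner z (X u₀ z) (X u₀ z)).1 b :=
    fun z hz b => c.pos z _ (hY₀ z (hVs hz)) b
  have hl : ∀ z : M, ∃ l : WeightAt I 1 z,
      z ∈ V → weightQuot (c.inner z (X u₀ z) (X u₀ z)) l = s z := by
    intro z
    by_cases hz : z ∈ V
    · obtain ⟨l, hl⟩ := exists_weightQuot_eq (hκ z hz) 1 (s z)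
      exact ⟨l, fun _ => hl⟩
    · exact ⟨0, fun hz' => absurd hz' hz⟩
  choose l hl using hl
  refine ⟨V, hVo, hz₀, l, fun W hW hWV e he => ?_, fun z hz h0 => ?_, fun W hW hWV e he z hz v => ?_⟩
  · have hK := c.inner_smooth hW (hX.mono (hWV.trans hVs)) (hX.mono (hWV.trans hVs)) he
    intro z hz
    have hr : ContDiffAt ℝ ∞ (fun t : ℝ => t ^ ((1 : ℝ) / 2))
        ((c.inner z (X u₀ z) (X u₀ z)).1 (e z)) :=
      contDiffAt_id.rpow_const_of_ne (hκ z (hWV hz) _).ne'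
    refine (((hssm.mono hWV) z hz).mul
      (hr.contMDiffAt.comp_contMDiffWithinAt z (hK z hz))).congr (fun y hy => ?_) ?_
    · rw [apply_eq_weightQuot_mul (hκ y (hWV hy) _), hl y (hWV hy)]; rfl
    · rw [apply_eq_weightQuot_mul (hκ z (hWV hz) _), hl z (hWV hz)]; rfl
  · have h1 := hl z hz
    rw [h0, map_zero] at h1
    exact (Real.sqrt_pos.2 (hGpos z hz)).ne h1
  · have he1 : (fun y => weightQuot (c.inner y (X u₀ y) (X u₀ y)) (l y)) =ᶠ[𝓝 z] s := by
      filter_upwards [hW.mem_nhds hz] with y hy using hl y (hWV hy)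
    have hsdiff : MDifferentiableAt I 𝓘(ℝ, ℝ) s z :=
      (hssm.contMDiffAt (hVo.mem_nhds (hWV hz))).mdifferentiableAt (by simp)
    have h1 : mvfderiv I (fun y => weightQuot (c.inner y (X u₀ y) (X u₀ y)) (l y)) z v
        = mvfderiv I s z v :=
      congrArg (fun L : TangentSpace I z →L[ℝ] ℝ => L v) (he1.mfderiv_eq (I := I))
    rw [weightDeriv_eq D hW (hX.mono (hWV.trans hVs)) (fun y hy => hY₀ y (hVs (hWV hy))) he l hz
      (hsdiff.congr_of_eventuallyEq he1) v, h1, hsd z (hWV hz), hl z (hWV hz)]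
    ring

end AdaptedPair

/-! ### Pull-back by a conformal submersion, in a gauge -/

section Submersion

variable {E : Type*} [NormedAddCommGroup E] [NormedSpace ℝ E]
  {H : Type*} [TopologicalSpace H] {I : ModelWithCorners ℝ E H}
  {M : Type*} [TopologicalSpace M] [ChartedSpace H M] [FiniteDimensional ℝ E] [IsManifold I ∞ M]
  {E' : Type*} [NormedAddCommGroup E'] [NormedSpace ℝ E'] [FiniteDimensional ℝ E']
  {H' : Type*} [TopologicalSpace H'] {I' : ModelWithCorners ℝ E' H'}
  {N : Type*} [TopologicalSpace N] [ChartedSpace H' N] [IsManifold I' ∞ N]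
  {c : ConformalStructure I M} {c' : ConformalStructure I' N} {p : M → N}

theorem IsWeightPullbackAt.weightQuot_eq {r : ℝ} {x : M} {l : WeightAt I r x}
    {l' : WeightAt I' r (p x)} (h : IsWeightPullbackAt c c' p x l l') {X : TangentSpace I x}
    (hX : IsHorizontal I' c p x X) (hdX : mfderiv I I' p x X ≠ 0) :
    weightQuot (c.inner x X X) l
      = weightQuot (c'.inner (p x) (mfderiv I I' p x X) (mfderiv I I' p x X)) l' := by
  have hX0 : X ≠ 0 := fun h0 => hdX (by rw [h0, map_zero])
  have b : Basis (Fin (finrank ℝ E)) ℝ (TangentSpace I x) := (finBasis ℝ E : Basis _ ℝ E)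
  have b' : Basis (Fin (finrank ℝ E')) ℝ (TangentSpace I' (p x)) :=
    (finBasis ℝ E' : Basis _ ℝ E')
  have h1 := c.pos x X hX0 b
  have h2 := c'.pos (p x) _ hdX b'
  rw [_root_.weightQuot_eq h1, _root_.weightQuot_eq h2, div_eq_div_iff
    (Real.rpow_pos_of_pos h1 _).ne' (Real.rpow_pos_of_pos h2 _).ne']
  exact h X hX0 hX b b'

theorem IsFormPullbackAt.gaugeForm_eq {k : ℕ} {r : ℝ} {x : M}
    {α : TangentSpace I x [⋀^Fin k]→ₗ[ℝ] WeightAt I r x}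
    {β : TangentSpace I' (p x) [⋀^Fin k]→ₗ[ℝ] WeightAt I' r (p x)}
    (h : IsFormPullbackAt c c' p x α β) {X : TangentSpace I x}
    (hX : IsHorizontal I' c p x X) (hdX : mfderiv I I' p x X ≠ 0) (Y : Fin k → TangentSpace I x) :
    gaugeForm c X α Y
      = gaugeForm c' (mfderiv I I' p x X) β (fun i => mfderiv I I' p x (Y i)) :=
  (h Y).weightQuot_eq hX hdX

theorem IsFormPullbackAt.apply_eq_zero {k : ℕ} {r : ℝ} {x : M}
    {α : TangentSpace I x [⋀^Fin k]→ₗ[ℝ] WeightAt I r x}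
    {β : TangentSpace I' (p x) [⋀^Fin k]→ₗ[ℝ] WeightAt I' r (p x)}
    (h : IsFormPullbackAt c c' p x α β) {X : TangentSpace I x}
    (hX : IsHorizontal I' c p x X) (hdX : mfderiv I I' p x X ≠ 0) {Y : Fin k → TangentSpace I x}
    {i : Fin k} (hi : mfderiv I I' p x (Y i) = 0) : α Y = 0 := by
  rw [← gaugeForm_eq_zero_iff (c := c) (y₀ := X) (fun h0 => hdX (by rw [h0, map_zero])),
    h.gaugeForm_eq hX hdX]
  exact AlternatingMap.map_coord_zero _ i hi

theorem gaugeMetric_self {x : M} {X : TangentSpace I x} (hX : X ≠ 0) : gaugeMetric c X X X = 1 := by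
  have b : Basis (Fin (finrank ℝ E)) ℝ (TangentSpace I x) := (finBasis ℝ E : Basis _ ℝ E)
  have h1 := c.pos x X hX b
  rw [gaugeMetric_apply, weightQuot_eq h1, show (2 : ℝ) / 2 = 1 by norm_num, Real.rpow_one,
    div_self h1.ne']

/-- A conformal submersion is an isometry on horizontal vectors, if the metrics in the conformal classes
are normalized by corresponding vectors. -/
theorem IsConformalSubmersion.gaugeMetric_mfderiv (hs : IsConformalSubmersion c c' p) {x : M}
    {X₀ X Y : TangentSpace I x} (h₀ : IsHorizontal I' c p x X₀) (hd₀ : mfderiv I I' p x X₀ ≠ 0)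
    (hX : IsHorizontal I' c p x X) (hY : IsHorizontal I' c p x Y) :
    gaugeMetric c' (mfderiv I I' p x X₀) (mfderiv I I' p x X) (mfderiv I I' p x Y)
      = gaugeMetric c X₀ X Y := by
  obtain ⟨P, hP⟩ := hs.conformal x
  have hX0 : X₀ ≠ 0 := fun h0 => hd₀ (by rw [h0, map_zero])
  have b : Basis (Fin (finrank ℝ E)) ℝ (TangentSpace I x) := (finBasis ℝ E : Basis _ ℝ E)
  have h1 : c.inner x X Y = gaugeMetric c X₀ X Y • c.inner x X₀ X₀ := by
    refine Weight.ext_of_apply b ((apply_eq_weightQuot_mul (c.pos x X₀ hX0 b) _).trans ?_)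
    rw [show (2 : ℝ) / 2 = 1 by norm_num, Real.rpow_one]
    rfl
  rw [gaugeMetric_apply, hP X Y hX hY, h1, map_smul, ← hP X₀ X₀ h₀ h₀, map_smul,
    ← gaugeMetric_apply, gaugeMetric_self hd₀, smul_eq_mul, mul_one]

end Submersion

section AdaptedPair

variable {E : Type*} [NormedAddCommGroup E] [NormedSpace ℝ E]
  {H : Type*} [TopologicalSpace H] {I : ModelWithCorners ℝ E H}
  {M : Type*} [TopologicalSpace M] [ChartedSpace H M] [FiniteDimensional ℝ E] [IsManifold I ∞ M]
  {E' : Type*} [NormedAddCommGroup E'] [NormedSpace ℝ E']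
  {H' : Type*} [TopologicalSpace H'] {I' : ModelWithCorners ℝ E' H'}
  {N : Type*} [TopologicalSpace N] [ChartedSpace H' N] [IsManifold I' ∞ N]
  {E'' : Type*} [NormedAddCommGroup E''] [NormedSpace ℝ E'']
  {H'' : Type*} [TopologicalSpace H''] {I'' : ModelWithCorners ℝ E'' H''}
  {N' : Type*} [TopologicalSpace N'] [ChartedSpace H'' N'] [IsManifold I'' ∞ N']
  {c : ConformalStructure I M} {c' : ConformalStructure I' N} {D : WeylStructure c}
  {p : M → N} {p' : M → N'} {π : E →L[ℝ] E'}
  {π' : E →L[ℝ] E''} {ι : E' →L[ℝ] E} {ι' : E'' →L[ℝ] E}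

omit [IsManifold I' ∞ N] in
theorem IsAdaptedPair.isHorizontal (h : IsAdaptedPair I' I'' D p p' π π' ι ι')
    {z₀ z : M} (hz : z ∈ (chartAt H z₀).source) (u : E') :
    IsHorizontal I' c p z (coordField I z₀ (ι u) z) := fun V hV =>
  h.orthogonal z _ V (by rw [h.snd.mfderiv_eq_zero_iff hz, coordVec_coordField hz, h.snd_inl]) hV

omit [IsManifold I'' ∞ N'] in
theorem IsAdaptedPair.mfderiv_inl (h : IsAdaptedPair I' I'' D p p' π π' ι ι')
    {z₀ z : M} (hz : z ∈ (chartAt H z₀).source) (u : E') :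
    mfderiv I I' p z (coordField I z₀ (ι u) z) = coordField I' (p z₀) u (p z) := by
  rw [h.fst.mfderiv_coordField hz, h.fst_inl]

omit [IsManifold I'' ∞ N'] in
theorem IsAdaptedPair.mfderiv_inl_ne_zero (h : IsAdaptedPair I' I'' D p p' π π' ι ι')
    {z₀ z : M} (hz : z ∈ (chartAt H z₀).source) {u : E'} (hu : u ≠ 0) :
    mfderiv I I' p z (coordField I z₀ (ι u) z) ≠ 0 := by
  rw [h.mfderiv_inl hz]
  exact coordField_ne_zero (h.fst.mem_source z₀ z hz) hu

/-- A section of the pull-back bundle vanishes on vertical vectors. -/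
theorem IsAdaptedPair.form_eq_zero [Nontrivial E'] (h : IsAdaptedPair I' I'' D p p' π π' ι ι')
    {k : ℕ} {r : ℝ} {φ : WeightedForm I M k r} (hφ : IsSectionOfPullback c c' p φ) (z : M)
    (Y : Fin k → TangentSpace I z) (i : Fin k) (hi : mfderiv I I' p z (Y i) = 0) : φ z Y = 0 := by
  have := h.finiteDimensional
  obtain ⟨u, hu⟩ := exists_ne (0 : E')
  obtain ⟨β, hβ⟩ := hφ.2 z
  have hz := mem_chart_source H z
  exact hβ.apply_eq_zero (h.isHorizontal hz u) (h.mfderiv_inl_ne_zero hz hu) hi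

variable [FiniteDimensional ℝ E']

variable (c) in
/-- The matrix of scalar products of the vectors `Y i` with the coordinate vectors of the first factor,
in the metric in the conformal class for which the coordinate vector of `u₀` is a unit vector. -/
def gramMatrix (z₀ : M) (ι : E' →L[ℝ] E) (u₀ : E') {x : M}
    (Y : Fin (finrank ℝ E') → TangentSpace I x) : Matrix (Fin (finrank ℝ E')) (Fin (finrank ℝ E')) ℝ :=
  Matrix.of fun j i => gaugeMetric c (coordField I z₀ (ι u₀) x) (Y i)
    (coordField I z₀ (ι (finBasis ℝ E' j)) x)

variable (I) in
/-- The coordinate vectors of the first factor. -/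
def factorFrame (z₀ : M) (ι : E' →L[ℝ] E) (x : M) : Fin (finrank ℝ E') → TangentSpace I x :=
  fun i => coordField I z₀ (ι (finBasis ℝ E' i)) x

omit [IsManifold I'' ∞ N'] in
theorem IsAdaptedPair.mfderiv_factorFrame (h : IsAdaptedPair I' I'' D p p' π π' ι ι')
    {z₀ z : M} (hz : z ∈ (chartAt H z₀).source) (i : Fin (finrank ℝ E')) :
    mfderiv I I' p z (factorFrame I z₀ ι z i) = coordFrame I' (p z₀) (p z) i := by
  rw [coordFrame_apply (h.fst.mem_source z₀ z hz)]
  exact h.mfderiv_inl hz _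

/-- The value of `κ' = c'(dp X₀, dp X₀)` on a frame is determined by the Gram determinant, because `c'`
has determinant one. -/
theorem IsAdaptedPair.det_gramMatrix_mul (h : IsAdaptedPair I' I'' D p p' π π' ι ι')
    (hs : IsConformalSubmersion c c' p) {z₀ z : M} (hz : z ∈ (chartAt H z₀).source) {u₀ : E'}
    (hu₀ : u₀ ≠ 0) : (gramMatrix c z₀ ι u₀ (factorFrame I z₀ ι z)).det *
      ((c'.inner (p z) (mfderiv I I' p z (coordField I z₀ (ι u₀) z))
        (mfderiv I I' p z (coordField I z₀ (ι u₀) z))).1 (coordFrame I' (p z₀) (p z)))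
        ^ finrank ℝ E' = 1 := by
  set κ' := c'.inner (p z) (mfderiv I I' p z (coordField I z₀ (ι u₀) z))
        (mfderiv I I' p z (coordField I z₀ (ι u₀) z)) with hκ'
  set b' := coordFrame I' (p z₀) (p z)
  have hpos : 0 < κ'.1 b' := c'.pos _ _ (h.mfderiv_inl_ne_zero hz hu₀) _
  have h1 : (Matrix.of fun i j => (c'.inner (p z) (b' i) (b' j)).1 b')
      = (κ'.1 b') • gramMatrix c z₀ ι u₀ (factorFrame I z₀ ι z) := by
    ext i j
    have h3 := hs.gaugeMetric_mfderiv (h.isHorizontal hz u₀)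
      (h.mfderiv_inl_ne_zero hz hu₀) (X := factorFrame I z₀ ι z j) (Y := factorFrame I z₀ ι z i)
      (h.isHorizontal hz _) (h.isHorizontal hz _)
    rw [h.mfderiv_factorFrame hz, h.mfderiv_factorFrame hz] at h3
    rw [Matrix.of_apply, Matrix.smul_apply, smul_eq_mul, c'.symm,
      apply_eq_weightQuot_mul hpos (c'.inner (p z) (b' j) (b' i)),
      show (2 : ℝ) / 2 = 1 by norm_num, Real.rpow_one, mul_comm]
    exact congrArg (fun t => κ'.1 b' * t) h3
  have h2 := c'.normalized (p z) b'
  rw [h1, Matrix.det_smul, Fintype.card_fin, mul_comm] at h2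
  exact h2

/-- The square of the coefficient of a form of top degree, computed on the first factor and in a
gauge. -/
theorem IsAdaptedPair.sq_apply_mul_det (h : IsAdaptedPair I' I'' D p p' π π' ι ι')
    (hs : IsConformalSubmersion c c' p) {z₀ z : M} (hz : z ∈ (chartAt H z₀).source) {u₀ : E'}
    (hu₀ : u₀ ≠ 0)
    {α : TangentSpace I z [⋀^Fin (finrank ℝ E')]→ₗ[ℝ] WeightAt I (finrank ℝ E' : ℕ) z}
    {β : TangentSpace I' (p z) [⋀^Fin (finrank ℝ E')]→ₗ[ℝ] WeightAt I' (finrank ℝ E' : ℕ) (p z)}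
    (hβ : IsFormPullbackAt c c' p z α β) :
    ((β (coordFrame I' (p z₀) (p z))).1 (coordFrame I' (p z₀) (p z))) ^ 2
        * (gramMatrix c z₀ ι u₀ (factorFrame I z₀ ι z)).det
      = (gaugeForm c (coordField I z₀ (ι u₀) z) α (factorFrame I z₀ ι z)) ^ 2 := by
  have h1 := h.det_gramMatrix_mul hs hz hu₀
  have hpos := c'.pos _ _ (h.mfderiv_inl_ne_zero hz hu₀) (coordFrame I' (p z₀) (p z))
  have h2 := hβ.gaugeForm_eq (h.isHorizontal hz u₀) (h.mfderiv_inl_ne_zero hz hu₀)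
    (factorFrame I z₀ ι z)
  simp only [h.mfderiv_factorFrame hz] at h2
  rw [h2, apply_eq_weightQuot_mul hpos, gaugeForm_apply, mul_pow, ← Real.rpow_natCast (_ ^ (_ / _)),
    ← Real.rpow_mul hpos.le, Nat.cast_ofNat, div_mul_cancel₀ _ two_ne_zero, Real.rpow_natCast,
    mul_assoc, mul_comm (_ ^ _) (Matrix.det _), h1, mul_one]

/-- The sign of the coefficient of a pulled back form can be read off in a gauge. -/
theorem IsAdaptedPair.apply_coordFrame_eq (h : IsAdaptedPair I' I'' D p p' π π' ι ι')
    {z₀ z : M} (hz : z ∈ (chartAt H z₀).source) {u₀ : E'}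
    (hu₀ : u₀ ≠ 0) {r : ℝ}
    {α : TangentSpace I z [⋀^Fin (finrank ℝ E')]→ₗ[ℝ] WeightAt I r z}
    {β : TangentSpace I' (p z) [⋀^Fin (finrank ℝ E')]→ₗ[ℝ] WeightAt I' r (p z)}
    (hβ : IsFormPullbackAt c c' p z α β) : ∃ s : ℝ, 0 < s ∧
    ((β (coordFrame I' (p z₀) (p z))).1 (coordFrame I' (p z₀) (p z)))
      = gaugeForm c (coordField I z₀ (ι u₀) z) α (factorFrame I z₀ ι z) * s := by
  have hpos := c'.pos _ _ (h.mfderiv_inl_ne_zero hz hu₀) (coordFrame I' (p z₀) (p z))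
  have h2 := hβ.gaugeForm_eq (h.isHorizontal hz u₀) (h.mfderiv_inl_ne_zero hz hu₀)
    (factorFrame I z₀ ι z)
  simp only [h.mfderiv_factorFrame hz] at h2
  refine ⟨_, Real.rpow_pos_of_pos hpos (r / 2), ?_⟩
  rw [h2, apply_eq_weightQuot_mul hpos, gaugeForm_apply]

end AdaptedPair

/-! ### Forms of top degree on a factor -/

theorem AlternatingMap.sum_update_basis {n : ℕ} {K : Type*} [AddCommGroup K] [Module ℝ K]
    (b : Basis (Fin n) ℝ K) (Ψ : K [⋀^Fin n]→ₗ[ℝ] ℝ) (w : Fin n → K) :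
    ∑ i, Ψ (Function.update b i (w i)) = (∑ i, b.repr (w i) i) * Ψ b := by
  rw [Finset.sum_mul]
  refine Finset.sum_congr rfl fun i _ => ?_
  conv_lhs => rw [← b.sum_repr (w i)]
  rw [AlternatingMap.map_update_sum, Finset.sum_eq_single i]
  · rw [AlternatingMap.map_update_smul, Function.update_eq_self, smul_eq_mul]
  · intro l _ hl
    rw [AlternatingMap.map_update_smul, Ψ.map_eq_zero_of_eq _ (i := i) (j := l) _ hl.symm, smul_zero]
    rw [Function.update_self, Function.update_of_ne hl]
  · exact fun hi => absurd (Finset.mem_univ i) hi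

section AdaptedPair

variable {E : Type*} [NormedAddCommGroup E] [NormedSpace ℝ E]
  {H : Type*} [TopologicalSpace H] {I : ModelWithCorners ℝ E H}
  {M : Type*} [TopologicalSpace M] [ChartedSpace H M] [FiniteDimensional ℝ E] [IsManifold I ∞ M]
  {E' : Type*} [NormedAddCommGroup E'] [NormedSpace ℝ E'] [FiniteDimensional ℝ E']
  {H' : Type*} [TopologicalSpace H'] {I' : ModelWithCorners ℝ E' H'}
  {N : Type*} [TopologicalSpace N] [ChartedSpace H' N] [IsManifold I' ∞ N]
  {E'' : Type*} [NormedAddCommGroup E''] [NormedSpace ℝ E'']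
  {H'' : Type*} [TopologicalSpace H''] {I'' : ModelWithCorners ℝ E'' H''}
  {N' : Type*} [TopologicalSpace N'] [ChartedSpace H'' N'] [IsManifold I'' ∞ N']
  {c : ConformalStructure I M} {D : WeylStructure c}
  {p : M → N} {p' : M → N'} {π : E →L[ℝ] E'}
  {π' : E →L[ℝ] E''} {ι : E' →L[ℝ] E} {ι' : E'' →L[ℝ] E}

theorem IsAdaptedPair.det_gramMatrix_eq (h : IsAdaptedPair I' I'' D p p' π π' ι ι')
    {z₀ z : M} (hz : z ∈ (chartAt H z₀).source) (u₀ : E')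
    (Y : Fin (finrank ℝ E') → TangentSpace I z) :
    (gramMatrix c z₀ ι u₀ Y).det = (finBasis ℝ E').det (fun i => π (coordVec I z₀ z (Y i))) *
      (gramMatrix c z₀ ι u₀ (factorFrame I z₀ ι z)).det := by
  set b := finBasis ℝ E'
  let g : E' →ₗ[ℝ] E' →ₗ[ℝ] ℝ :=
    (gaugeMetric c (coordField I z₀ (ι u₀) z)).compl₁₂ (coordInl hz ι) (coordInl hz ι)
  have h1 := AlternatingMap.mul_gram_det b b.det g (fun i => π (coordVec I z₀ z (Y i)))
  rw [b.det_self, one_mul] at h1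
  refine Eq.trans ?_ h1.symm
  congr 1
  ext j i
  have h2 := congrArg (fun y => gaugeMetric c (coordField I z₀ (ι u₀) z) y
    (coordField I z₀ (ι (b j)) z)) (h.coordField_add_coordField hz (Y i))
  simp only [map_add, LinearMap.add_apply] at h2
  rw [gaugeMetric_eq_zero (X := coordField I z₀ (ι' (π' (coordVec I z₀ z (Y i)))) z), add_zero] at h2
  · exact h2.symm
  · rw [c.symm]
    exact h.isHorizontal hz _ _ (by
      rw [h.fst.mfderiv_eq_zero_iff hz, coordVec_coordField hz, h.fst_inr])

omit [IsManifold I'' ∞ N'] in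
theorem IsAdaptedPair.gaugeForm_eq (h : IsAdaptedPair I' I'' D p p' π π' ι ι')
    {z₀ z : M} (hz : z ∈ (chartAt H z₀).source) (u₀ : E') {r : ℝ}
    {α : TangentSpace I z [⋀^Fin (finrank ℝ E')]→ₗ[ℝ] WeightAt I r z}
    (hα : ∀ Y i, mfderiv I I' p z (Y i) = 0 → α Y = 0)
    (Y : Fin (finrank ℝ E') → TangentSpace I z) :
    gaugeForm c (coordField I z₀ (ι u₀) z) α Y =
      (finBasis ℝ E').det (fun i => π (coordVec I z₀ z (Y i))) *
        gaugeForm c (coordField I z₀ (ι u₀) z) α (factorFrame I z₀ ι z) := by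
  let Φ : E' [⋀^Fin (finrank ℝ E')]→ₗ[ℝ] ℝ :=
    (gaugeForm c (coordField I z₀ (ι u₀) z) α).compLinearMap (coordInl hz ι)
  rw [gaugeForm_apply, h.form_apply_eq hz hα]
  have h2 := congrArg (fun L : E' [⋀^Fin (finrank ℝ E')]→ₗ[ℝ] ℝ =>
    L fun i => π (coordVec I z₀ z (Y i))) (Φ.eq_smul_basis_det (finBasis ℝ E'))
  rw [mul_comm]
  exact h2

/-- The trace of the connection matrix of the first factor in its coordinate frame. -/
def factorTrace (D : WeylStructure c) (z₀ : M) (π : E →L[ℝ] E') (ι : E' →L[ℝ] E) (x : M)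
    (v : TangentSpace I x) : ℝ :=
  ∑ j, (finBasis ℝ E').repr
    (π (coordVec I z₀ x (D.cov (coordField I z₀ (ι (finBasis ℝ E' j))) x v))) j

omit [IsManifold I' ∞ N] [IsManifold I'' ∞ N'] in
theorem IsAdaptedPair.sum_det_update (h : IsAdaptedPair I' I'' D p p' π π' ι ι')
    {z₀ x : M} (hx : x ∈ (chartAt H z₀).source) (v : TangentSpace I x) :
    ∑ i, (finBasis ℝ E').det (fun l => π (coordVec I z₀ x (Function.update
      (fun j => coordField I z₀ (ι (finBasis ℝ E' j)) x) i
        (D.cov (coordField I z₀ (ι (finBasis ℝ E' i))) x v) l))) = factorTrace D z₀ π ι x v := by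
  have h2 : ∀ i, (fun l => π (coordVec I z₀ x (Function.update
      (fun j => coordField I z₀ (ι (finBasis ℝ E' j)) x) i
        (D.cov (coordField I z₀ (ι (finBasis ℝ E' i))) x v) l)))
      = Function.update (finBasis ℝ E') i
        (π (coordVec I z₀ x (D.cov (coordField I z₀ (ι (finBasis ℝ E' i))) x v))) := by
    intro i
    funext l
    by_cases hl : l = i
    · subst hl; simp
    · simp [Function.update_of_ne hl, coordVec_coordField hx, h.fst_inl]
  simp only [h2]
  rw [AlternatingMap.sum_update_basis, Basis.det_self, mul_one]
  rfl

theorem contMDiffOn_det_gramMatrix {z₀ : M} {W : Set M} (hW : IsOpen W)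
    (hWs : W ⊆ (chartAt H z₀).source) {u₀ : E'} (hu₀ : ι u₀ ≠ 0)
    {Y : Fin (finrank ℝ E') → ∀ x : M, TangentSpace I x} (hY : ∀ i, SmoothFieldOn I (Y i) W) :
    ContMDiffOn I 𝓘(ℝ, ℝ) ∞ (fun x => (gramMatrix c z₀ ι u₀ (fun i => Y i x)).det) W := by
  have : CompleteSpace E := FiniteDimensional.complete ℝ E
  have hX : ∀ u, SmoothFieldOn I (coordField I z₀ u) W := fun u => (coordField_smooth z₀ u).mono hWs
  simp only [Matrix.det_apply', gramMatrix, Matrix.of_apply]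
  exact contMDiffOn_finsetSum fun σ _ => ContMDiffOn.mul contMDiffOn_const
    (contMDiffOn_finsetProd fun i _ => gaugeMetric_smooth hW (hX _)
      (fun y hy => coordField_ne_zero (hWs hy) hu₀) (hY _) (hX _))

variable [I.Boundaryless]

omit [IsManifold I' ∞ N] in
/-- The derivative of the Gram determinant: by `D g = - 2 q g` and Jacobi's formula, differentiating the
vectors `Y i` gives the sum, and differentiating the coordinate frame gives the trace. -/
theorem IsAdaptedPair.mvfderiv_det_gramMatrix (h : IsAdaptedPair I' I'' D p p' π π' ι ι')
    {z₀ : M} {W : Set M} (hW : IsOpen W) (hWs : W ⊆ (chartAt H z₀).source) {u₀ : E'} (hu₀ : u₀ ≠ 0)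
    {Y : Fin (finrank ℝ E') → ∀ x : M, TangentSpace I x} (hY : ∀ i, SmoothFieldOn I (Y i) W)
    {x : M} (hx : x ∈ W) (v : TangentSpace I x) :
    mvfderiv I (fun x => (gramMatrix c z₀ ι u₀ (fun i => Y i x)).det) x v =
      ∑ i, (gramMatrix c z₀ ι u₀ (Function.update (fun j => Y j x) i (D.cov (Y i) x v))).det
        + (factorTrace D z₀ π ι x v
          - 2 * (finrank ℝ E' : ℕ) * D.leeForm (coordField I z₀ (ι u₀)) x v)
            * (gramMatrix c z₀ ι u₀ (fun i => Y i x)).det := by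
  have : CompleteSpace E := FiniteDimensional.complete ℝ E
  set b := finBasis ℝ E' with hb
  have hX : ∀ u, SmoothFieldOn I (coordField I z₀ u) W := fun u => (coordField_smooth z₀ u).mono hWs
  have h₀ : ∀ y ∈ W, coordField I z₀ (ι u₀) y ≠ 0 := fun y hy =>
    coordField_ne_zero (hWs hy) (h.inl_ne_zero hu₀)
  have hdd := fun i j => mvfderiv_gaugeMetric D hW (hX (ι u₀)) h₀ (hY i) (hX (ι (b j))) hx v
  have hAd := fun i j => ((gaugeMetric_smooth (c := c) hW (hX (ι u₀)) h₀ (hY i)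
    (hX (ι (b j)))).contMDiffAt (hW.mem_nhds hx)).mdifferentiableAt (by simp)
  have hDd := ((contMDiffOn_det_gramMatrix (c := c) hW hWs (h.inl_ne_zero hu₀) hY).contMDiffAt
    (hW.mem_nhds hx)).mdifferentiableAt (by simp)
  set m : Matrix (Fin (finrank ℝ E')) (Fin (finrank ℝ E')) ℝ := Matrix.of fun l j =>
    b.repr (π (coordVec I z₀ x (D.cov (coordField I z₀ (ι (b j))) x v))) l with hm
  set A := gramMatrix c z₀ ι u₀ (fun i => Y i x) with hA
  set B : Matrix (Fin (finrank ℝ E')) (Fin (finrank ℝ E')) ℝ := Matrix.of fun j i =>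
    gaugeMetric c (coordField I z₀ (ι u₀) x) (D.cov (Y i) x v) (coordField I z₀ (ι (b j)) x) with hB
  set q := D.leeForm (coordField I z₀ (ι u₀)) x v with hq
  have hA' : ∀ j i, mvfderiv I (fun y => gaugeMetric c (coordField I z₀ (ι u₀) y) (Y i y)
      (coordField I z₀ (ι (b j)) y)) x v = (B + m.transpose * A - (2 * q) • A) j i := by
    intro j i
    rw [hdd i j]
    have h1 : D.cov (coordField I z₀ (ι (b j))) x v
        = ∑ l, m l j • coordField I z₀ (ι (b l)) x := by
      rw [h.cov_inl (hWs hx)]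
      set w := π (coordVec I z₀ x (D.cov (coordField I z₀ (ι (b j))) x v)) with hw
      have h2 := congrArg (coordInl (I := I) (hWs hx) ι) (b.sum_repr w)
      rw [map_sum] at h2
      simp only [map_smul] at h2
      exact h2.symm
    rw [h1, map_sum]
    simp only [map_smul, smul_eq_mul, Matrix.sub_apply, Matrix.add_apply, Matrix.mul_apply,
      Matrix.transpose_apply, Matrix.smul_apply]
    rfl
  have hcol : ∀ i, gramMatrix c z₀ ι u₀ (Function.update (fun j => Y j x) i (D.cov (Y i) x v))
      = A.updateCol i fun j => B j i := by
    intro i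
    ext j l
    by_cases hl : l = i
    · subst hl
      simp [gramMatrix, hB]
      rfl
    · simp [gramMatrix, Matrix.updateCol_ne hl, Function.update_of_ne hl, hA]
  have htr : (A.adjugate * (B + m.transpose * A - (2 * q) • A)).trace =
      ∑ i, (A.updateCol i fun j => B j i).det
        + (m.trace - 2 * (finrank ℝ E' : ℕ) * q) * A.det := by
    rw [mul_sub, mul_add, Matrix.trace_sub, Matrix.trace_add, Matrix.trace_adjugate_mul,
      ← mul_assoc, Matrix.trace_mul_comm _ A, ← mul_assoc, Matrix.mul_adjugate, Matrix.mul_smul,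
      Matrix.adjugate_mul]
    simp only [Matrix.smul_mul, one_mul, Matrix.trace_smul, Matrix.trace_transpose, smul_eq_mul,
      Matrix.trace_one, Fintype.card_fin]
    ring
  obtain ⟨γ, hγ0, -, hd⟩ := exists_curve x v
  have h1 := hasDerivAt_det (A := fun t => gramMatrix c z₀ ι u₀ (fun i => Y i (γ t))) (t := 0)
    (A' := B + m.transpose * A - (2 * q) • A) fun j i => by
      have := hd _ (hAd i j)
      rw [hA'] at this
      exact this
  rw [(hd _ hDd).unique h1, hγ0]
  refine htr.trans ?_
  simp only [hcol]
  rfl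

theorem IsAdaptedPair.mvfderiv_det_gramMatrix_factorFrame
    (h : IsAdaptedPair I' I'' D p p' π π' ι ι')
    {z₀ x : M} (hx : x ∈ (chartAt H z₀).source) {u₀ : E'} (hu₀ : u₀ ≠ 0) (v : TangentSpace I x) :
    mvfderiv I (fun x => (gramMatrix c z₀ ι u₀ (factorFrame I z₀ ι x)).det) x v =
      2 * (factorTrace D z₀ π ι x v
          - (finrank ℝ E' : ℕ) * D.leeForm (coordField I z₀ (ι u₀)) x v)
            * (gramMatrix c z₀ ι u₀ (factorFrame I z₀ ι x)).det := by
  have : CompleteSpace E := FiniteDimensional.complete ℝ E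
  have h1 := h.mvfderiv_det_gramMatrix (chartAt H z₀).open_source subset_rfl hu₀
    (Y := fun i => coordField I z₀ (ι (finBasis ℝ E' i))) (fun i => coordField_smooth z₀ _) hx v
  refine h1.trans ?_
  simp only [h.det_gramMatrix_eq hx u₀ (Function.update _ _ _)]
  rw [← Finset.sum_mul, h.sum_det_update hx]
  change factorTrace D z₀ π ι x v * (gramMatrix c z₀ ι u₀ (factorFrame I z₀ ι x)).det +
    (factorTrace D z₀ π ι x v
          - 2 * (finrank ℝ E' : ℕ) * D.leeForm (coordField I z₀ (ι u₀)) x v)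
            * (gramMatrix c z₀ ι u₀ (factorFrame I z₀ ι x)).det = _
  ring

end AdaptedPair

theorem eventually_eq_of_mvfderiv_eq_zero {E : Type*} [NormedAddCommGroup E] [NormedSpace ℝ E]
    {H : Type*} [TopologicalSpace H] {I : ModelWithCorners ℝ E H} [I.Boundaryless]
    {M : Type*} [TopologicalSpace M] [ChartedSpace H M] [IsManifold I ∞ M] {F : M → ℝ} {z₀ : M}
    (hF : ∀ z ∈ (chartAt H z₀).source, MDifferentiableAt I 𝓘(ℝ, ℝ) F z)
    (h : ∀ z ∈ (chartAt H z₀).source, ∀ v, mvfderiv I F z v = 0) : ∀ᶠ z in 𝓝 z₀, F z = F z₀ := by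
  set f := extChartAt I z₀ with hf
  obtain ⟨ε, hε, hball⟩ := Metric.mem_nhds_iff.1 (extChartAt_target_mem_nhds (I := I) z₀)
  have hsymm : ∀ x ∈ Metric.ball (f z₀) ε, f.symm x ∈ (chartAt H z₀).source := fun x hx => by
    rw [← extChartAt_source I]
    exact f.map_target (hball hx)
  have hpre : f ⁻¹' Metric.ball (f z₀) ε ∈ 𝓝 z₀ :=
    (continuousAt_extChartAt z₀).preimage_mem_nhds (Metric.ball_mem_nhds _ hε)
  filter_upwards [hpre, extChartAt_source_mem_nhds (I := I) z₀] with z hz hzs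
  have h1 := (convex_ball (f z₀) ε).eq_of_fderiv_apply_eq_zero (F := F ∘ f.symm) (p := f z₀)
    (q := f z) (fun x hx => ?_) (Metric.mem_ball_self hε) hz (fun x hx => ?_)
  · simp only [Function.comp_apply, f.left_inv hzs, f.left_inv (mem_extChartAt_source z₀)] at h1
    exact h1
  · have h2 := differentiableAt_comp_extChartAt_symm (hsymm x hx) (hF _ (hsymm x hx))
    rwa [← hf, f.right_inv (hball hx)] at h2
  · have h2 := mvfderiv_eq_fderiv (hsymm x hx) (hF _ (hsymm x hx))
      (coordField I z₀ (f z - f z₀) (f.symm x))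
    rw [h _ (hsymm x hx), coordVec_coordField (hsymm x hx), ← hf, f.right_inv (hball hx)] at h2
    exact h2.symm

section AdaptedPair

variable {E : Type*} [NormedAddCommGroup E] [NormedSpace ℝ E]
  {H : Type*} [TopologicalSpace H] {I : ModelWithCorners ℝ E H}
  {M : Type*} [TopologicalSpace M] [ChartedSpace H M] [FiniteDimensional ℝ E] [IsManifold I ∞ M]
  {E' : Type*} [NormedAddCommGroup E'] [NormedSpace ℝ E'] [FiniteDimensional ℝ E']
  {H' : Type*} [TopologicalSpace H'] {I' : ModelWithCorners ℝ E' H'}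
  {N : Type*} [TopologicalSpace N] [ChartedSpace H' N] [IsManifold I' ∞ N]
  {E'' : Type*} [NormedAddCommGroup E''] [NormedSpace ℝ E'']
  {H'' : Type*} [TopologicalSpace H''] {I'' : ModelWithCorners ℝ E'' H''}
  {N' : Type*} [TopologicalSpace N'] [ChartedSpace H'' N'] [IsManifold I'' ∞ N']
  {c : ConformalStructure I M} {D : WeylStructure c}
  {p : M → N} {p' : M → N'} {π : E →L[ℝ] E'}
  {π' : E →L[ℝ] E''} {ι : E' →L[ℝ] E} {ι' : E'' →L[ℝ] E} [I.Boundaryless]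

omit [IsManifold I'' ∞ N'] in
theorem IsAdaptedPair.mvfderiv_gaugeForm_factorFrame
    (h : IsAdaptedPair I' I'' D p p' π π' ι ι') {φ : WeightlessForm I M (finrank ℝ E')}
    (hφ : WeightedForm.Smooth φ) (hp : WeightedForm.Parallel D.cov φ)
    (hker : ∀ z Y i, mfderiv I I' p z (Y i) = 0 → φ z Y = 0)
    {z₀ x : M} (hx : x ∈ (chartAt H z₀).source) {u₀ : E'} (hu₀ : u₀ ≠ 0) (v : TangentSpace I x) :
    mvfderiv I (fun x => gaugeForm c (coordField I z₀ (ι u₀) x) (φ x) (factorFrame I z₀ ι x)) x v =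
      (factorTrace D z₀ π ι x v - (finrank ℝ E' : ℕ) * D.leeForm (coordField I z₀ (ι u₀)) x v)
        * gaugeForm c (coordField I z₀ (ι u₀) x) (φ x) (factorFrame I z₀ ι x) := by
  have : CompleteSpace E := FiniteDimensional.complete ℝ E
  have h1 := mvfderiv_gaugeForm D (chartAt H z₀).open_source (coordField_smooth z₀ (ι u₀))
    (fun y hy => coordField_ne_zero hy (h.inl_ne_zero hu₀)) hφ hp
    (Y := fun i => coordField I z₀ (ι (finBasis ℝ E' i))) (fun i => coordField_smooth z₀ _) hx v
  refine h1.trans ?_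
  simp only [h.gaugeForm_eq hx u₀ (hker x) (Function.update _ _ _)]
  rw [← Finset.sum_mul, h.sum_det_update hx]
  change factorTrace D z₀ π ι x v *
      gaugeForm c (coordField I z₀ (ι u₀) x) (φ x) (factorFrame I z₀ ι x) -
    _ * D.leeForm (coordField I z₀ (ι u₀)) x v *
      gaugeForm c (coordField I z₀ (ι u₀) x) (φ x) (factorFrame I z₀ ι x) = _
  ring

/-- The length of a parallel form of top degree on a factor is locally constant. -/
theorem IsAdaptedPair.eventually_sq_div_eq
    (h : IsAdaptedPair I' I'' D p p' π π' ι ι') {φ : WeightlessForm I M (finrank ℝ E')}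
    (hφ : WeightedForm.Smooth φ) (hp : WeightedForm.Parallel D.cov φ)
    (hker : ∀ z Y i, mfderiv I I' p z (Y i) = 0 → φ z Y = 0) (z₀ : M) {u₀ : E'} (hu₀ : u₀ ≠ 0)
    (hdet : ∀ z ∈ (chartAt H z₀).source,
      (gramMatrix c z₀ ι u₀ (factorFrame I z₀ ι z)).det ≠ 0) :
    ∀ᶠ z in 𝓝 z₀, (gaugeForm c (coordField I z₀ (ι u₀) z) (φ z) (factorFrame I z₀ ι z)) ^ 2
        / (gramMatrix c z₀ ι u₀ (factorFrame I z₀ ι z)).det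
      = (gaugeForm c (coordField I z₀ (ι u₀) z₀) (φ z₀) (factorFrame I z₀ ι z₀)) ^ 2
        / (gramMatrix c z₀ ι u₀ (factorFrame I z₀ ι z₀)).det := by
  have : CompleteSpace E := FiniteDimensional.complete ℝ E
  set U := (chartAt H z₀).source
  have hUo : IsOpen U := (chartAt H z₀).open_source
  set P : M → ℝ := fun z => gaugeForm c (coordField I z₀ (ι u₀) z) (φ z) (factorFrame I z₀ ι z)
  set Δ : M → ℝ := fun z => (gramMatrix c z₀ ι u₀ (factorFrame I z₀ ι z)).det
  have hP : ContMDiffOn I 𝓘(ℝ, ℝ) ∞ P U := gaugeForm_smooth hUo (coordField_smooth z₀ (ι u₀))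
    (fun y hy => coordField_ne_zero hy (h.inl_ne_zero hu₀)) hφ
    (Y := fun i => coordField I z₀ (ι (finBasis ℝ E' i))) (fun i => coordField_smooth z₀ _)
  have hΔ : ContMDiffOn I 𝓘(ℝ, ℝ) ∞ Δ U := contMDiffOn_det_gramMatrix hUo subset_rfl
    (h.inl_ne_zero hu₀)
    (Y := fun i => coordField I z₀ (ι (finBasis ℝ E' i))) (fun i => coordField_smooth z₀ _)
  have hF : ContMDiffOn I 𝓘(ℝ, ℝ) ∞ (fun z => P z ^ 2 / Δ z) U := (hP.pow 2).div₀ hΔ hdet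
  have hdiff : ∀ {F : M → ℝ}, ContMDiffOn I 𝓘(ℝ, ℝ) ∞ F U → ∀ z ∈ U,
      MDifferentiableAt I 𝓘(ℝ, ℝ) F z := fun hF z hz =>
    (hF.contMDiffAt (hUo.mem_nhds hz)).mdifferentiableAt (by simp)
  refine eventually_eq_of_mvfderiv_eq_zero (hdiff hF) fun z hz v => ?_
  have h1 := h.mvfderiv_gaugeForm_factorFrame hφ hp hker hz hu₀ v
  have h2 := h.mvfderiv_det_gramMatrix_factorFrame hz hu₀ v
  obtain ⟨γ, rfl, -, hd⟩ := exists_curve z v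
  have h3 := ((hd _ (hdiff hP _ hz)).pow 2).div (hd _ (hdiff hΔ _ hz)) (hdet _ hz)
  refine ((hd _ (hdiff hF _ hz)).unique h3).trans ?_
  change mvfderiv I P (γ 0) v = _ * P (γ 0) at h1
  change mvfderiv I Δ (γ 0) v = _ * Δ (γ 0) at h2
  rw [h1, h2, Pi.pow_apply]
  refine div_eq_zero_iff.2 (Or.inl ?_)
  push_cast
  ring

/-- A form of top degree on a factor that has constant length is parallel. -/
theorem IsAdaptedPair.parallel_of_sq_eq
    (h : IsAdaptedPair I' I'' D p p' π π' ι ι') {φ : WeightlessForm I M (finrank ℝ E')}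
    (hφ : WeightedForm.Smooth φ) (hker : ∀ z Y i, mfderiv I I' p z (Y i) = 0 → φ z Y = 0)
    {u₀ : E'} (hu₀ : u₀ ≠ 0) {a : ℝ} (ha : a ≠ 0)
    (hdet : ∀ z₀, ∀ z ∈ (chartAt H z₀).source,
      (gramMatrix c z₀ ι u₀ (factorFrame I z₀ ι z)).det ≠ 0)
    (hsq : ∀ z₀, ∀ z ∈ (chartAt H z₀).source,
      (gaugeForm c (coordField I z₀ (ι u₀) z) (φ z) (factorFrame I z₀ ι z)) ^ 2
        = a * (gramMatrix c z₀ ι u₀ (factorFrame I z₀ ι z)).det) :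
    WeightedForm.Parallel D.cov φ := by
  have : CompleteSpace E := FiniteDimensional.complete ℝ E
  refine parallel_of_mvfderiv_gaugeForm D hφ fun z₀ => ?_
  set U := (chartAt H z₀).source
  have hUo : IsOpen U := (chartAt H z₀).open_source
  have h₀ : ∀ y ∈ U, coordField I z₀ (ι u₀) y ≠ 0 :=
    fun y hy => coordField_ne_zero hy (h.inl_ne_zero hu₀)
  refine ⟨U, hUo, mem_chart_source H z₀, coordField I z₀ (ι u₀), coordField_smooth z₀ (ι u₀), h₀,
    fun W hW hxW hWU Y hY v => ?_⟩
  set P : M → ℝ := fun z => gaugeForm c (coordField I z₀ (ι u₀) z) (φ z) (factorFrame I z₀ ι z)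
    with hPdef
  set Δ : M → ℝ := fun z => (gramMatrix c z₀ ι u₀ (factorFrame I z₀ ι z)).det with hΔdef
  set F : M → ℝ := fun z => gaugeForm c (coordField I z₀ (ι u₀) z) (φ z) (fun i => Y i z)
  set G : M → ℝ := fun z => (gramMatrix c z₀ ι u₀ (fun i => Y i z)).det
  -- the identity to be differentiated, for `Z = Y` and for the coordinate frame
  have hmul : ∀ z ∈ U, ∀ Z : Fin (finrank ℝ E') → TangentSpace I z,
      gaugeForm c (coordField I z₀ (ι u₀) z) (φ z) Z * P z
        = a * (gramMatrix c z₀ ι u₀ Z).det := by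
    intro z hz Z
    rw [h.gaugeForm_eq hz u₀ (hker z) Z, h.det_gramMatrix_eq hz u₀ Z]
    have := hsq z₀ z hz
    simp only [hPdef]
    linear_combination (finBasis ℝ E').det (fun i => π (coordVec I z₀ z (Z i))) * this
  have hdiff : ∀ {F : M → ℝ}, ContMDiffOn I 𝓘(ℝ, ℝ) ∞ F W → MDifferentiableAt I 𝓘(ℝ, ℝ) F z₀ :=
    fun hF => (hF.contMDiffAt (hW.mem_nhds hxW)).mdifferentiableAt (by simp)
  have hX : ∀ u, SmoothFieldOn I (coordField I z₀ u) W := fun u => (coordField_smooth z₀ u).mono hWU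
  have hP := hdiff (gaugeForm_smooth (c := c) hW (hX (ι u₀)) (fun y hy => h₀ y (hWU hy)) hφ
    (fun i => hX (ι (finBasis ℝ E' i))))
  have hF := hdiff (gaugeForm_smooth (c := c) hW (hX (ι u₀)) (fun y hy => h₀ y (hWU hy)) hφ hY)
  have hΔ := hdiff (contMDiffOn_det_gramMatrix (c := c) hW hWU (h.inl_ne_zero hu₀)
    (fun i => hX (ι (finBasis ℝ E' i))))
  have hG := hdiff (contMDiffOn_det_gramMatrix (c := c) hW hWU (h.inl_ne_zero hu₀) hY)
  have hP0 : P z₀ ≠ 0 := fun h0 => by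
    have h1 := hsq z₀ z₀ (hWU hxW)
    simp only [hPdef] at h0
    rw [h0, zero_pow two_ne_zero] at h1
    exact mul_ne_zero ha (hdet z₀ z₀ (hWU hxW)) h1.symm
  have hΔ' := h.mvfderiv_det_gramMatrix_factorFrame (hWU hxW) hu₀ v
  have hG' := h.mvfderiv_det_gramMatrix hW hWU hu₀ hY hxW v
  have hFP := hmul z₀ (hWU hxW) (fun i => Y i z₀)
  have hPP := hmul z₀ (hWU hxW) (factorFrame I z₀ ι z₀)
  have hsum : (∑ i, gaugeForm c (coordField I z₀ (ι u₀) z₀) (φ z₀)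
      (Function.update (fun j => Y j z₀) i (D.cov (Y i) z₀ v))) * P z₀ = a *
      ∑ i, (gramMatrix c z₀ ι u₀ (Function.update (fun j => Y j z₀) i (D.cov (Y i) z₀ v))).det := by
    rw [Finset.sum_mul, Finset.mul_sum]
    exact Finset.sum_congr rfl fun i _ => hmul z₀ (hWU hxW) _
  obtain ⟨γ, hγ0, hγ, hd⟩ := exists_curve z₀ v
  have hγU : ∀ᶠ t in 𝓝 (0 : ℝ), γ t ∈ U := hγ.eventually (by
    rw [hγ0]; exact hUo.mem_nhds (hWU hxW))
  have e1 := ((hd _ hF).mul (hd _ hP)).unique (((hd _ hG).const_mul a).congr_of_eventuallyEq (by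
    filter_upwards [hγU] with t ht using hmul _ ht _))
  have e2 := ((hd _ hP).mul (hd _ hP)).unique (((hd _ hΔ).const_mul a).congr_of_eventuallyEq (by
    filter_upwards [hγU] with t ht using hmul _ ht _))
  change mvfderiv I F z₀ v * P (γ 0) + F (γ 0) * mvfderiv I P z₀ v = a * mvfderiv I G z₀ v at e1
  change mvfderiv I P z₀ v * P (γ 0) + P (γ 0) * mvfderiv I P z₀ v = a * mvfderiv I Δ z₀ v at e2
  rw [hγ0] at e1 e2
  change mvfderiv I G z₀ v = _ + _ * G z₀ at hG'
  change mvfderiv I Δ z₀ v = _ * Δ z₀ at hΔ'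
  change F z₀ * P z₀ = a * G z₀ at hFP
  change P z₀ * P z₀ = a * Δ z₀ at hPP
  change mvfderiv I F z₀ v = _ - _ * F z₀
  rw [hG'] at e1
  rw [hΔ'] at e2
  set tr := factorTrace D z₀ π ι z₀ v
  set q := D.leeForm (coordField I z₀ (ι u₀)) z₀ v
  have e3 : mvfderiv I P z₀ v = (tr - (finrank ℝ E' : ℕ) * q) * P z₀ := by
    refine mul_right_cancel₀ hP0 ?_
    linear_combination (1 / 2) * e2 - (tr - (finrank ℝ E' : ℕ) * q) * hPP
  rw [e3] at e1
  refine mul_right_cancel₀ hP0 ?_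
  linear_combination e1 - hsum - (tr - 2 * (finrank ℝ E' : ℕ) * q) * hFP

end AdaptedPair

section TopForm

variable {n : ℕ} {V : Type*} [AddCommGroup V] [Module ℝ V]

theorem weightedTopForm_apply {r : ℝ} (b : Basis (Fin n) ℝ V) (β : V [⋀^Fin n]→ₗ[ℝ] Weight n V r)
    (Y : Fin n → V) : (β Y).1 b = b.det Y * (β b).1 b := by
  let L : Weight n V r →ₗ[ℝ] ℝ := LinearMap.proj b ∘ₗ (Weight n V r).subtype
  have h := congrArg (fun Ψ : V [⋀^Fin n]→ₗ[ℝ] ℝ => Ψ Y)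
    ((L.compAlternatingMap β).eq_smul_basis_det b)
  exact h.trans (mul_comm _ _)

theorem weightedTopForm_ext {r : ℝ} (b : Basis (Fin n) ℝ V)
    {β β' : V [⋀^Fin n]→ₗ[ℝ] Weight n V r} (h : (β b).1 b = (β' b).1 b) : β = β' :=
  AlternatingMap.ext fun Y => Weight.ext_of_apply b (by
    rw [weightedTopForm_apply b β, weightedTopForm_apply b β', h])

/-- The canonical isomorphism, up to sign, of the weightless forms of top degree with `ℝ`. -/
theorem abs_weightlessTopForm_apply (hn : n ≠ 0) (b b' : Basis (Fin n) ℝ V)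
    (β : V [⋀^Fin n]→ₗ[ℝ] Weight n V (n : ℕ)) : |(β b').1 b'| = |(β b).1 b| := by
  have hd : 0 < |b.det b'| := abs_pos.2 (b.isUnit_det b').ne_zero
  rw [(β b').2 b b', weightedTopForm_apply b β b', div_self (Nat.cast_ne_zero.2 hn),
    Real.rpow_neg_one, ← mul_assoc, abs_mul, abs_mul, abs_inv, abs_abs, inv_mul_cancel₀ hd.ne',
    one_mul]

end TopForm

section AdaptedPair

variable {E : Type*} [NormedAddCommGroup E] [NormedSpace ℝ E]
  {H : Type*} [TopologicalSpace H] {I : ModelWithCorners ℝ E H}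
  {M : Type*} [TopologicalSpace M] [ChartedSpace H M] [FiniteDimensional ℝ E] [IsManifold I ∞ M]
  {E' : Type*} [NormedAddCommGroup E'] [NormedSpace ℝ E'] [FiniteDimensional ℝ E']
  {H' : Type*} [TopologicalSpace H'] {I' : ModelWithCorners ℝ E' H'}
  {N : Type*} [TopologicalSpace N] [ChartedSpace H' N] [IsManifold I' ∞ N]
  {E'' : Type*} [NormedAddCommGroup E''] [NormedSpace ℝ E'']
  {H'' : Type*} [TopologicalSpace H''] {I'' : ModelWithCorners ℝ E'' H''}
  {N' : Type*} [TopologicalSpace N'] [ChartedSpace H'' N'] [IsManifold I'' ∞ N']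
  {c : ConformalStructure I M} {c' : ConformalStructure I' N} {D : WeylStructure c}
  {p : M → N} {p' : M → N'} {π : E →L[ℝ] E'}
  {π' : E →L[ℝ] E''} {ι : E' →L[ℝ] E} {ι' : E'' →L[ℝ] E}

theorem IsAdaptedPair.det_gramMatrix_pos (h : IsAdaptedPair I' I'' D p p' π π' ι ι')
    (hs : IsConformalSubmersion c c' p) {z₀ z : M} (hz : z ∈ (chartAt H z₀).source) {u₀ : E'}
    (hu₀ : u₀ ≠ 0) : 0 < (gramMatrix c z₀ ι u₀ (factorFrame I z₀ ι z)).det := by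
  have hpos := c'.pos _ _ (h.mfderiv_inl_ne_zero hz hu₀) (coordFrame I' (p z₀) (p z))
  have h1 := h.det_gramMatrix_mul hs hz hu₀
  exact pos_of_mul_pos_left (h1 ▸ one_pos) (pow_pos hpos _).le

omit [FiniteDimensional ℝ E'] [IsManifold I'' ∞ N'] in
/-- A form on a factor vanishes if it vanishes on the coordinate vectors of the factor. -/
theorem IsAdaptedPair.form_eq_zero_of_coordInl (h : IsAdaptedPair I' I'' D p p' π π' ι ι')
    {z₀ z : M} (hz : z ∈ (chartAt H z₀).source) {k : ℕ} {r : ℝ}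
    {α : TangentSpace I z [⋀^Fin k]→ₗ[ℝ] WeightAt I r z}
    (hα : ∀ Y i, mfderiv I I' p z (Y i) = 0 → α Y = 0)
    (h0 : α.compLinearMap (coordInl hz ι) = 0) : α = 0 := by
  refine AlternatingMap.ext fun Y => ?_
  rw [h.form_apply_eq hz hα, AlternatingMap.zero_apply]
  exact congrArg (fun L : E' [⋀^Fin k]→ₗ[ℝ] WeightAt I r z =>
    L fun i => π (coordVec I z₀ z (Y i))) h0

theorem IsAdaptedPair.le_finrank [Nontrivial E'] (h : IsAdaptedPair I' I'' D p p' π π' ι ι')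
    {k : ℕ} {r : ℝ} {φ : WeightedForm I M k r} (hφ : IsSectionOfPullback c c' p φ)
    (hne : ∃ z, φ z ≠ 0) : k ≤ finrank ℝ E' := by
  by_contra! hk
  obtain ⟨z, hz⟩ := hne
  refine hz (h.form_eq_zero_of_coordInl (mem_chart_source H z) (h.form_eq_zero hφ z)
    (AlternatingMap.ext fun u => ?_))
  refine AlternatingMap.map_linearDependent _ u fun hu => ?_
  have := hu.fintype_card_le_finrank
  rw [Fintype.card_fin] at this
  exact absurd this (not_le.2 hk)

variable [I.Boundaryless]

theorem IsAdaptedPair.parallel_of_isPullbackOfVolume [Nontrivial E']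
    (h : IsAdaptedPair I' I'' D p p' π π' ι ι') (hs : IsConformalSubmersion c c' p) {k : ℕ}
    {φ : WeightlessForm I M k} (hφ : IsSectionOfPullback c c' p φ)
    (hv : IsPullbackOfVolume c c' p φ) : WeightedForm.Parallel D.cov φ := by
  obtain ⟨η, ⟨-, rfl, hη⟩, a, ha, hpull⟩ := hv
  obtain ⟨u₀, hu₀⟩ := exists_ne (0 : E')
  refine h.parallel_of_sq_eq hφ.1 (h.form_eq_zero hφ) hu₀ (pow_ne_zero 2 ha)
    (fun z₀ z hz => (h.det_gramMatrix_pos hs hz hu₀).ne') fun z₀ z hz => ?_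
  rw [← h.sq_apply_mul_det hs hz hu₀ (hpull z)]
  congr 1
  change (a * (η (p z) (coordFrame I' (p z₀) (p z))).1 (coordFrame I' (p z₀) (p z))) ^ 2 = a ^ 2
  have h1 : |(η (p z) (coordFrame I' (p z₀) (p z))).1 (coordFrame I' (p z₀) (p z))| = 1 :=
    hη (p z) (coordFrame I' (p z₀) (p z))
  rw [mul_pow, ← sq_abs ((η (p z) _).1 _), h1, one_pow, mul_one]

/-- If a form of top degree on a factor is parallel, its coefficient in a frame of coordinate fields of
the factor, with the corresponding trivialization of the weight bundle, is locally constant. -/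
theorem IsAdaptedPair.eventually_apply_coordFrame_eq [T2Space M] [ConnectedSpace M] [Nontrivial E']
    (h : IsAdaptedPair I' I'' D p p' π π' ι ι') (hs : IsConformalSubmersion c c' p)
    {φ : WeightlessForm I M (finrank ℝ E')} (hφ : IsSectionOfPullback c c' p φ)
    (hp : WeightedForm.Parallel D.cov φ) (hne : ∃ z, φ z ≠ 0)
    {β : ∀ z, TangentSpace I' (p z) [⋀^Fin (finrank ℝ E')]→ₗ[ℝ] WeightAt I' (finrank ℝ E' : ℕ) (p z)}
    (hβ : ∀ z, IsFormPullbackAt c c' p z (φ z) (β z)) (z₀ : M) :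
    (β z₀ (coordFrame I' (p z₀) (p z₀))).1 (coordFrame I' (p z₀) (p z₀)) ≠ 0 ∧
    ∀ᶠ z in 𝓝 z₀, (β z (coordFrame I' (p z₀) (p z))).1 (coordFrame I' (p z₀) (p z))
      = (β z₀ (coordFrame I' (p z₀) (p z₀))).1 (coordFrame I' (p z₀) (p z₀)) := by
  have : CompleteSpace E := FiniteDimensional.complete ℝ E
  obtain ⟨u₀, hu₀⟩ := exists_ne (0 : E')
  have hn : 1 ≤ finrank ℝ E := finrank_pos_iff.2 ⟨ι u₀, 0, h.inl_ne_zero hu₀⟩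
  have hUo : IsOpen (chartAt H z₀).source := (chartAt H z₀).open_source
  have hz₀ := mem_chart_source H z₀
  have hker := h.form_eq_zero hφ
  set P : M → ℝ := fun z => gaugeForm c (coordField I z₀ (ι u₀) z) (φ z) (factorFrame I z₀ ι z)
    with hP
  set θ : M → ℝ := fun z => (β z (coordFrame I' (p z₀) (p z))).1 (coordFrame I' (p z₀) (p z))
    with hθ
  have hPc : ContinuousAt P z₀ := (gaugeForm_smooth (c := c) hUo (coordField_smooth z₀ (ι u₀))
    (fun y hy => coordField_ne_zero hy (h.inl_ne_zero hu₀)) hφ.1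
    (Y := fun i => coordField I z₀ (ι (finBasis ℝ E' i)))
    (fun i => coordField_smooth z₀ _)).continuousOn.continuousAt (hUo.mem_nhds hz₀)
  have hP0 : P z₀ ≠ 0 := by
    intro h0
    refine parallel_ne_zero hn D hφ.1 hp hne z₀ (AlternatingMap.ext fun Y => ?_)
    have h1 := h.gaugeForm_eq (c := c) hz₀ u₀ (hker z₀) Y
    simp only [hP] at h0
    rw [h0, mul_zero, gaugeForm_eq_zero_iff (coordField_ne_zero hz₀ (h.inl_ne_zero hu₀))] at h1
    rw [h1, AlternatingMap.zero_apply]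
  have hsign : ∀ᶠ z in 𝓝 z₀, 0 < P z * P z₀ :=
    (hPc.mul continuousAt_const).eventually_const_lt (mul_self_pos.2 hP0)
  have hsq : ∀ z ∈ (chartAt H z₀).source,
      θ z ^ 2 = P z ^ 2 / (gramMatrix c z₀ ι u₀ (factorFrame I z₀ ι z)).det := fun z hz =>
    (eq_div_iff (h.det_gramMatrix_pos hs hz hu₀).ne').2 (h.sq_apply_mul_det hs hz hu₀ (hβ z))
  have hPθ : ∀ z ∈ (chartAt H z₀).source, ∃ s : ℝ, 0 < s ∧ θ z = P z * s := fun z hz =>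
    h.apply_coordFrame_eq hz hu₀ (hβ z)
  obtain ⟨s₀, hs₀, hθ₀⟩ := hPθ z₀ hz₀
  refine ⟨?_, ?_⟩
  · change θ z₀ ≠ 0
    rw [hθ₀]
    exact mul_ne_zero hP0 hs₀.ne'
  filter_upwards [hsign, hUo.mem_nhds hz₀, h.eventually_sq_div_eq hφ.1 hp hker z₀ hu₀
    fun z hz => (h.det_gramMatrix_pos hs hz hu₀).ne'] with z hz1 hz hz2
  change θ z = θ z₀
  have h1 : θ z ^ 2 = θ z₀ ^ 2 := by rw [hsq z hz, hsq z₀ hz₀]; exact hz2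
  obtain ⟨s, hs, hθz⟩ := hPθ z hz
  rcases sq_eq_sq_iff_eq_or_eq_neg.1 h1 with h2 | h2
  · exact h2
  · -- the signs of `θ z` and `θ z₀` are those of `P z` and `P z₀`
    have h3 : 0 < θ z * θ z₀ := by
      rw [hθz, hθ₀, mul_mul_mul_comm]
      exact mul_pos hz1 (mul_pos hs hs₀)
    rw [h2] at h3
    nlinarith [mul_self_nonneg (θ z₀)]

end AdaptedPair

section AdaptedPair

variable {E : Type*} [NormedAddCommGroup E] [NormedSpace ℝ E]
  {H : Type*} [TopologicalSpace H] {I : ModelWithCorners ℝ E H}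
  {M : Type*} [TopologicalSpace M] [ChartedSpace H M] [FiniteDimensional ℝ E] [IsManifold I ∞ M]
  {E' : Type*} [NormedAddCommGroup E'] [NormedSpace ℝ E'] [FiniteDimensional ℝ E']
  {H' : Type*} [TopologicalSpace H'] {I' : ModelWithCorners ℝ E' H'}
  {N : Type*} [TopologicalSpace N] [ChartedSpace H' N] [IsManifold I' ∞ N]
  {E'' : Type*} [NormedAddCommGroup E''] [NormedSpace ℝ E'']
  {H'' : Type*} [TopologicalSpace H''] {I'' : ModelWithCorners ℝ E'' H''}
  {N' : Type*} [TopologicalSpace N'] [ChartedSpace H'' N'] [IsManifold I'' ∞ N']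
  {c : ConformalStructure I M} {c' : ConformalStructure I' N} {D : WeylStructure c}
  {p : M → N} {p' : M → N'} {π : E →L[ℝ] E'}
  {π' : E →L[ℝ] E''} {ι : E' →L[ℝ] E} {ι' : E'' →L[ℝ] E} [I.Boundaryless]

/-- A parallel form of top degree on a factor is a multiple of the pull-back of a weightless volume
form: it has constant length, and it is constant along the fibres because they are connected. -/
theorem IsAdaptedPair.isPullbackOfVolume [T2Space M] [ConnectedSpace M] [Nontrivial E']
    (h : IsAdaptedPair I' I'' D p p' π π' ι ι') (hs : IsConformalSubmersion c c' p)
    (hopen : IsOpenMap p) (hsurj : Function.Surjective p) (hfib : ∀ y, IsPreconnected (p ⁻¹' {y}))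
    {φ : WeightlessForm I M (finrank ℝ E')} (hφ : IsSectionOfPullback c c' p φ)
    (hp : WeightedForm.Parallel D.cov φ) (hne : ∃ z, φ z ≠ 0) : IsPullbackOfVolume c c' p φ := by
  have hn : finrank ℝ E' ≠ 0 := finrank_pos.ne'
  choose β hβ using hφ.2
  have hloc := h.eventually_apply_coordFrame_eq hs hφ hp hne hβ
  -- the tangent spaces of `N` are all equal to `E'` as types, so that values of `β` at different
  -- points of a fibre can be compared
  let B : M → E' [⋀^Fin (finrank ℝ E')]→ₗ[ℝ] Weight (finrank ℝ E') E' (finrank ℝ E' : ℕ) :=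
    fun z => β z
  let e : M → N → Basis (Fin (finrank ℝ E')) ℝ E' := fun z₀ y => coordFrame I' (p z₀) y
  have hB0 : ∀ z₀, (B z₀ (e z₀ (p z₀))).1 (e z₀ (p z₀)) ≠ 0 := fun z₀ => (hloc z₀).1
  have hBloc : ∀ z₀, ∀ᶠ z in 𝓝 z₀, (B z (e z₀ (p z))).1 (e z₀ (p z))
      = (B z₀ (e z₀ (p z₀))).1 (e z₀ (p z₀)) := fun z₀ => (hloc z₀).2
  let b := finBasis ℝ E'
  have habs : ∀ z (b' : Basis (Fin (finrank ℝ E')) ℝ E'), |(B z b').1 b'| = |(B z b).1 b| :=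
    fun z b' => abs_weightlessTopForm_apply hn b b' (B z)
  have hconst : ∀ z w, |(B z b).1 b| = |(B w b).1 b| := fun z w => by
    refine IsLocallyConstant.apply_eq_of_preconnectedSpace (f := fun z => |(B z b).1 b|)
      ((IsLocallyConstant.iff_eventually_eq _).2 fun z₀ => ?_) z w
    filter_upwards [hBloc z₀] with z hz
    rw [← habs z (e z₀ (p z)), hz, habs]
  obtain ⟨z₁, -⟩ := hne
  set a := |(B z₁ b).1 b| with ha
  have ha0 : a ≠ 0 := by
    rw [ha, ← habs z₁ (e z₁ (p z₁))]
    exact abs_ne_zero.2 (hB0 z₁)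
  have hfibre : ∀ z w, p z = p w → B z = B w := by
    intro z w hzw
    have : PreconnectedSpace (p ⁻¹' {p w}) := isPreconnected_iff_preconnectedSpace.1 (hfib (p w))
    refine IsLocallyConstant.apply_eq_of_preconnectedSpace
      (f := fun z : p ⁻¹' {p w} => B z.1) ((IsLocallyConstant.iff_eventually_eq _).2 ?_)
      ⟨z, hzw⟩ ⟨w, rfl⟩
    rintro ⟨z₀, hz₀⟩
    filter_upwards [continuous_subtype_val.continuousAt.eventually (hBloc z₀)] with z hz
    have hpz : p z.1 = p z₀ := z.2.trans hz₀.symm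
    rw [hpz] at hz
    exact weightedTopForm_ext (e z₀ (p z₀)) hz
  let s : N → M := Function.surjInv hsurj
  have hs' : ∀ y, p (s y) = y := Function.surjInv_eq hsurj
  let η : WeightlessForm I' N (finrank ℝ E') := fun y => a⁻¹ • B (s y)
  have hη : ∀ z, (η (p z) : E' [⋀^Fin (finrank ℝ E')]→ₗ[ℝ]
      Weight (finrank ℝ E') E' (finrank ℝ E' : ℕ)) = a⁻¹ • B z := fun z =>
    congrArg (fun β => a⁻¹ • β) (hfibre _ _ (hs' (p z)))
  refine ⟨η, ⟨?_, rfl, fun y b' => ?_⟩, a, ha0, fun z => ?_⟩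
  · intro W hW f hf t y hy
    obtain ⟨z₀, rfl⟩ := hsurj y
    obtain ⟨V, hV, hVo, hz₀⟩ := eventually_nhds_iff.1 (hBloc z₀)
    set U := W ∩ (chartAt H' (p z₀)).source ∩ p '' V with hU
    have hUo : IsOpen U := (hW.inter (chartAt H' (p z₀)).open_source).inter (hopen V hVo)
    have hUW : U ⊆ W := fun y hy => hy.1.1
    have hUs : U ⊆ (chartAt H' (p z₀)).source := fun y hy => hy.1.2
    have hyU : p z₀ ∈ U := ⟨⟨hy, mem_chart_source H' _⟩, z₀, hz₀, rfl⟩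
    have hdet : ContMDiffOn I' 𝓘(ℝ, ℝ) ∞
        (fun y => (coordFrame I' (p z₀) y).det (fun i => f y (t i))) U := by
      simp only [Basis.det_apply, Matrix.det_apply', Basis.toMatrix_apply]
      exact contMDiffOn_finsetSum fun σ _ => ContMDiffOn.mul contMDiffOn_const
        (contMDiffOn_finsetProd fun i _ =>
          coordFrame_repr_smooth hUo hUs ((hf (t i)).mono hUW) _)
    refine ((weight_smooth_of_coordFrame (l := fun y => η y (fun i => f y (t i))) hUo hUs
      ((hdet.mul (contMDiffOn_const
        (c := a⁻¹ * (B z₀ (e z₀ (p z₀))).1 (e z₀ (p z₀))))).congr fun y hy => ?_)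
      (hf.mono hUW)).contMDiffAt (hUo.mem_nhds hyU)).contMDiffWithinAt
    obtain ⟨-, z, hz, rfl⟩ := hy
    rw [← hV z hz]
    have h1 := weightedTopForm_apply (coordFrame I' (p z₀) (p z)) (η (p z)) fun i => f (p z) (t i)
    refine h1.trans ?_
    congr 1
    exact congrArg (fun β : E' [⋀^Fin (finrank ℝ E')]→ₗ[ℝ]
      Weight (finrank ℝ E') E' (finrank ℝ E' : ℕ) => (β (e z₀ (p z))).1 (e z₀ (p z))) (hη z)
  · have h1 : |(B (s y) b').1 b'| = a := (habs (s y) b').trans (hconst _ _)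
    change |a⁻¹ * (B (s y) b').1 b'| = 1
    rw [abs_mul, h1, abs_inv, ha, abs_abs, ← ha, inv_mul_cancel₀ ha0]
  · have h1 : (a • η (p z)) = β z := by
      refine (congrArg (fun β : E' [⋀^Fin (finrank ℝ E')]→ₗ[ℝ]
        Weight (finrank ℝ E') E' (finrank ℝ E' : ℕ) => a • β) (hη z)).trans ?_
      rw [smul_smul, mul_inv_cancel₀ ha0, one_smul]
    rw [h1]
    exact hβ z

/-- For a conformal product that is not closed, the parallel weightless forms on a factor are the
multiples of the pull-backs of weightless volume forms. -/
theorem IsAdaptedPair.parallel_iff [T2Space M] [ConnectedSpace M]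
    (h : IsAdaptedPair I' I'' D p p' π π' ι ι') (hs : IsConformalSubmersion c c' p)
    (hopen : IsOpenMap p) (hsurj : Function.Surjective p) (hfib : ∀ y, IsPreconnected (p ⁻¹' {y}))
    (hn : 1 ≤ finrank ℝ E') (hn' : 1 ≤ finrank ℝ E'') (hD : ¬ D.Closed) {k : ℕ} (hk : 1 ≤ k)
    {φ : WeightlessForm I M k} (hne : ∃ z, φ z ≠ 0) (hφ : IsSectionOfPullback c c' p φ) :
    WeightedForm.Parallel D.cov φ ↔ IsPullbackOfVolume c c' p φ := by
  have : Nontrivial E' := finrank_pos_iff.1 hn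
  refine ⟨fun hp => ?_, h.parallel_of_isPullbackOfVolume hs hφ⟩
  obtain rfl : k = finrank ℝ E' := by
    refine (h.le_finrank hφ hne).eq_of_not_lt fun hlt => hD ?_
    exact h.closed hn' hk hlt hφ.1 hp hne (h.form_eq_zero hφ)
  exact h.isPullbackOfVolume hs hopen hsurj hfib hφ hp hne

end AdaptedPair

/-! ### Conformal products -/

section Product

variable {E₁ : Type*} [NormedAddCommGroup E₁] [NormedSpace ℝ E₁]
  {M₁ : Type*} [TopologicalSpace M₁] [ChartedSpace E₁ M₁]
  {E₂ : Type*} [NormedAddCommGroup E₂] [NormedSpace ℝ E₂]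
  {M₂ : Type*} [TopologicalSpace M₂] [ChartedSpace E₂ M₂]

theorem isChartProjection_fst : IsChartProjection (𝓘(ℝ, E₁).prod 𝓘(ℝ, E₂)) 𝓘(ℝ, E₁)
    (Prod.fst : M₁ × M₂ → M₁) (ContinuousLinearMap.fst ℝ E₁ E₂) where
  contMDiff := contMDiff_fst
  mem_source z₀ z hz := by
    rw [prodChartedSpace_chartAt] at hz
    exact hz.1
  extChartAt_eq z₀ z hz := by
    rw [extChartAt_prod]
    rfl

theorem isChartProjection_snd : IsChartProjection (𝓘(ℝ, E₁).prod 𝓘(ℝ, E₂)) 𝓘(ℝ, E₂)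
    (Prod.snd : M₁ × M₂ → M₂) (ContinuousLinearMap.snd ℝ E₁ E₂) where
  contMDiff := contMDiff_snd
  mem_source z₀ z hz := by
    rw [prodChartedSpace_chartAt] at hz
    exact hz.2
  extChartAt_eq z₀ z hz := by
    rw [extChartAt_prod]
    rfl

theorem IsConformalProduct.isAdaptedPair [IsManifold 𝓘(ℝ, E₁) ∞ M₁] [IsManifold 𝓘(ℝ, E₂) ∞ M₂]
    [FiniteDimensional ℝ E₁] [FiniteDimensional ℝ E₂]
    {c₁ : ConformalStructure 𝓘(ℝ, E₁) M₁} {c₂ : ConformalStructure 𝓘(ℝ, E₂) M₂}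
    {c : ConformalStructure (𝓘(ℝ, E₁).prod 𝓘(ℝ, E₂)) (M₁ × M₂)} (hc : IsConformalProduct c₁ c₂ c)
    {D : WeylStructure c} (hD : D.IsAdapted) :
    IsAdaptedPair 𝓘(ℝ, E₁) 𝓘(ℝ, E₂) D (Prod.fst : M₁ × M₂ → M₁) (Prod.snd : M₁ × M₂ → M₂)
      (ContinuousLinearMap.fst ℝ E₁ E₂) (ContinuousLinearMap.snd ℝ E₁ E₂)
      (ContinuousLinearMap.inl ℝ E₁ E₂) (ContinuousLinearMap.inr ℝ E₁ E₂) where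
  fst := isChartProjection_fst
  snd := isChartProjection_snd
  fst_inl _ := rfl
  snd_inr _ := rfl
  fst_inr _ := rfl
  snd_inl _ := rfl
  inl_add_inr x := by simp
  norm_inl_le x := by simp [Prod.norm_def]
  norm_inr_le x := by simp [Prod.norm_def]
  orthogonal z X Y hX hY := by
    rw [c.symm]
    exact hc.orthogonal z Y X hY hX
  parallel_fst W hW Y hY := (hD W hW Y hY).1
  parallel_snd W hW Y hY := (hD W hW Y hY).2

end Product

theorem mainTheorem4
    {E₁ : Type*} [NormedAddCommGroup E₁] [NormedSpace ℝ E₁] [FiniteDimensional ℝ E₁]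
    {M₁ : Type*} [TopologicalSpace M₁] [ChartedSpace E₁ M₁] [IsManifold 𝓘(ℝ, E₁) ∞ M₁]
    [T2Space M₁] [SecondCountableTopology M₁] [ConnectedSpace M₁]
    {E₂ : Type*} [NormedAddCommGroup E₂] [NormedSpace ℝ E₂] [FiniteDimensional ℝ E₂]
    {M₂ : Type*} [TopologicalSpace M₂] [ChartedSpace E₂ M₂] [IsManifold 𝓘(ℝ, E₂) ∞ M₂]
    [T2Space M₂] [SecondCountableTopology M₂] [ConnectedSpace M₂]
    (hn₁ : 1 ≤ finrank ℝ E₁) (hn₂ : 1 ≤ finrank ℝ E₂)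
    (c₁ : ConformalStructure 𝓘(ℝ, E₁) M₁) (c₂ : ConformalStructure 𝓘(ℝ, E₂) M₂)
    (c : ConformalStructure (𝓘(ℝ, E₁).prod 𝓘(ℝ, E₂)) (M₁ × M₂))
    (hc : IsConformalProduct c₁ c₂ c)
    (D : WeylStructure c) (hD : D.IsAdapted) :
    (∀ k : ℕ, 1 ≤ k → k + 1 ≤ finrank ℝ E₁ →
      ∀ φ : WeightlessForm (𝓘(ℝ, E₁).prod 𝓘(ℝ, E₂)) (M₁ × M₂) k,
        IsSectionOfPullback c c₁ (Prod.fst : M₁ × M₂ → M₁) φ → (∃ z, φ z ≠ 0) →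
        WeightedForm.Parallel D.cov φ → D.Closed) ∧
    (¬ D.Closed →
      ∀ k : ℕ, 1 ≤ k → ∀ φ : WeightlessForm (𝓘(ℝ, E₁).prod 𝓘(ℝ, E₂)) (M₁ × M₂) k,
        (∃ z, φ z ≠ 0) →
        (IsSectionOfPullback c c₁ (Prod.fst : M₁ × M₂ → M₁) φ →
          (WeightedForm.Parallel D.cov φ ↔
            IsPullbackOfVolume c c₁ (Prod.fst : M₁ × M₂ → M₁) φ)) ∧
        (IsSectionOfPullback c c₂ (Prod.snd : M₁ × M₂ → M₂) φ →
          (WeightedForm.Parallel D.cov φ ↔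
            IsPullbackOfVolume c c₂ (Prod.snd : M₁ × M₂ → M₂) φ))) := by
  have h := hc.isAdaptedPair hD
  have : Nontrivial E₁ := finrank_pos_iff.1 hn₁
  refine ⟨fun k hk hkn φ hφ hne hp => ?_, fun hcl k hk φ hne => ⟨fun hφ => ?_, fun hφ => ?_⟩⟩
  · exact h.closed hn₂ hk hkn hφ.1 hp hne (h.form_eq_zero hφ)
  · refine h.parallel_iff hc.fst isOpenMap_fst Prod.fst_surjective (fun x => ?_) hn₁ hn₂ hcl hk hne hφ
    have hx : (Prod.fst ⁻¹' {x} : Set (M₁ × M₂)) = {x} ×ˢ Set.univ := by ext; simp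
    rw [hx]
    exact isPreconnected_singleton.prod isPreconnected_univ
  · refine h.symm.parallel_iff hc.snd isOpenMap_snd Prod.snd_surjective (fun y => ?_) hn₂ hn₁ hcl hk
      hne hφ
    have hy : (Prod.snd ⁻¹' {y} : Set (M₁ × M₂)) = Set.univ ×ˢ {y} := by ext; simp
    rw [hy]
    exact isPreconnected_univ.prod isPreconnected_singleton

end
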